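/- For $a,c\in\mathbb C$ and $m\ge 0$ let $A^{a,c}_{m,m+1}(z,\bar z)$ be the $m\times(m+1)$ matrix with rows $0,\dots,m-1$ and columns $0,\dots,m$ whose $(i,j)$ entry is $z$ if $j=i$, $\bar z$ if $j=i+1$, $\bar c$ if $j=i+2$ and $i\neq 0$, $\bar a$ if $j=i+2$ and $i=0$, $c$ if $j=i-1$ and $i\ne m-1$, $a$ if $j=i-1$ and $i=m-1$, and $0$ otherwise. For $0\le k\le m$ let $Q_k^m(z,\bar z)$ be the determinant of this matrix with column $m-k$ removed (so $Q_0^0=1$, and $Q_k^m$ has leading monomial $z^{m-k}\bar z^k$). Identify $(x,y)\in\mathbb R^2$ with $z=x+iy$. There is a family of Borel measures $\mu_{a,c}$ on $\mathbb R^2$ such that, whenever $a$ and $c$ are nonzero complex numbers with $c(c-a)\in\mathbb R$ and $|c|\ge 2|c-a|$: (i) $\mu_{a,c}$ is a finite, nonzero positive measure with compact support; (ii) the polynomials $Q_k^m$ are orthogonal with respect to $\mu_{a,c}$, that is, for all $0\le k\le m$ and every complex polynomial $g(z,\bar z)$ of total degree less than $m$, $$\int_{\mathbb R^2} Q_k^m(z,\bar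 z)\,\overline{g(z,\bar z)}\,d\mu_{a,c}=0;$$ (iii) for every $m\ge1$ a Gaussian cubature rule of degree $2m-1$ exists for $\mu_{a,c}$: there are $N=\dim\Pi_{m-1}^2=\binom{m+1}{2}$ distinct points $x_1,\dots,x_N\in\mathbb R^2$ and nonzero real weights $\lambda_1,\dots,\lambda_N$ with $\int f\,d\mu_{a,c}=\sum_{j=1}^N\lambda_j f(x_j)$ for all real polynomials $f$ in two variables of degree at most $2m-1$. Moreover, the family (and already its one-parameter subfamily $c=1$, $\tfrac12\le a\le\tfrac32$) contains the Chebyshev weight of the second kind on the deltoid, dilated by $3$: $\mu_{1,1}$ is the image, under $(x,y)\mapsto(3x,3y)$, of the measure $w_{1/2}(x,y)\,dx\,dy$ on $\Delta$, where $w_{1/2}(x,y)=\left[-3(x^2+y^2+1)^2+8(x^3-3xy^2)+4\right]^{1/2}$ and $\Delta$ is the closed region bounded by the curve $x+iy=(2e^{i\theta}+e^{-2i\theta})/3$, $0\le\theta\le2\pi$. -/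

import Mathlib

open MeasureTheory MvPolynomial

noncomputable section

namespace GaussCubature

/-! ### The generalized characteristic polynomials -/

/-- The `m × (m + 1)` banded matrix with `z` on the main diagonal, `z̄` on the first
superdiagonal, `c̄` on the second superdiagonal and `c` on the first subdiagonal, except that the
entry of the second superdiagonal in the first row is `ā` and the entry of the subdiagonal in the
last row is `a`. The entries are polynomials in two variables: `X 0` stands for `z` and `X 1` for
`z̄`. -/
def charMatrix (a c : ℂ) (m : ℕ) : Matrix (Fin m) (Fin (m + 1)) (MvPolynomial (Fin 2) ℂ) :=
  Matrix.of fun i j =>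
    if (j : ℕ) = i then X 0
    else if (j : ℕ) = i + 1 then X 1
    else if (j : ℕ) = i + 2 then C (starRingEnd ℂ (if (i : ℕ) = 0 then a else c))
    else if (j : ℕ) + 1 = i then C (if (i : ℕ) + 1 = m then a else c)
    else 0

/-- `Q_k^m` for `0 ≤ k ≤ m`: the determinant of `charMatrix a c m` with the column of index
`m - k` removed (columns are numbered `0, …, m`); its leading monomial is `z^(m-k) z̄^k`. -/
def Q (a c : ℂ) (m : ℕ) (k : Fin (m + 1)) : MvPolynomial (Fin 2) ℂ :=
  ((charMatrix a c m).submatrix id (Fin.succAbove (Fin.rev k))).det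

/-! ### Orthogonality in conjugate complex variables and Gaussian cubature -/

/-- The value at `(x, y) ∈ ℝ²` of a polynomial in `z, z̄`, where `z = x + iy`, `z̄ = x - iy`. -/
def evalConj (p : MvPolynomial (Fin 2) ℂ) (v : Fin 2 → ℝ) : ℂ :=
  eval ![(v 0 : ℂ) + Complex.I * v 1, (v 0 : ℂ) - Complex.I * v 1] p

/-- The polynomial `p` in `z, z̄` is orthogonal to all polynomials in `z, z̄` of total degree
less than `n`, for the inner product `⟨f, g⟩ = ∫ f(z, z̄) conj (g(z, z̄)) dμ`. -/
def IsOrthogonalToLower (μ : Measure (Fin 2 → ℝ)) (n : ℕ) (p : MvPolynomial (Fin 2) ℂ) : Prop :=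
  ∀ g : MvPolynomial (Fin 2) ℂ, g.totalDegree < n →
    ∫ v, evalConj p v * starRingEnd ℂ (evalConj g v) ∂μ = 0

/-- There is a cubature rule of degree `M` with `N` (distinct) real nodes and nonzero real
weights for the integral against `μ`. -/
def HasCubatureRule (μ : Measure (Fin 2 → ℝ)) (M N : ℕ) : Prop :=
  ∃ (nodes : Finset (Fin 2 → ℝ)) (weight : (Fin 2 → ℝ) → ℝ),
    nodes.card = N ∧ (∀ x ∈ nodes, weight x ≠ 0) ∧
    ∀ f : MvPolynomial (Fin 2) ℝ, f.totalDegree ≤ M →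
      ∫ v, eval v f ∂μ = ∑ x ∈ nodes, weight x * eval x f

/-- A Gaussian cubature rule of degree `2m - 1` (for `m ≥ 1`): the number of nodes is the
dimension `(m + 1).choose 2` of the space of real polynomials of degree at most `m - 1` in two
variables. -/
def HasGaussianCubature (μ : Measure (Fin 2 → ℝ)) (m : ℕ) : Prop :=
  HasCubatureRule μ (2 * m - 1) ((m + 1).choose 2)

/-! ### The Chebyshev weight of the second kind on the deltoid -/

/-- The Steiner hypocycloid `(2 e^{iθ} + e^{-2iθ}) / 3`. -/
def steiner (θ : ℝ) : Fin 2 → ℝ :=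
  ![(2 * Real.cos θ + Real.cos (2 * θ)) / 3, (2 * Real.sin θ - Real.sin (2 * θ)) / 3]

/-- The closed region bounded by the Steiner hypocycloid, i.e. the union of the segments from the
origin to the points of the curve (which is star-shaped about the origin). -/
def deltoid : Set (Fin 2 → ℝ) :=
  {v | ∃ r ∈ Set.Icc (0 : ℝ) 1, ∃ θ : ℝ, v = r • steiner θ}

/-- The quartic `-3 (x² + y² + 1)² + 8 (x³ - 3 x y²) + 4`. -/
def deltoidPoly (v : Fin 2 → ℝ) : ℝ :=
  -3 * ((v 0) ^ 2 + (v 1) ^ 2 + 1) ^ 2 + 8 * ((v 0) ^ 3 - 3 * v 0 * (v 1) ^ 2) + 4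

/-- Restriction of the quartic to the ray through a point of the curve. -/
lemma deltoidPoly_smul_steiner (r θ : ℝ) :
    deltoidPoly (r • steiner θ) = (1 - r) *
      (3 * r * (r * ((5 + 4 * Real.cos (3 * θ)) / 9) - 1) ^ 2 + (1 - r) ^ 2) := by
  have h := Real.sin_sq_add_cos_sq θ
  have hs : Real.sin θ ^ 2 = 1 - Real.cos θ ^ 2 := by linarith
  simp only [deltoidPoly, steiner, Pi.smul_apply, Matrix.cons_val_zero, Matrix.cons_val_one,
    smul_eq_mul, Real.cos_two_mul, Real.sin_two_mul, Real.cos_three_mul]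
  generalize Real.cos θ = x at *
  generalize Real.sin θ = y at *
  have e : ((r * ((2 * y - 2 * y * x) / 3)) : ℝ) ^ 2
      = r ^ 2 * (4 * (1 - x ^ 2) * (1 - x) ^ 2) / 9 := by
    rw [← hs]; ring
  rw [mul_assoc 3 _ _, e]
  ring

lemma steiner_exists_ray_aux (φ : ℝ) (h0 : 0 ≤ φ) (h1 : φ < 2 * Real.pi / 3) :
    ∃ θ t : ℝ, 0 < t ∧ steiner θ = t • ![Real.cos φ, Real.sin φ] := by
  have hpi := Real.pi_pos
  have hc : Real.cos (2 * Real.pi / 3) = -(1 / 2) := by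
    rw [show 2 * Real.pi / 3 = Real.pi - Real.pi / 3 by ring, Real.cos_pi_sub, Real.cos_pi_div_three]
  have hs : Real.sin (2 * Real.pi / 3) = √3 / 2 := by
    rw [show 2 * Real.pi / 3 = Real.pi - Real.pi / 3 by ring, Real.sin_pi_sub, Real.sin_pi_div_three]
  have hsin : 0 ≤ Real.sin φ := Real.sin_nonneg_of_nonneg_of_le_pi h0 (by linarith)
  have hcont : ContinuousOn
      (fun θ => Real.sin φ * ((2 * Real.cos θ + Real.cos (2 * θ)) / 3)
        - Real.cos φ * ((2 * Real.sin θ - Real.sin (2 * θ)) / 3))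
      (Set.Icc 0 (2 * Real.pi / 3)) := by fun_prop
  have hmem : (0 : ℝ) ∈ Set.Icc
      ((fun θ => Real.sin φ * ((2 * Real.cos θ + Real.cos (2 * θ)) / 3)
        - Real.cos φ * ((2 * Real.sin θ - Real.sin (2 * θ)) / 3)) (2 * Real.pi / 3))
      ((fun θ => Real.sin φ * ((2 * Real.cos θ + Real.cos (2 * θ)) / 3)
        - Real.cos φ * ((2 * Real.sin θ - Real.sin (2 * θ)) / 3)) 0) := by
    constructor
    · have := Real.sin_nonneg_of_nonneg_of_le_pi (x := φ + Real.pi / 3) (by linarith) (by linarith)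
      rw [Real.sin_add, Real.cos_pi_div_three, Real.sin_pi_div_three] at this
      simp only [Real.cos_two_mul, Real.sin_two_mul, hc, hs]
      linarith
    · norm_num
      linarith
  obtain ⟨θ, ⟨hθ0, hθ1⟩, hF⟩ := intermediate_value_Icc' (by linarith) hcont hmem
  simp only [Real.cos_two_mul, Real.sin_two_mul] at hF
  have p1 := Real.sin_sq_add_cos_sq φ
  have p2 := Real.sin_sq_add_cos_sq θ
  set gx := (2 * Real.cos θ + (2 * Real.cos θ ^ 2 - 1)) / 3 with hgx
  set gy := (2 * Real.sin θ - 2 * Real.sin θ * Real.cos θ) / 3 with hgy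
  have ex : gx = (Real.cos φ * gx + Real.sin φ * gy) * Real.cos φ := by
    linear_combination (-gx) * p1 + Real.sin φ * hF
  have ey : gy = (Real.cos φ * gx + Real.sin φ * gy) * Real.sin φ := by
    linear_combination (-gy) * p1 - Real.cos φ * hF
  refine ⟨θ, Real.cos φ * gx + Real.sin φ * gy, ?_, ?_⟩
  · have hy : 0 ≤ gy := by
      have := Real.sin_nonneg_of_nonneg_of_le_pi hθ0 (by linarith)
      have := Real.cos_le_one θ
      rw [hgy]; nlinarith
    have hne : Real.cos φ * gx + Real.sin φ * gy ≠ 0 := by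
      intro h
      rw [h, zero_mul] at ex ey
      have hn : gx ^ 2 + gy ^ 2 = (5 + 4 * (4 * Real.cos θ ^ 3 - 3 * Real.cos θ)) / 9 := by
        rw [hgx, hgy]
        linear_combination (4 * (1 - Real.cos θ) ^ 2 / 9) * p2
      rw [ex, ey, ← Real.cos_three_mul] at hn
      linarith [Real.neg_one_le_cos (3 * θ)]
    rcases hsin.lt_or_eq with hlt | heq
    · refine lt_of_le_of_ne ?_ hne.symm
      by_contra! hneg
      nlinarith
    · have hx0 : 0 ≤ Real.cos φ := by
        have : φ = 0 := by
          by_contra hφ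
          exact (Real.sin_pos_of_pos_of_lt_pi (lt_of_le_of_ne h0 (Ne.symm hφ))
            (by linarith)).ne heq
        simp [this]
      have hθ : θ = 0 := by
        by_contra hθ
        have hsp := Real.sin_pos_of_pos_of_lt_pi (lt_of_le_of_ne hθ0 (Ne.symm hθ)) (by linarith)
        rw [← heq, mul_zero] at ey
        have hc1 : Real.cos θ = 1 := by
          rw [hgy] at ey
          have : Real.sin θ * (1 - Real.cos θ) = 0 := by linarith
          rcases mul_eq_zero.1 this with h | h
          · exact absurd h hsp.ne'
          · linarith
        rw [hc1] at p2
        nlinarith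
      refine lt_of_le_of_ne ?_ hne.symm
      rw [← heq, hgx, hθ]
      norm_num
      exact hx0
  · ext i
    fin_cases i
    · simpa [steiner, Real.cos_two_mul] using ex
    · simpa [steiner, Real.sin_two_mul, ← mul_assoc] using ey

lemma steiner_exists_ray (φ : ℝ) :
    ∃ θ t : ℝ, 0 < t ∧ steiner θ = t • ![Real.cos φ, Real.sin φ] := by
  have hpi := Real.pi_pos
  have hα : 0 < 2 * Real.pi / 3 := by positivity
  set k : ℤ := ⌊φ / (2 * Real.pi / 3)⌋ with hk
  set β : ℝ := k * (2 * Real.pi / 3) with hβ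
  have l0 : 0 ≤ φ - β := by
    have := Int.floor_le (φ / (2 * Real.pi / 3))
    rw [le_div_iff₀ hα] at this
    rw [← hk] at this
    linarith
  have l1 : φ - β < 2 * Real.pi / 3 := by
    have := Int.lt_floor_add_one (φ / (2 * Real.pi / 3))
    rw [div_lt_iff₀ hα] at this
    rw [← hk] at this
    linarith
  obtain ⟨θ, t, ht, h⟩ := steiner_exists_ray_aux _ l0 l1
  have hx : (2 * Real.cos θ + Real.cos (2 * θ)) / 3 = t * Real.cos (φ - β) := by
    simpa [steiner] using congrFun h 0
  have hy : (2 * Real.sin θ - Real.sin (2 * θ)) / 3 = t * Real.sin (φ - β) := by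
    simpa [steiner] using congrFun h 1
  have e2 : 2 * (θ + β) = 2 * θ - β + k * (2 * Real.pi) := by rw [hβ]; ring
  have e3 : φ = (φ - β) + β := by ring
  refine ⟨θ + β, t, ht, ?_⟩
  ext i
  fin_cases i
  · suffices (2 * Real.cos (θ + β) + Real.cos (2 * (θ + β))) / 3 = t * Real.cos φ by
      simpa [steiner] using this
    rw [e2, Real.cos_add_int_mul_two_pi, e3, Real.cos_add (φ - β), Real.cos_add, Real.cos_sub (2 * θ)]
    linear_combination Real.cos β * hx - Real.sin β * hy
  · suffices (2 * Real.sin (θ + β) - Real.sin (2 * (θ + β))) / 3 = t * Real.sin φ by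
      simpa [steiner] using this
    rw [e2, Real.sin_add_int_mul_two_pi, e3, Real.sin_add (φ - β), Real.sin_add, Real.sin_sub (2 * θ)]
    linear_combination Real.sin β * hx + Real.cos β * hy

/-- The deltoid is the set where the quartic is nonnegative. -/
lemma mem_deltoid_iff (v : Fin 2 → ℝ) : v ∈ deltoid ↔ 0 ≤ deltoidPoly v := by
  constructor
  · rintro ⟨r, ⟨h0, h1⟩, θ, rfl⟩
    rw [deltoidPoly_smul_steiner]
    have : 0 ≤ 1 - r := by linarith
    positivity
  · intro h
    obtain ⟨φ, hφ⟩ : ∃ φ : ℝ, v = ‖(⟨v 0, v 1⟩ : ℂ)‖ • ![Real.cos φ, Real.sin φ] := by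
      refine ⟨Complex.arg ⟨v 0, v 1⟩, ?_⟩
      ext i
      fin_cases i
      · simp
      · simp
    obtain ⟨θ, t, ht, hθ⟩ := steiner_exists_ray φ
    have hv : v = (‖(⟨v 0, v 1⟩ : ℂ)‖ / t) • steiner θ := by
      rw [hθ, smul_smul, div_mul_cancel₀ _ ht.ne']; exact hφ
    have hr : 0 ≤ ‖(⟨v 0, v 1⟩ : ℂ)‖ / t := by positivity
    generalize ‖(⟨v 0, v 1⟩ : ℂ)‖ / t = r at hv hr
    refine ⟨r, ⟨hr, ?_⟩, θ, hv⟩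
    rw [hv, deltoidPoly_smul_steiner] at h
    by_contra! hlt
    have : 0 < 3 * r * (r * ((5 + 4 * Real.cos (3 * θ)) / 9) - 1) ^ 2 + (1 - r) ^ 2 := by
      have : 0 < (1 - r) ^ 2 := by apply sq_pos_of_ne_zero; linarith
      positivity
    nlinarith

/-- The measure `w_{1/2}(x, y) dx dy` on the deltoid, where `w_α = deltoidPoly ^ α`. -/
def deltoidMeasure : Measure (Fin 2 → ℝ) :=
  (volume.restrict deltoid).withDensity fun v => ENNReal.ofReal √(deltoidPoly v)

end GaussCubature

end

open MeasureTheory MvPolynomial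

noncomputable section

namespace GaussCubature

/-! Put b = a/c - 1, so |b| ≤ 1/2, and choose τ with τ²/conj τ = c. Scaling rows and columns of the
banded matrix (`exists_eval_Q_eq`) shows that, after z ↦ τz, each Q is a constant times a maximal
minor of the matrix with c = 1 and a = 1 + b. So everything reduces to c = 1, and the general
measure is an image under multiplication by τ.

For c = 1 write z = t₀ + t₁ + t₂ with unimodular tᵢ of product one; then conj z = t₀⁻¹ + t₁⁻¹ +
t₂⁻¹, and the torus covers the dilated deltoid generically six times. The Jacobian is the
Vandermonde product up to a constant, and the weight is the square root of minus a constant times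
the discriminant of the cubic with roots tᵢ. Hence the Chebyshev measure pulls back to a constant
times |Vandermonde|² dθ (`map_torusMap_eq`). The measure for parameter b is the Chebyshev measure
divided by |D|², where D = ∏ (1 + b tᵢ³).

Orthogonality. Vandermonde times a minor is, up to a constant, a combination of four A₂ alternants
(`bandMinor_eq`, `bandMinor_one_eq`). Collected by the six permutations, each term is u^x w^(-y) (1
+ conj b u⁻³)(1 + b w³) with x + y = m + 2. These two factors cancel against |D|², leaving (1 + b
u³)(1 + conj b w⁻³) and the two factors in v. Give u, v, w⁻¹ the degrees 1, 0, 1. The geometric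
series of the four inverses contain only degrees ≥ 0, the second Vandermonde lowers degree by at
most 2, and a test polynomial of degree below m by less than m. Only positive degrees remain, and a
monomial of positive degree has integral zero over the torus (`integral_laurent_term_eq_zero`,
`integral_bandAlternant`).

Cubature. The signed maximal minors lie in the kernel of the matrix, so z Q_(k+1) - conj z Q_k is in
the span of the Q's of the same degree (`X_mul_Q_sub`), hence orthogonal to lower degree. This is
what makes the compressions of multiplication by z and conj z to polynomials of degree < m commute.
They are mutually adjoint, so they are jointly diagonalisable; the joint eigenvalues are the nodes,
and the squared norms of the components of the constant 1 are the weights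
(`exists_cubature_of_orthogonal`). -/

/-! ### Expansions of banded determinants -/

section Expansion

variable {R : Type*} [CommRing R]

/-- The determinant of the leading `n × n` section of an infinite matrix. -/
def sectionDet (f : ℕ → ℕ → R) (n : ℕ) : R :=
  (Matrix.of fun i j : Fin n => f i j).det

lemma sectionDet_congr {f g : ℕ → ℕ → R} {n : ℕ} (h : ∀ i < n, ∀ j < n, f i j = g i j) :
    sectionDet f n = sectionDet g n := by
  unfold sectionDet
  congr 1
  ext i j
  exact h i i.2 j j.2

lemma sectionDet_transpose (f : ℕ → ℕ → R) (n : ℕ) :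
    sectionDet (fun i j => f j i) n = sectionDet f n := by
  unfold sectionDet
  rw [← Matrix.det_transpose]
  rfl

/-- Column expansion when only the first two entries of the first column are nonzero. -/
lemma sectionDet_column_two (f : ℕ → ℕ → R) (n : ℕ) (h : ∀ i, 2 ≤ i → f i 0 = 0) :
    sectionDet f (n + 2) = f 0 0 * sectionDet (fun i j => f (i + 1) (j + 1)) (n + 1)
      - f 1 0 * sectionDet (fun i j => f (if i = 0 then 0 else i + 1) (j + 1)) (n + 1) := by
  unfold sectionDet
  rw [Matrix.det_succ_column_zero, Fin.sum_univ_succ, Fin.sum_univ_succ, Finset.sum_eq_zero]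
  · have e : (Matrix.of fun i j : Fin (n + 2) => f i j).submatrix (Fin.succAbove (Fin.succ 0))
        Fin.succ = Matrix.of fun i j : Fin (n + 1) => f (if (i : ℕ) = 0 then 0 else i + 1) (j + 1) := by
      ext i j
      refine Fin.cases ?_ (fun i => ?_) i
      · simp
      · simp [Fin.succAbove, Fin.lt_def]
    have e' : (Matrix.of fun i j : Fin (n + 2) => f i j).submatrix Fin.succ Fin.succ
        = Matrix.of fun i j : Fin (n + 1) => f (i + 1) (j + 1) := rfl
    rw [e]
    simp [e', sub_eq_add_neg]
  · intro i _
    simp [h (i + 1 + 1) (by omega)]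

lemma sectionDet_row_two (f : ℕ → ℕ → R) (n : ℕ) (h : ∀ j, 2 ≤ j → f 0 j = 0) :
    sectionDet f (n + 2) = f 0 0 * sectionDet (fun i j => f (i + 1) (j + 1)) (n + 1)
      - f 0 1 * sectionDet (fun i j => f (i + 1) (if j = 0 then 0 else j + 1)) (n + 1) := by
  rw [← sectionDet_transpose, sectionDet_column_two _ _ h, ← sectionDet_transpose,
    ← sectionDet_transpose (fun i j => f (j + 1) _)]

lemma sectionDet_row_one (f : ℕ → ℕ → R) (n : ℕ) (h : ∀ j, 1 ≤ j → f 0 j = 0) :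
    sectionDet f (n + 1) = f 0 0 * sectionDet (fun i j => f (i + 1) (j + 1)) n := by
  unfold sectionDet
  rw [Matrix.det_succ_row_zero, Fin.sum_univ_succ, Finset.sum_eq_zero]
  · have e : (Matrix.of fun i j : Fin (n + 1) => f i j).submatrix Fin.succ Fin.succ
        = Matrix.of fun i j : Fin n => f (i + 1) (j + 1) := rfl
    simp [e]
  · intro i _
    simp [h (i + 1) (by omega)]

/-- Expansion along the first column, with a first row supported on the first two columns. -/
lemma sectionDet_column_row (f : ℕ → ℕ → R) (n : ℕ) (h : ∀ i, 2 ≤ i → f i 0 = 0)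
    (h' : ∀ j, 2 ≤ j → f 0 j = 0) :
    sectionDet f (n + 2) = f 0 0 * sectionDet (fun i j => f (i + 1) (j + 1)) (n + 1)
      - f 1 0 * (f 0 1 * sectionDet (fun i j => f (i + 2) (j + 2)) n) := by
  rw [sectionDet_column_two f n h,
    sectionDet_row_one (fun i j => f (if i = 0 then 0 else i + 1) (j + 1)) n
      (fun j hj => by simpa using h' (j + 1) (by omega))]
  simp

/-- Expansion of a banded determinant along the first row, then along the first column. -/
lemma sectionDet_band (f : ℕ → ℕ → R) (n : ℕ) (h : ∀ j, 2 ≤ j → f 0 j = 0)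
    (h' : ∀ i, 3 ≤ i → f i 0 = 0) (h'' : ∀ j, 3 ≤ j → f 1 j = 0) :
    sectionDet f (n + 3) = f 0 0 * sectionDet (fun i j => f (i + 1) (j + 1)) (n + 2)
      - f 0 1 * (f 1 0 * sectionDet (fun i j => f (i + 2) (j + 2)) (n + 1)
        - f 2 0 * (f 1 2 * sectionDet (fun i j => f (i + 3) (j + 3)) n)) := by
  rw [sectionDet_row_two f (n + 1) h,
    sectionDet_column_row (fun i j => f (i + 1) (if j = 0 then 0 else j + 1)) n
      (fun i hi => by simpa using h' (i + 1) (by omega))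
      (fun j hj => by simpa [show j ≠ 0 by omega] using h'' (j + 1) (by omega))]
  simp

end Expansion

/-! ### The maximal minors of the banded matrix -/

section Minors

variable {R : Type*} [CommRing R]

/-- The entries of the banded matrix with `c = 1`. -/
def bandEntry (a a' z w : R) (m i j : ℕ) : R :=
  if j = i then z
  else if j = i + 1 then w
  else if j = i + 2 then (if i = 0 then a' else 1)
  else if j + 1 = i then (if i + 1 = m then a else 1)
  else 0

/-- The minor of the banded matrix with column `j` removed. -/
def bandMinor (a a' z w : R) (m j : ℕ) : R :=
  sectionDet (fun i l => bandEntry a a' z w m i (if l < j then l else l + 1)) m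

/-- The entries of the square banded matrix that remains when the first row and the first two
columns are removed. -/
def bandTailEntry (a z w : R) (n i j : ℕ) : R :=
  if j = i then w
  else if j = i + 1 then 1
  else if j + 1 = i then z
  else if j + 2 = i then (if i + 1 = n then a else 1)
  else 0

/-- Expanding either of the first two minors leaves these determinants. They see the perturbation
only through the last row, so they form a single sequence with a constant-coefficient recurrence
apart from its start. -/
def bandTail (a z w : R) (n : ℕ) : R := sectionDet (bandTailEntry a z w n) n

lemma bandTail_zero (a z w : R) : bandTail a z w 0 = 1 := by
  simp [bandTail, sectionDet]

lemma bandTail_one (a z w : R) : bandTail a z w 1 = w := by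
  simp [bandTail, sectionDet, bandTailEntry]

lemma bandTail_two (a z w : R) : bandTail a z w 2 = w ^ 2 - z := by
  simp [bandTail, sectionDet, bandTailEntry, Matrix.det_fin_two]
  ring

/-- The perturbed entry sits two places below the diagonal in the last row, so it meets the first
column only in size 3. This is why `a` replaces 1 exactly when n = 0. -/
lemma bandTail_add_three (a z w : R) (n : ℕ) :
    bandTail a z w (n + 3) = w * bandTail a z w (n + 2) - z * bandTail a z w (n + 1)
      + (if n = 0 then a else 1) * bandTail a z w n := by
  have e1 : sectionDet (fun i j => bandTailEntry a z w (n + 3) (i + 1) (j + 1)) (n + 2)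
      = bandTail a z w (n + 2) := by
    refine sectionDet_congr fun i _ j _ => ?_
    simp only [bandTailEntry]
    grind
  have e2 : sectionDet (fun i j => bandTailEntry a z w (n + 3) (i + 2) (j + 2)) (n + 1)
      = bandTail a z w (n + 1) := by
    refine sectionDet_congr fun i _ j _ => ?_
    simp only [bandTailEntry]
    grind
  have e3 : sectionDet (fun i j => bandTailEntry a z w (n + 3) (i + 3) (j + 3)) n
      = bandTail a z w n := by
    refine sectionDet_congr fun i _ j _ => ?_
    simp only [bandTailEntry]
    grind
  rw [bandTail, sectionDet_band, e1, e2, e3]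
  · simp [bandTailEntry]
    ring
  all_goals
    intro j hj
    simp only [bandTailEntry]
    grind

/-- The minors without column 0 and without column 1 seed the kernel recurrence, which produces all
the others. -/
lemma bandMinor_add_three_zero (a a' z w : R) (n : ℕ) :
    bandMinor a a' z w (n + 3) 0 = w * bandTail a z w (n + 2)
      - a' * (z * bandTail a z w (n + 1) - (if n = 0 then a else 1) * bandTail a z w n) := by
  have e0 : bandMinor a a' z w (n + 3) 0
      = sectionDet (fun i j => bandEntry a a' z w (n + 3) i (j + 1)) (n + 3) := by
    simp [bandMinor]
  have e1 : sectionDet (fun i j => bandEntry a a' z w (n + 3) (i + 1) (j + 1 + 1)) (n + 2)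
      = bandTail a z w (n + 2) := by
    refine sectionDet_congr fun i _ j _ => ?_
    simp only [bandTailEntry, bandEntry]
    grind
  have e2 : sectionDet (fun i j => bandEntry a a' z w (n + 3) (i + 2) (j + 2 + 1)) (n + 1)
      = bandTail a z w (n + 1) := by
    refine sectionDet_congr fun i _ j _ => ?_
    simp only [bandTailEntry, bandEntry]
    grind
  have e3 : sectionDet (fun i j => bandEntry a a' z w (n + 3) (i + 3) (j + 3 + 1)) n
      = bandTail a z w n := by
    refine sectionDet_congr fun i _ j _ => ?_
    simp only [bandTailEntry, bandEntry]
    grind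
  rw [e0, sectionDet_band, e1, e2, e3]
  · simp [bandEntry]
  all_goals
    intro j hj
    simp only [bandEntry]
    grind

lemma bandMinor_add_three_one (a a' z w : R) (n : ℕ) :
    bandMinor a a' z w (n + 3) 1 = z * bandTail a z w (n + 2) - a' * bandTail a z w (n + 1) := by
  have e1 : sectionDet (fun i j => bandEntry a a' z w (n + 3) (i + 1)
      (if j + 1 < 1 then j + 1 else j + 1 + 1)) (n + 2) = bandTail a z w (n + 2) := by
    refine sectionDet_congr fun i _ j _ => ?_
    simp only [bandTailEntry, bandEntry]
    grind
  have e2 : sectionDet (fun i j => bandEntry a a' z w (n + 3) (i + 2)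
      (if j + 2 < 1 then j + 2 else j + 2 + 1)) (n + 1) = bandTail a z w (n + 1) := by
    refine sectionDet_congr fun i _ j _ => ?_
    simp only [bandTailEntry, bandEntry]
    grind
  rw [bandMinor, sectionDet_column_row, e1, e2]
  · simp [bandEntry]
  all_goals
    intro j hj
    simp only [bandEntry]
    grind

lemma bandMinor_two_zero (a a' z w : R) : bandMinor a a' z w 2 0 = w ^ 2 - a' * z := by
  simp [bandMinor, sectionDet, bandEntry, Matrix.det_fin_two]
  ring

lemma bandMinor_two_one (a a' z w : R) : bandMinor a a' z w 2 1 = z * w - a' * a := by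
  simp [bandMinor, sectionDet, bandEntry, Matrix.det_fin_two]

lemma bandMinor_one_zero (a a' z w : R) : bandMinor a a' z w 1 0 = w := by
  simp [bandMinor, sectionDet, bandEntry]

lemma bandMinor_one_one (a a' z w : R) : bandMinor a a' z w 1 1 = z := by
  simp [bandMinor, sectionDet, bandEntry]

/-- The signed maximal minors of an `m × (m + 1)` matrix span a vector in its kernel. -/
lemma sum_neg_one_pow_mul_minor_eq_zero {m : ℕ} (M : Matrix (Fin m) (Fin (m + 1)) R) (i : Fin m) :
    ∑ j : Fin (m + 1), (-1) ^ (j : ℕ) * M i j * (M.submatrix id j.succAbove).det = 0 := by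
  -- Put a second copy of row i on top: the determinant is zero, and its expansion along the new row
  -- is the required sum.
  let B : Matrix (Fin (m + 1)) (Fin (m + 1)) R :=
    Matrix.of fun k j => Fin.cases (M i j) (fun l => M l j) k
  have h : B.det = 0 :=
    Matrix.det_zero_of_row_eq (i := 0) (j := i.succ) (Fin.succ_ne_zero i).symm (by ext j; simp [B])
  rw [Matrix.det_succ_row_zero] at h
  exact h

lemma bandMinor_eq_det (a a' z w : R) (m : ℕ) (j : Fin (m + 1)) :
    bandMinor a a' z w m j = ((Matrix.of fun (i : Fin m) (l : Fin (m + 1)) =>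
      bandEntry a a' z w m i l).submatrix id j.succAbove).det := by
  unfold bandMinor sectionDet
  congr 1
  ext i l
  simp only [Matrix.of_apply, Matrix.submatrix_apply, id, Fin.succAbove, Fin.lt_def]
  congr 1
  split_ifs <;> simp_all <;> omega

/-- The kernel relation for the rows other than the last one. -/
lemma bandMinor_add_two (a a' z w : R) {m i : ℕ} (hi : i + 2 ≤ m) :
    (if i = 0 then a' else 1) * bandMinor a a' z w m (i + 2)
      = w * bandMinor a a' z w m (i + 1) - z * bandMinor a a' z w m i
        + if i = 0 then 0 else bandMinor a a' z w m (i - 1) := by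
  have h := sum_neg_one_pow_mul_minor_eq_zero (Matrix.of fun (i : Fin m) (l : Fin (m + 1)) =>
      bandEntry a a' z w m i l) ⟨i, by omega⟩
  simp only [← bandMinor_eq_det, Matrix.of_apply] at h
  rw [Fin.sum_univ_eq_sum_range (fun j => (-1) ^ j * bandEntry a a' z w m i j *
    bandMinor a a' z w m j)] at h
  have hs : (-1 : R) ^ i * (-1) ^ i = 1 := by rw [← mul_pow]; simp
  rcases Nat.eq_zero_or_pos i with rfl | hpos
  · rw [← Finset.sum_subset (s₁ := {0, 1, 2})] at h
    · simp [bandEntry] at h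
      simp
      linear_combination h
    · intro j; simp; omega
    · intro j _ hj
      simp at hj
      have : bandEntry a a' z w m 0 j = 0 := by simp only [bandEntry]; grind
      simp [this]
  · obtain ⟨i, rfl⟩ : ∃ k, i = k + 1 := ⟨i - 1, by omega⟩
    rw [← Finset.sum_subset (s₁ := {i, i + 1, i + 2, i + 3})] at h
    · have hm : i + 1 + 1 ≠ m := by omega
      have hm' : i ≠ i + 1 + 1 := by omega
      simp [bandEntry, hm, hm', pow_succ] at h
      simp
      have hs' : (-1 : R) ^ i * (-1) ^ i = 1 := by rw [← mul_pow]; simp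
      linear_combination (-1) * (-1) ^ i * h + (z * bandMinor a a' z w m (i+1)
        - w * bandMinor a a' z w m (i + 2) + bandMinor a a' z w m (i+3) - bandMinor a a' z w m i) * (-hs')
    · intro j; simp; omega
    · intro j _ hj
      simp at hj
      have : bandEntry a a' z w m (i + 1) j = 0 := by simp only [bandEntry]; grind
      simp [this]

end Minors

/-! ### Alternating sums -/

section Alternant

variable {K : Type*} [Field K]

/-- The alternating sum of the permutations of `t₀ ^ x * t₂ ^ (-y)`. -/
def alternant (t₀ t₁ t₂ : K) (x y : ℤ) : K :=
  t₀ ^ x * t₂ ^ (-y) - t₁ ^ x * t₂ ^ (-y) - t₀ ^ x * t₁ ^ (-y) + t₁ ^ x * t₀ ^ (-y)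
    + t₂ ^ x * t₁ ^ (-y) - t₂ ^ x * t₀ ^ (-y)

/-- Since v = u⁻¹w⁻¹, each summand shifts (x, y) by one of the three weights of the standard
representation of SL₃. -/
lemma sum_mul_zpow {u v w : K} (h : u * v * w = 1) (x y : ℤ) :
    (u + v + w) * (u ^ x * w ^ (-y)) =
      u ^ (x + 1) * w ^ (-y) + u ^ (x - 1) * w ^ (-(y + 1)) + u ^ x * w ^ (-(y - 1)) := by
  have hu : u ≠ 0 := by rintro rfl; simp at h
  have hw : w ≠ 0 := by rintro rfl; simp at h
  have hv : v = u⁻¹ * w⁻¹ := by field_simp; linear_combination h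
  rw [zpow_add_one₀ hu, zpow_sub_one₀ hu, neg_add, neg_sub, sub_eq_add_neg 1 y,
    zpow_add₀ hw, zpow_add₀ hw, zpow_neg_one, zpow_one, hv]
  ring

lemma sum_inv_mul_zpow {u v w : K} (h : u * v * w = 1) (x y : ℤ) :
    (u⁻¹ + v⁻¹ + w⁻¹) * (u ^ x * w ^ (-y)) =
      u ^ x * w ^ (-(y + 1)) + u ^ (x + 1) * w ^ (-(y - 1)) + u ^ (x - 1) * w ^ (-y) := by
  have hu : u ≠ 0 := by rintro rfl; simp at h
  have hw : w ≠ 0 := by rintro rfl; simp at h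
  have hv : v⁻¹ = u * w := by
    exact inv_eq_of_mul_eq_one_left (by linear_combination h)
  rw [zpow_add_one₀ hu, zpow_sub_one₀ hu, neg_add, neg_sub, sub_eq_add_neg 1 y,
    zpow_add₀ hw, zpow_add₀ hw, zpow_neg_one, zpow_one, hv]
  ring

variable {t₀ t₁ t₂ : K}

/-- The Pieri rule. The factor is symmetric, so the monomial identity may be antisymmetrised over
the six orderings. -/
lemma sum_mul_alternant (h : t₀ * t₁ * t₂ = 1) (x y : ℤ) :
    (t₀ + t₁ + t₂) * alternant t₀ t₁ t₂ x y = alternant t₀ t₁ t₂ (x + 1) y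
      + alternant t₀ t₁ t₂ (x - 1) (y + 1) + alternant t₀ t₁ t₂ x (y - 1) := by
  have h1 := sum_mul_zpow (u := t₀) (v := t₁) (w := t₂) (by linear_combination h) x y
  have h2 := sum_mul_zpow (u := t₁) (v := t₀) (w := t₂) (by linear_combination h) x y
  have h3 := sum_mul_zpow (u := t₀) (v := t₂) (w := t₁) (by linear_combination h) x y
  have h4 := sum_mul_zpow (u := t₁) (v := t₂) (w := t₀) (by linear_combination h) x y
  have h5 := sum_mul_zpow (u := t₂) (v := t₀) (w := t₁) (by linear_combination h) x y
  have h6 := sum_mul_zpow (u := t₂) (v := t₁) (w := t₀) (by linear_combination h) x y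
  unfold alternant
  linear_combination h1 - h2 - h3 + h4 + h5 - h6

lemma sum_inv_mul_alternant (h : t₀ * t₁ * t₂ = 1) (x y : ℤ) :
    (t₀⁻¹ + t₁⁻¹ + t₂⁻¹) * alternant t₀ t₁ t₂ x y = alternant t₀ t₁ t₂ x (y + 1)
      + alternant t₀ t₁ t₂ (x + 1) (y - 1) + alternant t₀ t₁ t₂ (x - 1) y := by
  have h1 := sum_inv_mul_zpow (u := t₀) (v := t₁) (w := t₂) (by linear_combination h) x y
  have h2 := sum_inv_mul_zpow (u := t₁) (v := t₀) (w := t₂) (by linear_combination h) x y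
  have h3 := sum_inv_mul_zpow (u := t₀) (v := t₂) (w := t₁) (by linear_combination h) x y
  have h4 := sum_inv_mul_zpow (u := t₁) (v := t₂) (w := t₀) (by linear_combination h) x y
  have h5 := sum_inv_mul_zpow (u := t₂) (v := t₀) (w := t₁) (by linear_combination h) x y
  have h6 := sum_inv_mul_zpow (u := t₂) (v := t₁) (w := t₀) (by linear_combination h) x y
  unfold alternant
  linear_combination h1 - h2 - h3 + h4 + h5 - h6

lemma alternant_zero_left (y : ℤ) : alternant t₀ t₁ t₂ 0 y = 0 := by
  simp only [alternant, zpow_zero]; ring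

lemma alternant_zero_right (x : ℤ) : alternant t₀ t₁ t₂ x 0 = 0 := by
  simp only [alternant, neg_zero, zpow_zero]; ring

lemma zpow_neg_mul_zpow {u v w : K} (h : u * v * w = 1) (x y : ℤ) :
    u ^ (-x) * w ^ (-(x + y)) = v ^ x * w ^ (-y) := by
  have hu : u ≠ 0 := by rintro rfl; simp at h
  have hw : w ≠ 0 := by rintro rfl; simp at h
  have hv : v = u⁻¹ * w⁻¹ := by field_simp; linear_combination h
  rw [hv, mul_zpow, neg_add, zpow_add₀ hw, inv_zpow', inv_zpow']
  ring

lemma zpow_add_mul_zpow {u v w : K} (h : u * v * w = 1) (x y : ℤ) :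
    u ^ (x + y) * w ^ y = u ^ x * v ^ (-y) := by
  have hu : u ≠ 0 := by rintro rfl; simp at h
  have hw : w ≠ 0 := by rintro rfl; simp at h
  have hv : v = u⁻¹ * w⁻¹ := by field_simp; linear_combination h
  rw [hv, mul_zpow, zpow_add₀ hu, inv_zpow', inv_zpow', neg_neg]
  ring

/-- The map (x, y) ↦ (-x, x + y) is a simple reflection of the A₂ Weyl group; on monomials it swaps
two of the variables, which changes the sign. -/
lemma alternant_reflect_left (h : t₀ * t₁ * t₂ = 1) (x y : ℤ) :
    alternant t₀ t₁ t₂ (-x) (x + y) = -alternant t₀ t₁ t₂ x y := by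
  unfold alternant
  rw [zpow_neg_mul_zpow (u := t₀) (v := t₁) (w := t₂) (by linear_combination h) x y,
    zpow_neg_mul_zpow (u := t₁) (v := t₀) (w := t₂) (by linear_combination h) x y,
    zpow_neg_mul_zpow (u := t₀) (v := t₂) (w := t₁) (by linear_combination h) x y,
    zpow_neg_mul_zpow (u := t₁) (v := t₂) (w := t₀) (by linear_combination h) x y,
    zpow_neg_mul_zpow (u := t₂) (v := t₀) (w := t₁) (by linear_combination h) x y,
    zpow_neg_mul_zpow (u := t₂) (v := t₁) (w := t₀) (by linear_combination h) x y]
  ring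

lemma alternant_reflect_right (h : t₀ * t₁ * t₂ = 1) (x y : ℤ) :
    alternant t₀ t₁ t₂ (x + y) (-y) = -alternant t₀ t₁ t₂ x y := by
  unfold alternant
  rw [neg_neg, zpow_add_mul_zpow (u := t₀) (v := t₁) (w := t₂) (by linear_combination h) x y,
    zpow_add_mul_zpow (u := t₁) (v := t₀) (w := t₂) (by linear_combination h) x y,
    zpow_add_mul_zpow (u := t₀) (v := t₂) (w := t₁) (by linear_combination h) x y,
    zpow_add_mul_zpow (u := t₁) (v := t₂) (w := t₀) (by linear_combination h) x y,
    zpow_add_mul_zpow (u := t₂) (v := t₀) (w := t₁) (by linear_combination h) x y,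
    zpow_add_mul_zpow (u := t₂) (v := t₁) (w := t₀) (by linear_combination h) x y]
  ring

/-- The perturbed alternating sum that represents the minors of the banded matrix. -/
def bandAlternant (b b' t₀ t₁ t₂ : K) (x y : ℤ) : K :=
  alternant t₀ t₁ t₂ x y + b' * alternant t₀ t₁ t₂ (x - 3) y + b * alternant t₀ t₁ t₂ x (y - 3)
    + b * b' * alternant t₀ t₁ t₂ (x - 3) (y - 3)

/-- The factor on the left absorbs the exceptional coefficient 1 + b of the tail recurrence. Both
sides then obey X(n+3) = w X(n+2) - z X(n+1) + X(n), which holds for the alternants because those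
with first index 0 vanish. -/
lemma bandTail_eq (h : t₀ * t₁ * t₂ = 1) (b : K) (n : ℕ) :
    (if n = 0 then 1 + b else 1) * alternant t₀ t₁ t₂ 1 1
        * bandTail (1 + b) (t₀ + t₁ + t₂) (t₀⁻¹ + t₁⁻¹ + t₂⁻¹) n
      = alternant t₀ t₁ t₂ 1 (n + 1) + b * alternant t₀ t₁ t₂ 1 (n - 2) := by
  set z := t₀ + t₁ + t₂ with hz
  set w := t₀⁻¹ + t₁⁻¹ + t₂⁻¹ with hw
  set A := alternant t₀ t₁ t₂ with hA
  have hz' : ∀ x y, z * A x y = A (x + 1) y + A (x - 1) (y + 1) + A x (y - 1) :=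
    sum_mul_alternant h
  have hw' : ∀ x y, w * A x y = A x (y + 1) + A (x + 1) (y - 1) + A (x - 1) y :=
    sum_inv_mul_alternant h
  have h0 : ∀ y, A 0 y = 0 := alternant_zero_left
  have h0' : ∀ x, A x 0 = 0 := alternant_zero_right
  have hr : ∀ x y, A (x + y) (-y) = -A x y := alternant_reflect_right h
  have rec3 : ∀ y, A 1 (y + 3) = w * A 1 (y + 2) - z * A 1 (y + 1) + A 1 y := by
    intro y
    have e1 := hw' 1 (y + 2)
    have e2 := hz' 1 (y + 1)
    norm_num [h0] at e1 e2
    ring_nf at e1 e2 ⊢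
    linear_combination (-1) * e1 + e2
  -- A right reflection followed by a left one carries (1, -2) to (1, 1), and the two signs cancel.
  have k0 : A 1 (-2) = A 1 1 := by
    have e1 := hr (-1) 2
    have e2 := alternant_reflect_left h 1 1
    norm_num at e1 e2
    rw [e1, hA, e2, neg_neg]
  have k1 : A 1 (-1) = 0 := by
    have e1 := hr 0 1
    norm_num [h0] at e1
    exact e1
  induction n using Nat.strong_induction_on with
  | _ n ih =>
    match n with
    | 0 => simp [bandTail_zero, k0]; ring
    | 1 =>
      have e := hw' 1 1
      norm_num [h0, h0'] at e
      norm_num [bandTail_one, k1]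
      linear_combination e
    | 2 =>
      have e := rec3 0
      have e' := hw' 1 1
      norm_num [h0, h0'] at e e'
      norm_num [bandTail_two, h0']
      linear_combination (-1) * e + w * e'
    | n + 3 =>
      have i0 := ih n (by omega)
      have i1 := ih (n + 1) (by omega)
      have i2 := ih (n + 2) (by omega)
      simp only [Nat.succ_ne_zero, if_false, Nat.cast_add, Nat.cast_ofNat, Nat.cast_one,
        one_mul] at i1 i2 ⊢
      rw [bandTail_add_three]
      have r1 := rec3 (n + 1)
      have r2 := rec3 (n - 2)
      ring_nf at i0 i1 i2 r1 r2 ⊢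
      linear_combination (-1) * r1 + w * i2 - z * i1 + i0 - b * r2

/-- Columns 0 and 1 come from the tail formula; row i of the kernel relation then gives column i +
2. The coefficient 1 + b' of row 0 must be divided out, hence `hb'`. -/
lemma bandMinor_eq (h : t₀ * t₁ * t₂ = 1) (b b' : K) (hb' : 1 + b' ≠ 0) {m : ℕ} (hm : 2 ≤ m)
    {j : ℕ} (hj : j ≤ m) :
    alternant t₀ t₁ t₂ 1 1
        * bandMinor (1 + b) (1 + b') (t₀ + t₁ + t₂) (t₀⁻¹ + t₁⁻¹ + t₂⁻¹) m j
      = bandAlternant b b' t₀ t₁ t₂ (j + 1) (m - j + 1) := by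
  have hL := bandTail_eq h b
  set z := t₀ + t₁ + t₂ with hz
  set w := t₀⁻¹ + t₁⁻¹ + t₂⁻¹ with hw
  set A := alternant t₀ t₁ t₂ with hA
  set S := bandAlternant b b' t₀ t₁ t₂ with hS
  have hSA : ∀ x y, S x y = A x y + b' * A (x - 3) y + b * A x (y - 3)
    + b * b' * A (x - 3) (y - 3) := fun _ _ => rfl
  have hz' : ∀ x y, z * A x y = A (x + 1) y + A (x - 1) (y + 1) + A x (y - 1) :=
    sum_mul_alternant h
  have hw' : ∀ x y, w * A x y = A x (y + 1) + A (x + 1) (y - 1) + A (x - 1) y :=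
    sum_inv_mul_alternant h
  have h0 : ∀ y, A 0 y = 0 := alternant_zero_left
  have h0' : ∀ x, A x 0 = 0 := alternant_zero_right
  have hr : ∀ x y, A (x + y) (-y) = -A x y := alternant_reflect_right h
  have hl : ∀ x y, A (-x) (x + y) = -A x y := alternant_reflect_left h
  -- The two Pieri expansions share two of their three terms, so only the outer ones remain.
  have hzw : ∀ x y, w * S (x + 1) (y - 1) - z * S x y = S (x + 2) (y - 2) - S (x - 1) (y + 1) := by
    intro x y
    simp only [hSA]
    have e1 := hz' x y
    have e2 := hz' (x - 3) y
    have e3 := hz' x (y - 3)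
    have e4 := hz' (x - 3) (y - 3)
    have f1 := hw' (x + 1) (y - 1)
    have f2 := hw' (x + 1 - 3) (y - 1)
    have f3 := hw' (x + 1) (y - 1 - 3)
    have f4 := hw' (x + 1 - 3) (y - 1 - 3)
    ring_nf at e1 e2 e3 e4 f1 f2 f3 f4 ⊢
    linear_combination f1 + b' * f2 + b * f3 + b * b' * f4 - e1 - b' * e2 - b * e3 - b * b' * e4
  have e21 := hl 2 1
  have f21 := hl 2 0
  have e12 := hr 1 1
  have g12 := hr (-1) 2
  have e11 := hl 1 1
  have e1 := hl 1 (-2)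
  have hw11 := hw' 1 1
  have hz11 := hz' 1 1
  have hw12 := hw' 1 2
  have hz12 := hz' 1 2
  norm_num [h0, h0'] at e21 f21 e12 g12 e11 e1 hw11 hz11 hw12 hz12
  induction j using Nat.strong_induction_on with
  | _ j ih =>
    match j with
    | 0 =>
      rw [hSA]
      rcases hm.lt_or_eq with hm | rfl
      · obtain ⟨n, rfl⟩ : ∃ k, m = k + 3 := ⟨m - 3, by omega⟩
        have i0 := hL n
        have i1 := hL (n + 1)
        have i2 := hL (n + 2)
        simp only [Nat.succ_ne_zero, if_false, Nat.cast_add, Nat.cast_ofNat, Nat.cast_one,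
          one_mul] at i1 i2 ⊢
        rw [bandMinor_add_three_zero]
        generalize (if n = 0 then 1 + b else 1) = κ at i0 ⊢
        have a1 := hw' 1 (n + 3)
        have a2 := hw' 1 n
        have a3 := hz' 1 (n + 2)
        have a4 := hz' 1 (n - 1)
        have a5 := hl 2 (n + 2)
        have a6 := hl 2 (n - 1)
        norm_num [h0] at a1 a2 a3 a4 a5 a6 ⊢
        ring_nf at i0 i1 i2 a1 a2 a3 a4 a5 a6 ⊢
        linear_combination w * i2 - (1 + b') * (z * i1 - i0) + a1 + b * a2 - (1 + b') * (a3 + b * a4)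
          - b' * a5 - b * b' * a6
      · rw [bandMinor_two_zero]
        norm_num [h0, h0', e21, f21]
        linear_combination w * hw11 + hw12 - (1 + b') * hz11
    | 1 =>
      rw [hSA]
      rcases hm.lt_or_eq with hm | rfl
      · obtain ⟨n, rfl⟩ : ∃ k, m = k + 3 := ⟨m - 3, by omega⟩
        have i1 := hL (n + 1)
        have i2 := hL (n + 2)
        simp only [Nat.succ_ne_zero, if_false, Nat.cast_add, Nat.cast_ofNat, Nat.cast_one,
          one_mul] at i1 i2 ⊢
        rw [bandMinor_add_three_one]
        have a1 := hz' 1 (n + 3)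
        have a2 := hz' 1 n
        have a3 := hl 1 (n + 2)
        have a4 := hl 1 (n - 1)
        norm_num [h0] at a1 a2 a3 a4 ⊢
        ring_nf at i1 i2 a1 a2 a3 a4 ⊢
        linear_combination z * i2 - (1 + b') * i1 + a1 + b * a2 - b' * a3 - b * b' * a4
      · rw [bandMinor_two_one]
        norm_num [h0, h0', e11, e12, e1, g12]
        linear_combination z * hw11 + hz12
    | j + 2 =>
      have i0 := ih j (by omega) (by omega)
      have i1 := ih (j + 1) (by omega) (by omega)
      have hk := bandMinor_add_two (1 + b) (1 + b') z w (m := m) (i := j) hj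
      rcases Nat.eq_zero_or_pos j with rfl | hpos
      · have k := hzw 1 (m + 1)
        have a1 := hl 3 (m - 1)
        have a2 := hl 3 (m - 4)
        -- Row 0 of the kernel relation has no predecessor term. Reflecting the leftover boundary
        -- term turns it into b' copies of the target, which matches the perturbed entry 1 + b'.
        have a3 : S 0 (m + 2) = -b' * S 3 (m - 1) := by
          norm_num [hSA, h0]
          ring_nf at a1 a2 ⊢
          linear_combination b' * a1 + b * b' * a2
        refine mul_left_cancel₀ hb' ?_
        simp only [if_true, Nat.cast_zero, zero_add, Nat.cast_one, Nat.cast_ofNat] at hk i0 i1 ⊢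
        ring_nf at a3 k i0 i1 hk ⊢
        linear_combination A 1 1 * hk + w * i1 - z * i0 + k - a3
      · obtain ⟨k, rfl⟩ : ∃ k, j = k + 1 := ⟨j - 1, by omega⟩
        have i2 := ih k (by omega) (by omega)
        simp only [Nat.succ_ne_zero, if_false, one_mul, Nat.add_sub_cancel] at hk
        rw [hk]
        have a := hzw (k + 2) (m - k)
        push_cast at i0 i1 i2 ⊢
        ring_nf at i0 i1 i2 a ⊢
        linear_combination w * i1 - z * i0 + i2 + a

/-- For m = 1 the matrix contains neither perturbed entry. The two middle alternants vanish, and the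
one with coefficient b b' reflects onto minus the main one, so the formula survives with the factor
1 - b b'. -/
lemma bandMinor_one_eq (h : t₀ * t₁ * t₂ = 1) (b b' : K) {j : ℕ} (hj : j ≤ 1) :
    (1 - b * b') * (alternant t₀ t₁ t₂ 1 1
        * bandMinor (1 + b) (1 + b') (t₀ + t₁ + t₂) (t₀⁻¹ + t₁⁻¹ + t₂⁻¹) 1 j)
      = bandAlternant b b' t₀ t₁ t₂ (j + 1) (1 - j + 1) := by
  have hzz := sum_mul_alternant h 1 1
  have hww := sum_inv_mul_alternant h 1 1
  have h0 := alternant_zero_left (t₀ := t₀) (t₁ := t₁) (t₂ := t₂)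
  have h0' := alternant_zero_right (t₀ := t₀) (t₁ := t₁) (t₂ := t₂)
  have hr := alternant_reflect_right h
  have hl := alternant_reflect_left h
  have e1 := hl 2 0
  have e2 := hr 0 1
  have e3 := hl 2 (-3)
  have e4 := hr (-1) 3
  have e5 := hl 1 2
  have e6 := hl 1 0
  have e7 := hr 0 2
  have e8 := hl 1 (-3)
  have e9 := hr (-2) 3
  have e10 := hl 2 1
  norm_num [h0, h0'] at e1 e2 e3 e4 e5 e6 e7 e8 e9 e10 hzz hww
  unfold bandAlternant
  interval_cases j
  · rw [bandMinor_one_zero]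
    norm_num [e1, e2, e3, e4, e5]
    linear_combination (1 - b * b') * hww
  · rw [bandMinor_one_one]
    norm_num [e6, e7, e8, e9, e10]
    linear_combination (1 - b * b') * hzz

end Alternant

/-! ### The torus parametrization of the deltoid -/

/-- The complex coordinate `z = x + i y`. -/
def toComplex (v : Fin 2 → ℝ) : ℂ := (v 0 : ℂ) + Complex.I * v 1

lemma toComplex_injective : Function.Injective toComplex := by
  intro v v' h
  have h0 := congrArg Complex.re h
  have h1 := congrArg Complex.im h
  simp [toComplex] at h0 h1
  ext i
  fin_cases i <;> assumption

lemma conj_toComplex (v : Fin 2 → ℝ) :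
    starRingEnd ℂ (toComplex v) = (v 0 : ℂ) - Complex.I * v 1 := by
  simp [toComplex, sub_eq_add_neg]

/-- The three angles with sum zero. -/
def torusAngle (θ : Fin 2 → ℝ) : Fin 3 → ℝ := ![θ 0, θ 1, -(θ 0 + θ 1)]

/-- The three unimodular numbers with product one. -/
def torusChar (θ : Fin 2 → ℝ) (i : Fin 3) : ℂ := Complex.exp (torusAngle θ i * Complex.I)

lemma norm_torusChar (θ : Fin 2 → ℝ) (i : Fin 3) : ‖torusChar θ i‖ = 1 :=
  Complex.norm_exp_ofReal_mul_I _

lemma torusChar_ne_zero (θ : Fin 2 → ℝ) (i : Fin 3) : torusChar θ i ≠ 0 := Complex.exp_ne_zero _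

lemma conj_torusChar (θ : Fin 2 → ℝ) (i : Fin 3) :
    starRingEnd ℂ (torusChar θ i) = (torusChar θ i)⁻¹ :=
  (Complex.inv_eq_conj (norm_torusChar θ i)).symm

lemma torusChar_mul (θ : Fin 2 → ℝ) : torusChar θ 0 * torusChar θ 1 * torusChar θ 2 = 1 := by
  simp only [torusChar, ← Complex.exp_add, torusAngle]
  rw [← Complex.exp_zero]
  congr 1
  simp
  ring

/-- The map onto the dilated deltoid. -/
def torusMap (θ : Fin 2 → ℝ) : Fin 2 → ℝ :=
  ![Real.cos (θ 0) + Real.cos (θ 1) + Real.cos (θ 0 + θ 1),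
    Real.sin (θ 0) + Real.sin (θ 1) - Real.sin (θ 0 + θ 1)]

lemma torusChar_zero (θ : Fin 2 → ℝ) :
    torusChar θ 0 = (Real.cos (θ 0) : ℂ) + Complex.I * (Real.sin (θ 0) : ℂ) := by
  simp [torusChar, torusAngle, Complex.exp_mul_I, mul_comm Complex.I]

lemma torusChar_one (θ : Fin 2 → ℝ) :
    torusChar θ 1 = (Real.cos (θ 1) : ℂ) + Complex.I * (Real.sin (θ 1) : ℂ) := by
  simp [torusChar, torusAngle, Complex.exp_mul_I, mul_comm Complex.I]

lemma torusChar_two (θ : Fin 2 → ℝ) : torusChar θ 2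
    = (Real.cos (θ 0 + θ 1) : ℂ) - Complex.I * (Real.sin (θ 0 + θ 1) : ℂ) := by
  have : torusAngle θ 2 = -(θ 0 + θ 1) := rfl
  rw [torusChar, this, Complex.exp_mul_I, ← Complex.ofReal_cos, ← Complex.ofReal_sin,
    Real.cos_neg, Real.sin_neg, Complex.ofReal_neg]
  ring

lemma toComplex_torusMap (θ : Fin 2 → ℝ) :
    toComplex (torusMap θ) = torusChar θ 0 + torusChar θ 1 + torusChar θ 2 := by
  rw [torusChar_zero, torusChar_one, torusChar_two]
  simp only [toComplex, torusMap, Matrix.cons_val_zero, Matrix.cons_val_one, Complex.ofReal_add,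
    Complex.ofReal_sub]
  ring

lemma conj_toComplex_torusMap (θ : Fin 2 → ℝ) : starRingEnd ℂ (toComplex (torusMap θ))
    = (torusChar θ 0)⁻¹ + (torusChar θ 1)⁻¹ + (torusChar θ 2)⁻¹ := by
  simp [toComplex_torusMap, conj_torusChar]

/-- The Jacobian determinant of `torusMap`. -/
def torusJac (θ : Fin 2 → ℝ) : ℝ :=
  (-Real.sin (θ 0) - Real.sin (θ 0 + θ 1)) * (Real.cos (θ 1) - Real.cos (θ 0 + θ 1))
    - (-Real.sin (θ 1) - Real.sin (θ 0 + θ 1)) * (Real.cos (θ 0) - Real.cos (θ 0 + θ 1))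

/-- The Weyl denominator formula for A₂. -/
lemma alternant_one_one {K : Type*} [Field K] {t₀ t₁ t₂ : K} (h : t₀ * t₁ * t₂ = 1) :
    alternant t₀ t₁ t₂ 1 1 = (t₀ - t₁) * (t₀ - t₂) * (t₁ - t₂) := by
  have h0 : t₀ ≠ 0 := by rintro rfl; simp at h
  have h1 : t₁ ≠ 0 := by rintro rfl; simp at h
  have h2 : t₂ ≠ 0 := by rintro rfl; simp at h
  simp only [alternant, zpow_one, zpow_neg_one]
  have e0 : t₀⁻¹ = t₁ * t₂ := inv_eq_of_mul_eq_one_right (by linear_combination h)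
  have e1 : t₁⁻¹ = t₀ * t₂ := inv_eq_of_mul_eq_one_right (by linear_combination h)
  have e2 : t₂⁻¹ = t₀ * t₁ := inv_eq_of_mul_eq_one_right (by linear_combination h)
  rw [e0, e1, e2]
  ring

/-- The Jacobian of the parametrization is the Weyl denominator up to 2i. This makes the Chebyshev
weight a squared Vandermonde on the torus. -/
lemma alternant_torusChar (θ : Fin 2 → ℝ) :
    alternant (torusChar θ 0) (torusChar θ 1) (torusChar θ 2) 1 1
      = 2 * Complex.I * torusJac θ := by
  simp only [alternant, zpow_one, zpow_neg_one, ← conj_torusChar]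
  rw [torusChar_zero, torusChar_one, torusChar_two, torusJac]
  generalize Real.cos (θ 0) = x₀
  generalize Real.cos (θ 1) = x₁
  generalize Real.cos (θ 0 + θ 1) = x₂
  generalize Real.sin (θ 0) = y₀
  generalize Real.sin (θ 1) = y₁
  generalize Real.sin (θ 0 + θ 1) = y₂
  apply Complex.ext <;> simp <;> ring

/-- The quartic is the discriminant of the cubic with roots `t₀, t₁, t₂`. -/
lemma deltoidPoly_eq_discr {t₀ t₁ t₂ : ℂ} (h : t₀ * t₁ * t₂ = 1) {v : Fin 2 → ℝ}
    (hz : 3 * toComplex v = t₀ + t₁ + t₂)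
    (hw : 3 * starRingEnd ℂ (toComplex v) = t₀ * t₁ + t₀ * t₂ + t₁ * t₂) :
    (27 * deltoidPoly v : ℂ) = -((t₀ - t₁) * (t₀ - t₂) * (t₁ - t₂)) ^ 2 := by
  have hx : (v 0 : ℂ) = ((t₀ + t₁ + t₂) + (t₀ * t₁ + t₀ * t₂ + t₁ * t₂)) / 6 := by
    rw [← hz, ← hw, conj_toComplex, toComplex]; ring
  have hy : Complex.I * (v 1 : ℂ) = ((t₀ + t₁ + t₂) - (t₀ * t₁ + t₀ * t₂ + t₁ * t₂)) / 6 := by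
    rw [← hz, ← hw, conj_toComplex, toComplex]; ring
  have hy2 : (v 1 : ℂ) ^ 2 = -(((t₀ + t₁ + t₂) - (t₀ * t₁ + t₀ * t₂ + t₁ * t₂)) / 6) ^ 2 := by
    rw [← hy, mul_pow, Complex.I_sq]; ring
  have e : (27 * deltoidPoly v : ℂ) = 27 * (-3 * ((v 0 : ℂ) ^ 2 + (v 1 : ℂ) ^ 2 + 1) ^ 2
      + 8 * ((v 0 : ℂ) ^ 3 - 3 * v 0 * (v 1 : ℂ) ^ 2) + 4) := by
    simp [deltoidPoly]
  -- The discriminant of a cubic in its elementary symmetric functions, with the third one equal to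
  -- 1.
  have d : ((t₀ - t₁) * (t₀ - t₂) * (t₁ - t₂)) ^ 2
      = (t₀ + t₁ + t₂) ^ 2 * (t₀ * t₁ + t₀ * t₂ + t₁ * t₂) ^ 2
        - 4 * (t₀ * t₁ + t₀ * t₂ + t₁ * t₂) ^ 3 - 4 * (t₀ + t₁ + t₂) ^ 3
        + 18 * (t₀ + t₁ + t₂) * (t₀ * t₁ + t₀ * t₂ + t₁ * t₂) - 27 := by
    have d' : ((t₀ - t₁) * (t₀ - t₂) * (t₁ - t₂)) ^ 2
      = (t₀ + t₁ + t₂) ^ 2 * (t₀ * t₁ + t₀ * t₂ + t₁ * t₂) ^ 2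
        - 4 * (t₀ * t₁ + t₀ * t₂ + t₁ * t₂) ^ 3 - 4 * (t₀ + t₁ + t₂) ^ 3 * (t₀ * t₁ * t₂)
        + 18 * (t₀ + t₁ + t₂) * (t₀ * t₁ + t₀ * t₂ + t₁ * t₂) * (t₀ * t₁ * t₂)
        - 27 * (t₀ * t₁ * t₂) ^ 2 := by ring
    rw [d', h]; ring
  rw [e, d, hy2, hx]
  ring

lemma inv_sum_eq {t₀ t₁ t₂ : ℂ} (h : t₀ * t₁ * t₂ = 1) :
    t₀⁻¹ + t₁⁻¹ + t₂⁻¹ = t₀ * t₁ + t₀ * t₂ + t₁ * t₂ := by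
  have e0 : t₀⁻¹ = t₁ * t₂ := inv_eq_of_mul_eq_one_right (by linear_combination h)
  have e1 : t₁⁻¹ = t₀ * t₂ := inv_eq_of_mul_eq_one_right (by linear_combination h)
  have e2 : t₂⁻¹ = t₀ * t₁ := inv_eq_of_mul_eq_one_right (by linear_combination h)
  rw [e0, e1, e2]; ring

/-- The parametrization of the deltoid itself. -/
def deltoidMap (θ : Fin 2 → ℝ) : Fin 2 → ℝ := (3⁻¹ : ℝ) • torusMap θ

lemma three_mul_toComplex_deltoidMap (θ : Fin 2 → ℝ) :
    3 * toComplex (deltoidMap θ) = torusChar θ 0 + torusChar θ 1 + torusChar θ 2 := by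
  rw [← toComplex_torusMap]
  simp [toComplex, deltoidMap]
  ring

lemma deltoidPoly_deltoidMap (θ : Fin 2 → ℝ) :
    deltoidPoly (deltoidMap θ) = 4 / 27 * torusJac θ ^ 2 := by
  have h3 := three_mul_toComplex_deltoidMap θ
  have h := deltoidPoly_eq_discr (torusChar_mul θ) h3 (by
    rw [← inv_sum_eq (torusChar_mul θ), ← conj_torusChar, ← conj_torusChar, ← conj_torusChar,
      ← map_add, ← map_add, ← h3]
    rw [map_mul, Complex.conj_ofNat])
  rw [← alternant_one_one (torusChar_mul θ), alternant_torusChar] at h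
  have : ((27 * deltoidPoly (deltoidMap θ) : ℝ) : ℂ) = ((4 * torusJac θ ^ 2 : ℝ) : ℂ) := by
    push_cast
    rw [h, mul_pow, mul_pow, Complex.I_sq]
    ring
  have := Complex.ofReal_injective this
  linarith

lemma continuous_torusMap : Continuous torusMap := by
  unfold torusMap
  fun_prop

lemma continuous_torusJac : Continuous torusJac := by
  unfold torusJac
  fun_prop

lemma continuous_torusChar (i : Fin 3) : Continuous fun θ => torusChar θ i := by
  unfold torusChar torusAngle
  fin_cases i <;> simp <;> fun_prop

/-! ### Unimodularity of the roots over the interior of the deltoid -/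

/-- A cubic with given elementary symmetric functions splits. -/
lemma exists_roots (s p : ℂ) : ∃ t₀ t₁ t₂ : ℂ,
    t₀ + t₁ + t₂ = s ∧ t₀ * t₁ + t₀ * t₂ + t₁ * t₂ = p ∧ t₀ * t₁ * t₂ = 1 := by
  obtain ⟨t₀, h0⟩ := IsAlgClosed.exists_root
    (Polynomial.X ^ 3 - Polynomial.C s * Polynomial.X ^ 2 + Polynomial.C p * Polynomial.X - 1 :
      Polynomial ℂ) (by
        have : (Polynomial.X ^ 3 - Polynomial.C s * Polynomial.X ^ 2
          + Polynomial.C p * Polynomial.X - 1 : Polynomial ℂ).degree = 3 := by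
          compute_degree!
        rw [this]; norm_num)
  simp [Polynomial.IsRoot] at h0
  obtain ⟨d, hd⟩ := IsAlgClosed.exists_pow_nat_eq ((s - t₀) ^ 2 - 4 * (p - t₀ * (s - t₀)))
    (n := 2) (by norm_num)
  refine ⟨t₀, (s - t₀ + d) / 2, (s - t₀ - d) / 2, by ring, ?_, ?_⟩
  · linear_combination (-1 / 4) * hd
  · linear_combination (-t₀ / 4) * hd + h0

/-- Here t₀ and t₁ are exchanged by inversion in the unit circle, and the product condition makes t₂
unimodular. The Vandermonde product is then real, so minus its square cannot be positive; this
excludes such roots inside the deltoid. -/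
lemma conj_vandermonde {t₀ t₁ t₂ : ℂ} (h : t₀ * t₁ * t₂ = 1) (h' : t₁ * starRingEnd ℂ t₀ = 1) :
    starRingEnd ℂ ((t₀ - t₁) * (t₀ - t₂) * (t₁ - t₂)) = (t₀ - t₁) * (t₀ - t₂) * (t₁ - t₂) := by
  have e0 : starRingEnd ℂ t₀ = t₀ * t₂ := by
    have h1 : t₁ ≠ 0 := by rintro rfl; simp at h
    refine mul_left_cancel₀ h1 ?_
    linear_combination h' - h
  have e1 : starRingEnd ℂ t₁ = t₁ * t₂ := by
    have h0 : t₀ ≠ 0 := by rintro rfl; simp at h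
    have := congrArg (starRingEnd ℂ) h'
    simp only [map_mul, Complex.conj_conj, map_one] at this
    refine mul_left_cancel₀ h0 ?_
    linear_combination this - h
  have e2 : starRingEnd ℂ t₂ = t₀ * t₁ := by
    have h2 : t₂ ≠ 0 := by rintro rfl; simp at h
    have := congrArg (starRingEnd ℂ) h
    simp only [map_mul, map_one, e0, e1] at this
    refine mul_left_cancel₀ h2 ?_
    linear_combination this - h - (starRingEnd ℂ t₂ * t₂) * h
  simp only [map_mul, map_sub, e0, e1, e2]
  linear_combination (t₀ - t₁) * (t₀ - t₂) * (t₁ - t₂) * h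

lemma deltoidPoly_nonpos {t₀ t₁ t₂ : ℂ} (h : t₀ * t₁ * t₂ = 1) (h' : t₁ * starRingEnd ℂ t₀ = 1)
    {v : Fin 2 → ℝ}
    (hv : (27 * deltoidPoly v : ℂ) = -((t₀ - t₁) * (t₀ - t₂) * (t₁ - t₂)) ^ 2) :
    deltoidPoly v ≤ 0 := by
  obtain ⟨r, hr⟩ := Complex.conj_eq_iff_real.1 (conj_vandermonde h h')
  rw [hr] at hv
  have : ((27 * deltoidPoly v : ℝ) : ℂ) = ((-r ^ 2 : ℝ) : ℂ) := by
    push_cast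
    exact hv
  have := Complex.ofReal_injective this
  nlinarith [sq_nonneg r]

/-- Inside the deltoid the roots of the cubic are unimodular. -/
lemma norm_eq_one_of_deltoidPoly_pos {t₀ t₁ t₂ : ℂ} (h : t₀ * t₁ * t₂ = 1) {v : Fin 2 → ℝ}
    (hz : 3 * toComplex v = t₀ + t₁ + t₂)
    (hw : 3 * starRingEnd ℂ (toComplex v) = t₀ * t₁ + t₀ * t₂ + t₁ * t₂)
    (hv : 0 < deltoidPoly v) : ‖t₀‖ = 1 := by
  have hD := deltoidPoly_eq_discr h hz hw
  have h0 : starRingEnd ℂ t₀ ≠ 0 := by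
    simp only [ne_eq, map_eq_zero]; rintro rfl; simp at h
  -- The cubic is conjugate-reciprocal, so 1 / conj t₀ is again one of its three roots.
  have hroot : (1 - t₀ * starRingEnd ℂ t₀) * (1 - t₁ * starRingEnd ℂ t₀)
      * (1 - t₂ * starRingEnd ℂ t₀) = 0 := by
    have e : starRingEnd ℂ (t₀ ^ 3 - (t₀ + t₁ + t₂) * t₀ ^ 2 +
        (t₀ * t₁ + t₀ * t₂ + t₁ * t₂) * t₀ - t₀ * t₁ * t₂) = 0 := by
      rw [show t₀ ^ 3 - (t₀ + t₁ + t₂) * t₀ ^ 2 +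
        (t₀ * t₁ + t₀ * t₂ + t₁ * t₂) * t₀ - t₀ * t₁ * t₂ = 0 by ring, map_zero]
    rw [← hz, ← hw, h] at e
    simp only [map_sub, map_add, map_mul, map_pow, Complex.conj_conj, map_one,
      Complex.conj_ofNat] at e
    rw [hz, hw] at e
    linear_combination (-1) * e - (starRingEnd ℂ t₀) ^ 3 * h
  rcases mul_eq_zero.1 hroot with hr | hr
  · rcases mul_eq_zero.1 hr with hr | hr
    · rw [Complex.mul_conj] at hr
      have hn : Complex.normSq t₀ = 1 := by
        have : ((Complex.normSq t₀ : ℝ) : ℂ) = 1 := by linear_combination -hr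
        exact_mod_cast this
      rw [Complex.normSq_eq_norm_sq] at hn
      exact (pow_eq_one_iff_of_nonneg (norm_nonneg _) two_ne_zero).1 hn
    · exact absurd (deltoidPoly_nonpos h (by linear_combination -hr) hD) (not_le.2 hv)
  · exact absurd (deltoidPoly_nonpos (t₀ := t₀) (t₁ := t₂) (t₂ := t₁) (by linear_combination h)
      (by linear_combination -hr) (by rw [hD]; ring)) (not_le.2 hv)

lemma vandermonde_ne_zero_iff {t : Fin 3 → ℂ} :
    (t 0 - t 1) * (t 0 - t 2) * (t 1 - t 2) ≠ 0 ↔ Function.Injective t := by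
  constructor
  · intro h i j hij
    contrapose! h
    fin_cases i <;> fin_cases j <;> simp_all
  · intro h
    simp [sub_eq_zero, h.eq_iff]

lemma torusJac_ne_zero_iff (θ : Fin 2 → ℝ) :
    torusJac θ ≠ 0 ↔ Function.Injective (torusChar θ) := by
  rw [← vandermonde_ne_zero_iff, ← alternant_one_one (torusChar_mul θ), alternant_torusChar]
  simp

/-! ### The change of variables -/

/-- The fundamental square of the torus. -/
def torusSquare : Set (Fin 2 → ℝ) := Set.pi Set.univ fun _ => Set.Ioc (-Real.pi) Real.pi

/-- The part of the torus on which the characters, permuted by `σ`, are ordered by argument. -/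
def torusCell (σ : Equiv.Perm (Fin 3)) : Set (Fin 2 → ℝ) :=
  {θ | θ ∈ torusSquare ∧ StrictMono fun i => Complex.arg (torusChar θ (σ i))}

lemma measurableSet_torusSquare : MeasurableSet torusSquare :=
  MeasurableSet.univ_pi fun _ => measurableSet_Ioc

lemma measurableSet_torusCell (σ : Equiv.Perm (Fin 3)) : MeasurableSet (torusCell σ) := by
  refine measurableSet_torusSquare.inter ?_
  have hm : ∀ i, Measurable fun θ => Complex.arg (torusChar θ i) := fun i =>
    Complex.measurable_arg.comp (continuous_torusChar i).measurable
  have : {θ | StrictMono fun i => Complex.arg (torusChar θ (σ i))}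
      = {θ | Complex.arg (torusChar θ (σ 0)) < Complex.arg (torusChar θ (σ 1))}
        ∩ {θ | Complex.arg (torusChar θ (σ 1)) < Complex.arg (torusChar θ (σ 2))} := by
    ext θ
    simp [Fin.strictMono_iff_lt_succ, Fin.forall_fin_two]
  change MeasurableSet {θ | StrictMono fun i => Complex.arg (torusChar θ (σ i))}
  have h := (measurableSet_lt (hm (σ 0)) (hm (σ 1))).inter (measurableSet_lt (hm (σ 1)) (hm (σ 2)))
  rw [this]
  exact h

lemma torusChar_injective_of_mem_torusCell {σ : Equiv.Perm (Fin 3)} {θ : Fin 2 → ℝ}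
    (h : θ ∈ torusCell σ) : Function.Injective (torusChar θ) := by
  intro i j hij
  have := h.2.injective (a₁ := σ.symm i) (a₂ := σ.symm j) (by simp [hij])
  simpa using this

lemma torusCell_disjoint {σ τ : Equiv.Perm (Fin 3)} (h : σ ≠ τ) :
    Disjoint (torusCell σ) (torusCell τ) := by
  rw [Set.disjoint_left]
  rintro θ h1 h2
  have := (StrictMono.range_inj h1.2 h2.2).1 (by
    rw [show (fun i => (torusChar θ (σ i)).arg) = (fun i => (torusChar θ i).arg) ∘ σ from rfl,
      show (fun i => (torusChar θ (τ i)).arg) = (fun i => (torusChar θ i).arg) ∘ τ from rfl,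
      EquivLike.range_comp, EquivLike.range_comp])
  refine h (Equiv.ext fun i => ?_)
  have hi : (torusChar θ (σ i)).arg = (torusChar θ (τ i)).arg := congrFun this i
  exact torusChar_injective_of_mem_torusCell h1
    (Complex.ext_norm_arg (by rw [norm_torusChar, norm_torusChar]) hi)

lemma exists_sorting_perm {t : Fin 3 → ℂ} (hn : ∀ i, ‖t i‖ = 1) (h : Function.Injective t) :
    ∃ σ : Equiv.Perm (Fin 3), StrictMono fun i => Complex.arg (t (σ i)) := by
  refine ⟨Tuple.sort fun i => Complex.arg (t i), ?_⟩
  refine (Tuple.monotone_sort fun i => Complex.arg (t i)).strictMono_of_injective ?_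
  exact Function.Injective.comp (fun i j hij => h (Complex.ext_norm_arg (by rw [hn, hn]) hij))
    (Equiv.injective _)

lemma mem_torusCell_of_torusJac_ne_zero {θ : Fin 2 → ℝ} (h : θ ∈ torusSquare)
    (hJ : torusJac θ ≠ 0) : ∃ σ, θ ∈ torusCell σ := by
  obtain ⟨σ, hσ⟩ := exists_sorting_perm (norm_torusChar θ) ((torusJac_ne_zero_iff θ).1 hJ)
  exact ⟨σ, h, hσ⟩

lemma arg_torusChar {θ : Fin 2 → ℝ} (h : θ ∈ torusSquare) :
    (torusChar θ 0).arg = θ 0 ∧ (torusChar θ 1).arg = θ 1 := by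
  have h' := fun i => h i (Set.mem_univ i)
  constructor
  · exact Complex.arg_exp_mul_I _ ▸ (toIocMod_eq_self _).2 (by
      have := h' 0; simp [torusAngle]; constructor <;> linarith [this.1, this.2])
  · exact Complex.arg_exp_mul_I _ ▸ (toIocMod_eq_self _).2 (by
      have := h' 1; simp [torusAngle]; constructor <;> linarith [this.1, this.2])

/-- The point determines z and conj z, hence all coefficients of the cubic whose roots are the
characters. -/
lemma exists_torusChar_eq {θ θ' : Fin 2 → ℝ} (h : torusMap θ = torusMap θ') (i : Fin 3) :
    ∃ j, torusChar θ i = torusChar θ' j := by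
  have h1 := toComplex_torusMap θ
  have h2 := conj_toComplex_torusMap θ
  rw [h, toComplex_torusMap] at h1
  rw [h, conj_toComplex_torusMap, inv_sum_eq (torusChar_mul θ), inv_sum_eq (torusChar_mul θ')] at h2
  have h3 := torusChar_mul θ
  have h4 := torusChar_mul θ'
  have : (torusChar θ i - torusChar θ' 0) * (torusChar θ i - torusChar θ' 1)
      * (torusChar θ i - torusChar θ' 2) = 0 := by
    have e : (torusChar θ i - torusChar θ 0) * (torusChar θ i - torusChar θ 1)
      * (torusChar θ i - torusChar θ 2) = 0 := by fin_cases i <;> simp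
    linear_combination e - torusChar θ i ^ 2 * h1 + torusChar θ i * h2 + h3 - h4
  rcases mul_eq_zero.1 this with h | h
  · rcases mul_eq_zero.1 h with h | h
    · exact ⟨0, sub_eq_zero.1 h⟩
    · exact ⟨1, sub_eq_zero.1 h⟩
  · exact ⟨2, sub_eq_zero.1 h⟩

/-- Equal images have the same set of characters, and the cell prescribes the order of their
arguments; a strictly monotone sequence is determined by its range. -/
lemma torusMap_injOn (σ : Equiv.Perm (Fin 3)) : Set.InjOn torusMap (torusCell σ) := by
  intro θ hθ θ' hθ' h
  have hr : Set.range (fun i => (torusChar θ (σ i)).arg)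
      = Set.range (fun i => (torusChar θ' (σ i)).arg) := by
    apply Set.Subset.antisymm
    · rintro _ ⟨i, rfl⟩
      obtain ⟨j, hj⟩ := exists_torusChar_eq h (σ i)
      exact ⟨σ.symm j, by simp [hj]⟩
    · rintro _ ⟨i, rfl⟩
      obtain ⟨j, hj⟩ := exists_torusChar_eq h.symm (σ i)
      exact ⟨σ.symm j, by simp [hj]⟩
  have he := (StrictMono.range_inj hθ.2 hθ'.2).1 hr
  have he' : ∀ i, (torusChar θ i).arg = (torusChar θ' i).arg := fun i => by
    simpa using congrFun he (σ.symm i)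
  ext i
  fin_cases i
  · simpa [(arg_torusChar hθ.1).1, (arg_torusChar hθ'.1).1] using he' 0
  · simpa [(arg_torusChar hθ.1).2, (arg_torusChar hθ'.1).2] using he' 1

lemma exists_mem_torusCell (σ : Equiv.Perm (Fin 3)) {v : Fin 2 → ℝ} (hv : 0 < deltoidPoly v) :
    ∃ θ ∈ torusCell σ, deltoidMap θ = v := by
  obtain ⟨t₀, t₁, t₂, hs, hp, h⟩ := exists_roots (3 * toComplex v)
    (3 * starRingEnd ℂ (toComplex v))
  have n0 := norm_eq_one_of_deltoidPoly_pos h hs.symm hp.symm hv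
  have n1 := norm_eq_one_of_deltoidPoly_pos (t₀ := t₁) (t₁ := t₀) (t₂ := t₂)
    (by linear_combination h) (by linear_combination -hs) (by linear_combination -hp) hv
  have n2 := norm_eq_one_of_deltoidPoly_pos (t₀ := t₂) (t₁ := t₀) (t₂ := t₁)
    (by linear_combination h) (by linear_combination -hs) (by linear_combination -hp) hv
  have hD := deltoidPoly_eq_discr h hs.symm hp.symm
  have hinj : Function.Injective ![t₀, t₁, t₂] := by
    rw [← vandermonde_ne_zero_iff]
    intro h0
    simp only [Matrix.cons_val] at h0
    rw [h0] at hD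
    have : (deltoidPoly v : ℂ) = 0 := by linear_combination hD / 27
    exact hv.ne' (by exact_mod_cast this)
  have hn : ∀ i, ‖![t₀, t₁, t₂] i‖ = 1 := by
    intro i; fin_cases i <;> simpa
  obtain ⟨ρ, hρ⟩ := exists_sorting_perm hn hinj
  -- Composing the sorting permutation with the inverse of σ makes s ∘ σ the sorted list, as the
  -- cell of σ requires.
  set s : Fin 3 → ℂ := fun i => ![t₀, t₁, t₂] (ρ (σ.symm i)) with hs'
  have hsn : ∀ i, ‖s i‖ = 1 := fun i => hn _
  have hsum : s 0 + s 1 + s 2 = 3 * toComplex v := by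
    rw [← Fin.sum_univ_three]
    refine (Equiv.sum_comp (σ.symm.trans ρ) ![t₀, t₁, t₂]).trans ?_
    rw [Fin.sum_univ_three]
    exact hs
  have hprod : s 0 * s 1 * s 2 = 1 := by
    rw [← Fin.prod_univ_three]
    refine (Equiv.prod_comp (σ.symm.trans ρ) ![t₀, t₁, t₂]).trans ?_
    rw [Fin.prod_univ_three]
    exact h
  have hexp : ∀ i, Complex.exp ((s i).arg * Complex.I) = s i := fun i => by
    have := Complex.norm_mul_exp_arg_mul_I (s i)
    rwa [hsn, Complex.ofReal_one, one_mul] at this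
  set θ : Fin 2 → ℝ := ![(s 0).arg, (s 1).arg] with hθ
  have c0 : torusChar θ 0 = s 0 := hexp 0
  have c1 : torusChar θ 1 = s 1 := hexp 1
  have c2 : torusChar θ 2 = s 2 := by
    have := torusChar_mul θ
    rw [c0, c1] at this
    have h01 : s 0 * s 1 ≠ 0 := by intro h0; rw [h0, zero_mul] at hprod; exact zero_ne_one hprod
    exact mul_left_cancel₀ h01 (this.trans hprod.symm)
  have hc : ∀ i, torusChar θ i = s i := by intro i; fin_cases i <;> assumption
  refine ⟨θ, ⟨?_, ?_⟩, ?_⟩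
  · intro i _
    fin_cases i
    · exact Complex.arg_mem_Ioc _
    · exact Complex.arg_mem_Ioc _
  · simp only [hc, hs', Equiv.symm_apply_apply]
    exact hρ
  · apply toComplex_injective
    have := three_mul_toComplex_deltoidMap θ
    rw [c0, c1, c2, hsum] at this
    exact mul_left_cancel₀ three_ne_zero this

/-! ### Jacobian and area formula on the cells -/

/-- The derivative of `deltoidMap`. -/
def deltoidDeriv (θ : Fin 2 → ℝ) : (Fin 2 → ℝ) →L[ℝ] (Fin 2 → ℝ) :=
  (Matrix.toLin' ((3⁻¹ : ℝ) •
    !![-Real.sin (θ 0) - Real.sin (θ 0 + θ 1), -Real.sin (θ 1) - Real.sin (θ 0 + θ 1);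
      Real.cos (θ 0) - Real.cos (θ 0 + θ 1), Real.cos (θ 1) - Real.cos (θ 0 + θ 1)])).toContinuousLinearMap

lemma det_deltoidDeriv (θ : Fin 2 → ℝ) : (deltoidDeriv θ).det = torusJac θ / 9 := by
  rw [deltoidDeriv, ContinuousLinearMap.det, LinearMap.coe_toContinuousLinearMap,
    LinearMap.det_toLin', Matrix.det_smul, Matrix.det_fin_two_of, torusJac]
  simp
  ring

lemma hasFDerivAt_deltoidMap (θ : Fin 2 → ℝ) : HasFDerivAt deltoidMap (deltoidDeriv θ) θ := by
  have h0 : HasFDerivAt (fun θ : Fin 2 → ℝ => θ 0) (ContinuousLinearMap.proj 0) θ :=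
    (ContinuousLinearMap.proj (R := ℝ) (φ := fun _ : Fin 2 => ℝ) 0).hasFDerivAt
  have h1 : HasFDerivAt (fun θ : Fin 2 → ℝ => θ 1) (ContinuousLinearMap.proj 1) θ :=
    (ContinuousLinearMap.proj (R := ℝ) (φ := fun _ : Fin 2 => ℝ) 1).hasFDerivAt
  refine hasFDerivAt_pi'' fun i => ?_
  fin_cases i
  · have h := ((h0.cos.add h1.cos).add (h0.add h1).cos).const_mul (3⁻¹ : ℝ)
    refine (show HasFDerivAt (fun x => deltoidMap x 0) _ θ from h).congr_fderiv ?_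
    refine ContinuousLinearMap.ext fun v => ?_
    simp [deltoidDeriv, dotProduct, Fin.sum_univ_two]
    ring
  · have h := ((h0.sin.add h1.sin).sub (h0.add h1).sin).const_mul (3⁻¹ : ℝ)
    refine (show HasFDerivAt (fun x => deltoidMap x 1) _ θ from h).congr_fderiv ?_
    refine ContinuousLinearMap.ext fun v => ?_
    simp [deltoidDeriv, dotProduct, Fin.sum_univ_two]
    ring

lemma continuous_deltoidPoly : Continuous deltoidPoly := by
  unfold deltoidPoly
  fun_prop

lemma deltoidMap_injOn (σ : Equiv.Perm (Fin 3)) : Set.InjOn deltoidMap (torusCell σ) :=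
  fun _ hθ _ hθ' h => torusMap_injOn σ hθ hθ' (smul_right_injective _ (by norm_num) h)

/-- The density on the torus that corresponds to the Chebyshev weight. -/
def torusDensity (θ : Fin 2 → ℝ) : ENNReal := ENNReal.ofReal (√(4 / 27) / 9 * torusJac θ ^ 2)

lemma measurable_torusDensity : Measurable torusDensity := by
  unfold torusDensity
  exact (continuous_const.mul (continuous_torusJac.pow 2)).measurable.ennreal_ofReal

/-- Each cell maps bijectively onto the set where the quartic is positive, so the area formula gives
the whole Chebyshev measure once per cell. -/
lemma lintegral_torusCell (σ : Equiv.Perm (Fin 3)) {B : Set (Fin 2 → ℝ)} (hB : MeasurableSet B) :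
    ∫⁻ θ in torusCell σ ∩ torusMap ⁻¹' B, torusDensity θ
      = deltoidMeasure.map (fun v => (3 : ℝ) • v) B := by
  have hs : Measurable fun v : Fin 2 → ℝ => (3 : ℝ) • v := measurable_const_smul _
  have hB' : MeasurableSet ((fun v : Fin 2 → ℝ => (3 : ℝ) • v) ⁻¹' B) := hs hB
  have hU : MeasurableSet {v | 0 < deltoidPoly v} :=
    measurableSet_lt measurable_const continuous_deltoidPoly.measurable
  have hd : MeasurableSet deltoid := by
    have : deltoid = {v | 0 ≤ deltoidPoly v} := Set.ext mem_deltoid_iff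
    rw [this]
    exact measurableSet_le measurable_const continuous_deltoidPoly.measurable
  have himg : deltoidMap '' (torusCell σ ∩ torusMap ⁻¹' B)
      = {v | 0 < deltoidPoly v} ∩ (fun v : Fin 2 → ℝ => (3 : ℝ) • v) ⁻¹' B := by
    ext v
    constructor
    · rintro ⟨θ, ⟨hθ, hθB⟩, rfl⟩
      refine ⟨?_, ?_⟩
      · have := (torusJac_ne_zero_iff θ).2 (torusChar_injective_of_mem_torusCell hθ)
        rw [Set.mem_ofPred_eq, deltoidPoly_deltoidMap]
        positivity
      · simpa [deltoidMap] using hθB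
    · rintro ⟨hv, hvB⟩
      obtain ⟨θ, hθ, rfl⟩ := exists_mem_torusCell σ hv
      exact ⟨θ, ⟨hθ, by simpa [deltoidMap] using hvB⟩, rfl⟩
  rw [Measure.map_apply hs hB, deltoidMeasure, withDensity_apply _ hB', Measure.restrict_restrict hB']
  -- The boundary may be dropped because the weight itself vanishes there; its area plays no role.
  have h1 : ∫⁻ v in (fun v : Fin 2 → ℝ => (3 : ℝ) • v) ⁻¹' B ∩ deltoid, ENNReal.ofReal √(deltoidPoly v)
      = ∫⁻ v in {v | 0 < deltoidPoly v} ∩ (fun v : Fin 2 → ℝ => (3 : ℝ) • v) ⁻¹' B,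
        ENNReal.ofReal √(deltoidPoly v) := by
    rw [← lintegral_indicator (hB'.inter hd), ← lintegral_indicator (hU.inter hB')]
    refine lintegral_congr fun v => ?_
    classical
    rw [Set.indicator_apply, Set.indicator_apply]
    rcases lt_trichotomy 0 (deltoidPoly v) with h | h | h
    · simp [mem_deltoid_iff, h, h.le]
    · simp [← h]
    · simp [mem_deltoid_iff, h.not_gt, h.not_ge]
  rw [h1, ← himg, lintegral_image_eq_lintegral_abs_det_fderiv_mul volume
    ((measurableSet_torusCell σ).inter (continuous_torusMap.measurable hB))
    (fun θ _ => (hasFDerivAt_deltoidMap θ).hasFDerivWithinAt)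
    ((deltoidMap_injOn σ).mono Set.inter_subset_left)]
  congr 1
  ext θ
  -- The derivative contributes |J| / 9 and the weight √(4/27) |J|, which together make the density
  -- on the torus.
  rw [det_deltoidDeriv, deltoidPoly_deltoidMap, ← ENNReal.ofReal_mul (abs_nonneg _),
    Real.sqrt_mul (by norm_num), Real.sqrt_sq_eq_abs, torusDensity, ← sq_abs (torusJac θ), abs_div]
  congr 1
  rw [abs_of_pos (by norm_num : (0 : ℝ) < 9)]
  ring

/-- The dilated Chebyshev weight is, up to a constant, an image of a measure on the torus. -/
theorem map_torusMap_eq :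
    ((volume.restrict torusSquare).withDensity torusDensity).map torusMap
      = (6 : ENNReal) • deltoidMeasure.map (fun v => (3 : ℝ) • v) := by
  ext B hB
  have hB' := continuous_torusMap.measurable hB
  rw [Measure.map_apply continuous_torusMap.measurable hB, withDensity_apply _ hB',
    Measure.restrict_restrict hB', Measure.smul_apply]
  have h1 : ∫⁻ θ in torusMap ⁻¹' B ∩ torusSquare, torusDensity θ
      = ∫⁻ θ in ⋃ σ, (torusCell σ ∩ torusMap ⁻¹' B), torusDensity θ := by
    have hm : MeasurableSet (⋃ σ, (torusCell σ ∩ torusMap ⁻¹' B)) :=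
      MeasurableSet.iUnion fun σ => (measurableSet_torusCell σ).inter hB'
    rw [← lintegral_indicator (hB'.inter measurableSet_torusSquare), ← lintegral_indicator hm]
    congr 1
    ext θ
    -- Points of the square outside every cell have zero Jacobian, where the density is zero.
    by_cases hJ : torusJac θ = 0
    · simp [Set.indicator, torusDensity, hJ]
    · have : θ ∈ torusMap ⁻¹' B ∩ torusSquare ↔ θ ∈ ⋃ σ, (torusCell σ ∩ torusMap ⁻¹' B) := by
        simp only [Set.mem_inter_iff, Set.mem_iUnion]
        constructor
        · rintro ⟨h, h'⟩
          obtain ⟨σ, hσ⟩ := mem_torusCell_of_torusJac_ne_zero h' hJ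
          exact ⟨σ, hσ, h⟩
        · rintro ⟨σ, hσ, h⟩
          exact ⟨h, hσ.1⟩
      by_cases h : θ ∈ torusMap ⁻¹' B ∩ torusSquare
      · rw [Set.indicator_of_mem h, Set.indicator_of_mem (this.1 h)]
      · rw [Set.indicator_of_notMem h, Set.indicator_of_notMem (fun h' => h (this.2 h'))]
  rw [h1, lintegral_iUnion (fun σ => (measurableSet_torusCell σ).inter hB')
    (fun σ τ h => (torusCell_disjoint h).mono Set.inter_subset_left Set.inter_subset_left)]
  simp only [lintegral_torusCell _ hB]
  rw [tsum_fintype, Finset.sum_const, Finset.card_univ, Fintype.card_perm]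
  simp [Nat.factorial]

/-! ### Vanishing integrals of Laurent series -/

section Vanishing

variable {Ω : Type*} [MeasurableSpace Ω]

/-- A geometric series argument: if all integrals of `F * s ^ k` vanish and `|s| ≤ 1 / 2`, then so
does the integral of `F / (1 + s)`. -/
lemma integral_mul_inv_one_add_eq_zero {ν : Measure Ω} [IsFiniteMeasure ν] {F s : Ω → ℂ}
    (hF : Measurable F) (hs : Measurable s) {c : ℝ} (hFc : ∀ ω, ‖F ω‖ ≤ c)
    (hs' : ∀ ω, ‖s ω‖ ≤ 1 / 2) (h : ∀ k : ℕ, ∫ ω, F ω * s ω ^ k ∂ν = 0) :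
    ∫ ω, F ω * (1 + s ω)⁻¹ ∂ν = 0 := by
  have hb : ∀ (k : ℕ) ω, ‖F ω * (-s ω) ^ k‖ ≤ c * (1 / 2) ^ k := fun k ω => by
    rw [norm_mul, norm_pow, norm_neg]
    exact mul_le_mul (hFc ω) (pow_le_pow_left₀ (norm_nonneg _) (hs' ω) k) (by positivity)
      ((norm_nonneg _).trans (hFc ω))
  have hint : ∀ k : ℕ, Integrable (fun ω => F ω * (-s ω) ^ k) ν := fun k =>
    Integrable.of_bound (hF.mul (hs.neg.pow_const k)).aestronglyMeasurable _
      (Filter.Eventually.of_forall (hb k))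
  have hsum : Summable fun k : ℕ => ∫ ω, ‖F ω * (-s ω) ^ k‖ ∂ν := by
    refine Summable.of_nonneg_of_le (fun k => integral_nonneg fun _ => norm_nonneg _)
      (fun k => (integral_mono (hint k).norm (integrable_const _) (hb k)).trans_eq ?_)
      ((summable_geometric_of_lt_one (r := 1 / 2) (by norm_num) (by norm_num)).mul_left
        (ν.real Set.univ * c))
    rw [integral_const, smul_eq_mul, mul_assoc]
  have hS := hasSum_integral_of_summable_integral_norm hint hsum
  have h0 : (fun k : ℕ => ∫ ω, F ω * (-s ω) ^ k ∂ν) = fun _ => 0 := by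
    ext k
    simp_rw [neg_pow (s _), mul_left_comm (F _)]
    rw [integral_const_mul, h k, mul_zero]
  rw [h0] at hS
  have := hS.unique hasSum_zero
  rw [← this]
  congr 1
  ext ω
  rw [tsum_mul_left, tsum_geometric_of_norm_lt_one (by rw [norm_neg]; linarith [hs' ω]),
    sub_neg_eq_add]

/-- The Laurent monomial `u ^ x * v ^ y * w ^ (-z)`. -/
def laurent (u v w : Ω → ℂ) (x y z : ℤ) (ω : Ω) : ℂ := u ω ^ x * v ω ^ y * w ω ^ (-z)

/-- `G` is bounded and has vanishing integral against all Laurent monomials of degree `> n`, where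
`u`, `v`, `w⁻¹` have degree `1, 0, 1`. -/
structure VanishesAbove (ν : Measure Ω) (u v w : Ω → ℂ) (n : ℤ) (G : Ω → ℂ) : Prop where
  measurable : Measurable G
  bounded : ∃ c : ℝ, ∀ ω, ‖G ω‖ ≤ c
  integral_eq_zero : ∀ x y z : ℤ, n < x + z → ∫ ω, laurent u v w x y z ω * G ω ∂ν = 0

variable {ν : Measure Ω} [IsFiniteMeasure ν] {u v w : Ω → ℂ}

/-- `u`, `v`, `w` are measurable and unimodular. -/
structure IsUnimodular (u v w : Ω → ℂ) : Prop where
  mu : Measurable u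
  mv : Measurable v
  mw : Measurable w
  nu : ∀ ω, ‖u ω‖ = 1
  nv : ∀ ω, ‖v ω‖ = 1
  nw : ∀ ω, ‖w ω‖ = 1

namespace IsUnimodular

variable (h : IsUnimodular u v w)
include h

lemma u_ne_zero (ω : Ω) : u ω ≠ 0 := by rw [← norm_ne_zero_iff, h.nu]; exact one_ne_zero
lemma v_ne_zero (ω : Ω) : v ω ≠ 0 := by rw [← norm_ne_zero_iff, h.nv]; exact one_ne_zero
lemma w_ne_zero (ω : Ω) : w ω ≠ 0 := by rw [← norm_ne_zero_iff, h.nw]; exact one_ne_zero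

lemma measurable_laurent (x y z : ℤ) : Measurable (laurent u v w x y z) := by
  have hz : ∀ (f : Ω → ℂ) (n : ℤ), Measurable f → Measurable fun ω => f ω ^ n := by
    intro f n hf
    cases n with
    | ofNat n => simpa using hf.pow_const n
    | negSucc n =>
      simp only [zpow_negSucc]
      exact (hf.pow_const (n + 1)).inv
  exact ((hz _ _ h.mu).mul (hz _ _ h.mv)).mul (hz _ _ h.mw)

lemma norm_laurent (x y z : ℤ) (ω : Ω) : ‖laurent u v w x y z ω‖ = 1 := by
  simp [laurent, h.nu, h.nv, h.nw]

lemma laurent_mul (x y z x' y' z' : ℤ) (ω : Ω) : laurent u v w x y z ω * laurent u v w x' y' z' ω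
    = laurent u v w (x + x') (y + y') (z + z') ω := by
  simp only [laurent]
  rw [zpow_add₀ (h.u_ne_zero ω), zpow_add₀ (h.v_ne_zero ω), neg_add, zpow_add₀ (h.w_ne_zero ω)]
  ring

end IsUnimodular

namespace VanishesAbove

variable {n n' : ℤ} {G H : Ω → ℂ}

lemma add (h : IsUnimodular u v w) (hG : VanishesAbove ν u v w n G)
    (hH : VanishesAbove ν u v w n H) : VanishesAbove ν u v w n fun ω => G ω + H ω := by
  obtain ⟨c, hc⟩ := hG.2
  obtain ⟨d, hd⟩ := hH.2
  refine ⟨hG.1.add hH.1, ⟨c + d, fun ω => (norm_add_le _ _).trans (add_le_add (hc ω) (hd ω))⟩,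
    fun x y z hx => ?_⟩
  have hi : ∀ {G : Ω → ℂ} {c : ℝ}, Measurable G → (∀ ω, ‖G ω‖ ≤ c) →
      Integrable (fun ω => laurent u v w x y z ω * G ω) ν := fun hG hc =>
    Integrable.of_bound ((h.measurable_laurent x y z).mul hG).aestronglyMeasurable _
      (Filter.Eventually.of_forall fun ω => by
        rw [norm_mul, h.norm_laurent, one_mul]; exact hc ω)
  simp_rw [mul_add]
  rw [integral_add (hi hG.1 hc) (hi hH.1 hd), hG.3 x y z hx, hH.3 x y z hx, add_zero]

omit [IsFiniteMeasure ν] in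
lemma const_mul (a : ℂ) (hG : VanishesAbove ν u v w n G) :
    VanishesAbove ν u v w n fun ω => a * G ω := by
  obtain ⟨c, hc⟩ := hG.2
  refine ⟨hG.1.const_mul a, ⟨‖a‖ * c, fun ω => ?_⟩, fun x y z hx => ?_⟩
  · rw [norm_mul]; gcongr; exact hc ω
  · simp_rw [mul_left_comm _ a]
    rw [integral_const_mul, hG.3 x y z hx, mul_zero]

omit [IsFiniteMeasure ν] in
lemma laurent_mul (h : IsUnimodular u v w) (hG : VanishesAbove ν u v w n G) (x y z : ℤ)
    (hn : n ≤ n' + (x + z)) : VanishesAbove ν u v w n' fun ω => laurent u v w x y z ω * G ω := by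
  obtain ⟨c, hc⟩ := hG.2
  refine ⟨(h.measurable_laurent x y z).mul hG.1, ⟨c, fun ω => ?_⟩, fun x' y' z' hx => ?_⟩
  · rw [norm_mul, h.norm_laurent, one_mul]; exact hc ω
  · simp_rw [← mul_assoc, h.laurent_mul]
    exact hG.3 _ _ _ (by omega)

/-- Every power of a monomial of degree ≥ 0 keeps the exponents in the vanishing range, so each term
of the geometric series integrates to zero. Degree 0 is allowed, which admits both v³ and v⁻³. -/
lemma mul_inv_one_add (h : IsUnimodular u v w) (hG : VanishesAbove ν u v w n G) (x y z : ℤ)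
    (hn : 0 ≤ x + z) {β : ℂ} (hβ : ‖β‖ ≤ 1 / 2) :
    VanishesAbove ν u v w n fun ω => G ω * (1 + β * laurent u v w x y z ω)⁻¹ := by
  obtain ⟨c, hc⟩ := hG.2
  have hs : ∀ ω, ‖β * laurent u v w x y z ω‖ ≤ 1 / 2 := fun ω => by
    rwa [norm_mul, h.norm_laurent, mul_one]
  have hm := (h.measurable_laurent x y z).const_mul β
  refine ⟨hG.1.mul (hm.const_add 1).inv, ⟨c * 2, fun ω => ?_⟩, fun x' y' z' hx => ?_⟩
  · rw [norm_mul, norm_inv]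
    have h1 : 1 / 2 ≤ ‖1 + β * laurent u v w x y z ω‖ := by
      have := norm_sub_le (1 + β * laurent u v w x y z ω) (β * laurent u v w x y z ω)
      rw [add_sub_cancel_right, norm_one] at this
      linarith [hs ω]
    have h2 : ‖1 + β * laurent u v w x y z ω‖⁻¹ ≤ 2 := by
      rw [inv_le_comm₀ (by linarith) (by norm_num)]; linarith
    exact mul_le_mul (hc ω) h2 (by positivity) ((norm_nonneg _).trans (hc ω))
  · simp_rw [← mul_assoc]
    refine integral_mul_inv_one_add_eq_zero ((h.measurable_laurent x' y' z').mul hG.1) hm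
      (c := c) (fun ω => by rw [norm_mul, h.norm_laurent, one_mul]; exact hc ω) hs fun k => ?_
    have hp : ∀ ω, laurent u v w x y z ω ^ k = laurent u v w (k * x) (k * y) (k * z) ω := by
      intro ω
      simp only [laurent]
      rw [mul_pow, mul_pow, ← zpow_natCast, ← zpow_natCast, ← zpow_natCast, ← zpow_mul,
        ← zpow_mul, ← zpow_mul]
      ring_nf
    have : ∀ ω, laurent u v w x' y' z' ω * G ω * (β * laurent u v w x y z ω) ^ k
        = β ^ k * (laurent u v w (x' + k * x) (y' + k * y) (z' + k * z) ω * G ω) := fun ω => by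
      rw [mul_pow, hp, ← h.laurent_mul]; ring
    simp_rw [this]
    rw [integral_const_mul, hG.3, mul_zero]
    have : (0 : ℤ) ≤ k * (x + z) := by positivity
    linarith

variable (h : IsUnimodular u v w) (hG : VanishesAbove ν u v w n G)
include h hG

lemma sum_mul : VanishesAbove ν u v w (n + 1) fun ω => (u ω + v ω + w ω) * G ω := by
  have h1 := hG.laurent_mul (n' := n + 1) h 1 0 0 (by omega)
  have h2 := hG.laurent_mul (n' := n + 1) h 0 1 0 (by omega)
  have h3 := hG.laurent_mul (n' := n + 1) h 0 0 (-1) (by omega)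
  convert (h1.add h h2).add h h3 using 2 with ω
  simp [laurent]
  ring

lemma sum_inv_mul :
    VanishesAbove ν u v w (n + 1) fun ω => ((u ω)⁻¹ + (v ω)⁻¹ + (w ω)⁻¹) * G ω := by
  have h1 := hG.laurent_mul (n' := n + 1) h (-1) 0 0 (by omega)
  have h2 := hG.laurent_mul (n' := n + 1) h 0 (-1) 0 (by omega)
  have h3 := hG.laurent_mul (n' := n + 1) h 0 0 1 (by omega)
  convert (h1.add h h2).add h h3 using 2 with ω
  simp [laurent]
  ring

/-- The lowest of the six monomials is u⁻¹w, of degree -2, so the threshold rises by 2. -/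
lemma alternant_mul :
    VanishesAbove ν u v w (n + 2) fun ω => alternant (u ω) (v ω) (w ω) 1 1 * G ω := by
  have h1 := hG.laurent_mul (n' := n + 2) h 1 0 1 (by omega)
  have h2 := (hG.laurent_mul (n' := n + 2) h 0 1 1 (by omega)).const_mul (-1)
  have h3 := (hG.laurent_mul (n' := n + 2) h 1 (-1) 0 (by omega)).const_mul (-1)
  have h4 := hG.laurent_mul (n' := n + 2) h (-1) 1 0 (by omega)
  have h5 := hG.laurent_mul (n' := n + 2) h 0 (-1) (-1) (by omega)
  have h6 := (hG.laurent_mul (n' := n + 2) h (-1) 0 (-1) (by omega)).const_mul (-1)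
  convert ((((h1.add h h2).add h h3).add h h4).add h h5).add h h6 using 2 with ω
  simp [laurent, alternant]
  ring

lemma sum_pow_mul (i : ℕ) :
    VanishesAbove ν u v w (n + i) fun ω => (u ω + v ω + w ω) ^ i * G ω := by
  induction i with
  | zero => simpa using hG
  | succ i ih =>
    have := ih.sum_mul h
    rw [Nat.cast_succ, ← add_assoc]
    simpa only [pow_succ', mul_assoc] using this

lemma sum_inv_pow_mul (i : ℕ) :
    VanishesAbove ν u v w (n + i) fun ω => ((u ω)⁻¹ + (v ω)⁻¹ + (w ω)⁻¹) ^ i * G ω := by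
  induction i with
  | zero => simpa using hG
  | succ i ih =>
    have := ih.sum_inv_mul h
    rw [Nat.cast_succ, ← add_assoc]
    simpa only [pow_succ', mul_assoc] using this

end VanishesAbove

/-- Orthogonality of one term of the alternating sum. -/
lemma integral_laurent_term_eq_zero (h : IsUnimodular u v w)
    (h1 : VanishesAbove ν u v w 0 fun _ => 1) {b b' : ℂ} (hb : ‖b‖ ≤ 1 / 2) (hb' : ‖b'‖ ≤ 1 / 2)
    (x y : ℤ) (i j : ℕ) (hx : i + j + 2 < x + y) :
    ∫ ω, (u ω ^ x * w ω ^ (-y)) * (alternant (u ω) (v ω) (w ω) 1 1 * ((u ω + v ω + w ω) ^ i *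
      (((u ω)⁻¹ + (v ω)⁻¹ + (w ω)⁻¹) ^ j * ((1 + b * u ω ^ 3)⁻¹ * (1 + b' * (w ω ^ 3)⁻¹)⁻¹
        * (1 + b * v ω ^ 3)⁻¹ * (1 + b' * (v ω ^ 3)⁻¹)⁻¹)))) ∂ν = 0 := by
  -- The four inverse factors cost nothing; the powers of the two sums and the Vandermonde raise the
  -- threshold from 0 to i + j + 2.
  have h2 := (((((((h1.mul_inv_one_add h 3 0 0 (by norm_num) hb).mul_inv_one_add h 0 0 3
    (by norm_num) hb').mul_inv_one_add h 0 3 0 (by norm_num) hb).mul_inv_one_add h 0 (-3) 0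
    (by norm_num) hb').sum_inv_pow_mul h j).sum_pow_mul h i).alternant_mul h).integral_eq_zero
      x 0 y (by omega)
  have e3 : ∀ t : ℂ, t ^ (3 : ℤ) = t ^ 3 := fun t => by norm_cast
  simpa [laurent, zpow_neg, e3] using h2

end Vanishing

/-! ### Integrals over the torus -/

lemma integral_exp_int_mul {k : ℤ} (hk : k ≠ 0) :
    ∫ x in Set.Ioc (-Real.pi) Real.pi, Complex.exp (k * x * Complex.I) = 0 := by
  rw [← intervalIntegral.integral_of_le (by linarith [Real.pi_pos])]
  have hc : (k * Complex.I : ℂ) ≠ 0 := mul_ne_zero (by exact_mod_cast hk) Complex.I_ne_zero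
  have := integral_exp_mul_complex (a := -Real.pi) (b := Real.pi) hc
  simp_rw [mul_right_comm _ Complex.I] at this
  rw [this]
  have e : Complex.exp (k * (Real.pi : ℝ) * Complex.I)
      = Complex.exp (k * ((-Real.pi : ℝ) : ℂ) * Complex.I) := by
    rw [Complex.exp_eq_exp_iff_exists_int]
    exact ⟨k, by push_cast; ring⟩
  rw [e, sub_self, zero_div]

instance : IsFiniteMeasure (volume.restrict torusSquare) := by
  constructor
  rw [Measure.restrict_apply_univ, torusSquare, Real.volume_pi_Ioc]
  exact ENNReal.prod_lt_top fun _ _ => ENNReal.ofReal_lt_top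

/-- Eliminating the third character leaves the frequencies n₀ - n₂ and n₁ - n₂ in two independent
angles, and a nonzero frequency kills the integral. -/
lemma integral_torusChar (n₀ n₁ n₂ : ℤ) (h : ¬ (n₀ = n₂ ∧ n₁ = n₂)) :
    ∫ θ in torusSquare, torusChar θ 0 ^ n₀ * torusChar θ 1 ^ n₁ * torusChar θ 2 ^ n₂ = 0 := by
  have e : ∀ θ, torusChar θ 0 ^ n₀ * torusChar θ 1 ^ n₁ * torusChar θ 2 ^ n₂
      = ∏ i, (fun (i : Fin 2) (x : ℝ) =>
        Complex.exp (((![n₀ - n₂, n₁ - n₂] i : ℤ) : ℂ) * x * Complex.I)) i (θ i) := by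
    intro θ
    simp only [torusChar, ← Complex.exp_int_mul, ← Complex.exp_add, Fin.prod_univ_two]
    congr 1
    simp [torusAngle]
    ring
  rw [torusSquare, volume_pi, Measure.restrict_pi_pi, funext e]
  have hp := integral_fintype_prod_eq_prod (𝕜 := ℂ) (ι := Fin 2) (E := fun _ => ℝ)
    (μ := fun _ => volume.restrict (Set.Ioc (-Real.pi) Real.pi))
    (fun i x => Complex.exp (((![n₀ - n₂, n₁ - n₂] i : ℤ) : ℂ) * x * Complex.I))
  refine hp.trans ?_
  rw [Fin.prod_univ_two]
  by_cases h0 : n₀ = n₂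
  · have h1 : n₁ - n₂ ≠ 0 := fun h1 => h ⟨h0, by omega⟩
    simp only [Matrix.cons_val_one, Matrix.cons_val_fin_one]
    rw [integral_exp_int_mul h1, mul_zero]
  · have h1 : n₀ - n₂ ≠ 0 := fun h1 => h0 (by omega)
    simp only [Matrix.cons_val_zero]
    rw [integral_exp_int_mul h1, zero_mul]

lemma isUnimodular_torusChar (i j k : Fin 3) :
    IsUnimodular (fun θ => torusChar θ i) (fun θ => torusChar θ j) (fun θ => torusChar θ k) :=
  ⟨(continuous_torusChar i).measurable, (continuous_torusChar j).measurable,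
    (continuous_torusChar k).measurable, fun θ => norm_torusChar θ i, fun θ => norm_torusChar θ j,
    fun θ => norm_torusChar θ k⟩

lemma fin_three_cases {P : Fin 3 → Fin 3 → Fin 3 → Prop} (h1 : P 0 1 2) (h2 : P 0 2 1)
    (h3 : P 1 0 2) (h4 : P 1 2 0) (h5 : P 2 0 1) (h6 : P 2 1 0) {p q r : Fin 3} (hpq : p ≠ q)
    (hpr : p ≠ r) (hqr : q ≠ r) : P p q r := by
  fin_cases p <;> fin_cases q <;> fin_cases r <;>
  first
  | exact absurd rfl hpq
  | exact absurd rfl hpr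
  | exact absurd rfl hqr
  | assumption

/-- The characters in any order satisfy the basic vanishing property. -/
lemma vanishesAbove_one {i j k : Fin 3} (hij : i ≠ j) (hik : i ≠ k) (hjk : j ≠ k) :
    VanishesAbove (volume.restrict torusSquare) (fun θ => torusChar θ i) (fun θ => torusChar θ j)
      (fun θ => torusChar θ k) 0 fun _ => 1 := by
  refine ⟨measurable_const, ⟨1, by simp⟩, fun x y z hx => ?_⟩
  simp only [laurent, mul_one]
  refine fin_three_cases (P := fun i j k => ∫ θ in torusSquare,
    torusChar θ i ^ x * torusChar θ j ^ y * torusChar θ k ^ (-z) = 0)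
    (integral_torusChar x y (-z) (by omega))
    ((integral_torusChar x (-z) y (by omega)).symm.trans ?_).symm
    ((integral_torusChar y x (-z) (by omega)).symm.trans ?_).symm
    ((integral_torusChar (-z) x y (by omega)).symm.trans ?_).symm
    ((integral_torusChar y (-z) x (by omega)).symm.trans ?_).symm
    ((integral_torusChar (-z) y x (by omega)).symm.trans ?_).symm hij hik hjk
  all_goals
    refine integral_congr_ae (Filter.Eventually.of_forall fun θ => ?_)
    ring

/-- The symmetric denominator of the perturbed weight on the torus. -/
def torusDenom (b : ℂ) (θ : Fin 2 → ℝ) : ℂ := ∏ i, (1 + b * torusChar θ i ^ 3)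

lemma torusDenom_factor_ne_zero {b : ℂ} (hb : ‖b‖ ≤ 1 / 2) {t : ℂ} (ht : ‖t‖ = 1) :
    1 + b * t ≠ 0 := by
  intro h
  have : b * t = -1 := by linear_combination h
  have := congrArg norm this
  rw [norm_mul, ht, norm_neg, norm_one] at this
  linarith

/-- Cancellation of one term of the numerator against the denominator. -/
lemma numerator_div_denom {b : ℂ} (hb : ‖b‖ ≤ 1 / 2) {u v w : ℂ} (hu : ‖u‖ = 1) (hv : ‖v‖ = 1)
    (hw : ‖w‖ = 1) (x y : ℤ) :
    (u ^ x * w ^ (-y) + starRingEnd ℂ b * (u ^ (x - 3) * w ^ (-y)) + b * (u ^ x * w ^ (-(y - 3)))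
      + b * starRingEnd ℂ b * (u ^ (x - 3) * w ^ (-(y - 3))))
      * (((1 + b * u ^ 3) * (1 + b * v ^ 3) * (1 + b * w ^ 3)) *
        starRingEnd ℂ ((1 + b * u ^ 3) * (1 + b * v ^ 3) * (1 + b * w ^ 3)))⁻¹
      = (u ^ x * w ^ (-y)) * ((1 + b * u ^ 3)⁻¹ * (1 + starRingEnd ℂ b * (w ^ 3)⁻¹)⁻¹
        * (1 + b * v ^ 3)⁻¹ * (1 + starRingEnd ℂ b * (v ^ 3)⁻¹)⁻¹) := by
  have hb' : ‖starRingEnd ℂ b‖ ≤ 1 / 2 := by simpa using hb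
  have cu : starRingEnd ℂ u = u⁻¹ := (Complex.inv_eq_conj hu).symm
  have cv : starRingEnd ℂ v = v⁻¹ := (Complex.inv_eq_conj hv).symm
  have cw : starRingEnd ℂ w = w⁻¹ := (Complex.inv_eq_conj hw).symm
  have u0 : u ≠ 0 := by rw [← norm_ne_zero_iff, hu]; exact one_ne_zero
  have w0 : w ≠ 0 := by rw [← norm_ne_zero_iff, hw]; exact one_ne_zero
  have n1 : 1 + b * w ^ 3 ≠ 0 := torusDenom_factor_ne_zero hb (by simp [hw])
  have n2 : 1 + starRingEnd ℂ b * (u ^ 3)⁻¹ ≠ 0 := torusDenom_factor_ne_zero hb' (by simp [hu])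
  have e1 : u ^ (x - 3) = u ^ x * (u ^ 3)⁻¹ := by
    rw [zpow_sub₀ u0, div_eq_mul_inv]; norm_cast
  have e2 : w ^ (-(y - 3)) = w ^ (-y) * w ^ 3 := by
    rw [neg_sub, sub_eq_add_neg, zpow_add₀ w0, mul_comm]; norm_cast
  -- The four shifted monomials factor. The two factors are the ones in |D|² whose inverses would
  -- expand into negative degree.
  have e3 : u ^ x * w ^ (-y) + starRingEnd ℂ b * (u ^ (x - 3) * w ^ (-y))
      + b * (u ^ x * w ^ (-(y - 3))) + b * starRingEnd ℂ b * (u ^ (x - 3) * w ^ (-(y - 3)))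
      = u ^ x * w ^ (-y) * ((1 + starRingEnd ℂ b * (u ^ 3)⁻¹) * (1 + b * w ^ 3)) := by
    rw [e1, e2]; ring
  rw [e3]
  simp only [map_mul, map_add, map_one, map_pow, cu, cv, cw, inv_pow]
  simp only [mul_inv]
  calc _ = u ^ x * w ^ (-y) * ((1 + b * u ^ 3)⁻¹ * (1 + starRingEnd ℂ b * (w ^ 3)⁻¹)⁻¹
        * (1 + b * v ^ 3)⁻¹ * (1 + starRingEnd ℂ b * (v ^ 3)⁻¹)⁻¹)
        * ((1 + starRingEnd ℂ b * (u ^ 3)⁻¹) * (1 + starRingEnd ℂ b * (u ^ 3)⁻¹)⁻¹)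
        * ((1 + b * w ^ 3) * (1 + b * w ^ 3)⁻¹) := by ring
    _ = _ := by rw [mul_inv_cancel₀ n1, mul_inv_cancel₀ n2, mul_one, mul_one]

/-- The part of the integrand that does not depend on the order of the characters. -/
def torusTest (i j : ℕ) (θ : Fin 2 → ℝ) : ℂ :=
  alternant (torusChar θ 0) (torusChar θ 1) (torusChar θ 2) 1 1
    * (toComplex (torusMap θ) ^ i * starRingEnd ℂ (toComplex (torusMap θ)) ^ j)

/-- One of the six terms of `bandAlternant`. -/
def bandTerm (b u w : ℂ) (x y : ℤ) : ℂ :=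
  u ^ x * w ^ (-y) + starRingEnd ℂ b * (u ^ (x - 3) * w ^ (-y)) + b * (u ^ x * w ^ (-(y - 3)))
      + b * starRingEnd ℂ b * (u ^ (x - 3) * w ^ (-(y - 3)))

lemma bandAlternant_eq_bandTerm (b t₀ t₁ t₂ : ℂ) (x y : ℤ) :
    bandAlternant b (starRingEnd ℂ b) t₀ t₁ t₂ x y = bandTerm b t₀ t₂ x y - bandTerm b t₁ t₂ x y
      - bandTerm b t₀ t₁ x y + bandTerm b t₁ t₀ x y + bandTerm b t₂ t₁ x y
      - bandTerm b t₂ t₀ x y := by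
  unfold bandAlternant bandTerm alternant
  ring

lemma torusDenom_ne_zero {b : ℂ} (hb : ‖b‖ ≤ 1 / 2) (θ : Fin 2 → ℝ) : torusDenom b θ ≠ 0 :=
  Finset.prod_ne_zero_iff.2 fun i _ => torusDenom_factor_ne_zero hb (by simp [norm_torusChar])

lemma continuous_torusTest (i j : ℕ) : Continuous (torusTest i j) := by
  have h : ∀ i, Continuous fun θ => torusChar θ i := continuous_torusChar
  have hi : ∀ i, Continuous fun θ => (torusChar θ i)⁻¹ := fun i =>
    (h i).inv₀ fun θ => torusChar_ne_zero θ i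
  unfold torusTest alternant
  simp only [toComplex_torusMap, zpow_one, zpow_neg_one]
  have := h 0; have := h 1; have := h 2
  have := hi 0; have := hi 1; have := hi 2
  fun_prop

/-- The argument for a fixed order applies to every order: reordering the characters leaves z, conj
z and the denominator unchanged and changes the Vandermonde product only by a sign s. -/
lemma integral_bandTerm {b : ℂ} (hb : ‖b‖ ≤ 1 / 2) {p q r : Fin 3} (hpq : p ≠ q) (hpr : p ≠ r)
    (hqr : q ≠ r) (x y : ℤ) (i j : ℕ) (hx : i + j + 2 < x + y) :
    ∫ θ in torusSquare, bandTerm b (torusChar θ p) (torusChar θ r) x y *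
      (torusTest i j θ * (torusDenom b θ * starRingEnd ℂ (torusDenom b θ))⁻¹) = 0 := by
  have h := integral_laurent_term_eq_zero (isUnimodular_torusChar p q r)
    (vanishesAbove_one hpq hpr hqr) hb (b' := starRingEnd ℂ b) (by simpa using hb) x y i j hx
  have hs : ∃ s : ℂ, s * s = 1 ∧ ∀ θ,
      alternant (torusChar θ p) (torusChar θ q) (torusChar θ r) 1 1
        = s * alternant (torusChar θ 0) (torusChar θ 1) (torusChar θ 2) 1 1 := by
    refine fin_three_cases (P := fun p q r => ∃ s : ℂ, s * s = 1 ∧ ∀ θ,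
      alternant (torusChar θ p) (torusChar θ q) (torusChar θ r) 1 1
        = s * alternant (torusChar θ 0) (torusChar θ 1) (torusChar θ 2) 1 1)
      ⟨1, by norm_num, fun θ => ?_⟩ ⟨-1, by norm_num, fun θ => ?_⟩ ⟨-1, by norm_num, fun θ => ?_⟩
      ⟨1, by norm_num, fun θ => ?_⟩ ⟨1, by norm_num, fun θ => ?_⟩ ⟨-1, by norm_num, fun θ => ?_⟩
      hpq hpr hqr <;> simp only [alternant] <;> ring
  obtain ⟨s, hs, hs'⟩ := hs
  have hsum : ∀ f : Fin 3 → ℂ, f p + f q + f r = f 0 + f 1 + f 2 := by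
    intro f
    refine fin_three_cases (P := fun p q r => f p + f q + f r = f 0 + f 1 + f 2)
      ?_ ?_ ?_ ?_ ?_ ?_ hpq hpr hqr <;> ring
  have hprod : ∀ f : Fin 3 → ℂ, f p * f q * f r = f 0 * f 1 * f 2 := by
    intro f
    refine fin_three_cases (P := fun p q r => f p * f q * f r = f 0 * f 1 * f 2)
      ?_ ?_ ?_ ?_ ?_ ?_ hpq hpr hqr <;> ring
  rw [← mul_zero s, ← h, ← integral_const_mul]
  refine integral_congr_ae (Filter.Eventually.of_forall fun θ => ?_)
  have hd : torusDenom b θ = (1 + b * torusChar θ p ^ 3) * (1 + b * torusChar θ q ^ 3)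
      * (1 + b * torusChar θ r ^ 3) := by
    rw [torusDenom, Fin.prod_univ_three, hprod fun i => 1 + b * torusChar θ i ^ 3]
  have hz : torusChar θ p + torusChar θ q + torusChar θ r = toComplex (torusMap θ) := by
    rw [toComplex_torusMap, hsum fun i => torusChar θ i]
  have hw : (torusChar θ p)⁻¹ + (torusChar θ q)⁻¹ + (torusChar θ r)⁻¹
      = starRingEnd ℂ (toComplex (torusMap θ)) := by
    rw [conj_toComplex_torusMap, hsum fun i => (torusChar θ i)⁻¹]
  have hn := numerator_div_denom hb (norm_torusChar θ p) (norm_torusChar θ q) (norm_torusChar θ r)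
    x y
  rw [← hd] at hn
  simp only [hz, hw, hs']
  rw [torusTest, bandTerm]
  linear_combination (alternant (torusChar θ 0) (torusChar θ 1) (torusChar θ 2) 1 1
    * (toComplex (torusMap θ) ^ i * starRingEnd ℂ (toComplex (torusMap θ)) ^ j)) * hn
    + (torusChar θ p ^ x * torusChar θ r ^ (-y) *
      (alternant (torusChar θ 0) (torusChar θ 1) (torusChar θ 2) 1 1 *
        (toComplex (torusMap θ) ^ i * (starRingEnd ℂ (toComplex (torusMap θ)) ^ j *
        ((1 + b * torusChar θ p ^ 3)⁻¹ * (1 + starRingEnd ℂ b * (torusChar θ r ^ 3)⁻¹)⁻¹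
        * (1 + b * torusChar θ q ^ 3)⁻¹ * (1 + starRingEnd ℂ b * (torusChar θ q ^ 3)⁻¹)⁻¹))))) * (-hs)

lemma continuous_bandTerm (b : ℂ) (p r : Fin 3) (x y : ℤ) :
    Continuous fun θ => bandTerm b (torusChar θ p) (torusChar θ r) x y := by
  have h : ∀ i (n : ℤ), Continuous fun θ => torusChar θ i ^ n := fun i n =>
    (continuous_torusChar i).zpow₀ n fun θ => Or.inl (torusChar_ne_zero θ i)
  unfold bandTerm
  have := h p x; have := h p (x - 3); have := h r (-y); have := h r (-(y - 3))
  fun_prop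

lemma continuous_torusDenom (b : ℂ) : Continuous (torusDenom b) := by
  unfold torusDenom
  exact continuous_finsetProd _ fun i _ =>
    continuous_const.add (continuous_const.mul ((continuous_torusChar i).pow 3))

lemma integrableOn_torusSquare {f : (Fin 2 → ℝ) → ℂ} (hf : Continuous f) :
    IntegrableOn f torusSquare := by
  refine (hf.continuousOn.integrableOn_compact
    (isCompact_univ_pi fun _ => isCompact_Icc)).mono_set
    (Set.pi_mono fun _ _ => Set.Ioc_subset_Icc_self)

lemma integral_bandAlternant {b : ℂ} (hb : ‖b‖ ≤ 1 / 2) (x y : ℤ) (i j : ℕ)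
    (hx : i + j + 2 < x + y) :
    ∫ θ in torusSquare, bandAlternant b (starRingEnd ℂ b) (torusChar θ 0) (torusChar θ 1)
      (torusChar θ 2) x y *
      (torusTest i j θ * (torusDenom b θ * starRingEnd ℂ (torusDenom b θ))⁻¹) = 0 := by
  obtain ⟨G, hG⟩ : ∃ G : Fin 3 → Fin 3 → (Fin 2 → ℝ) → ℂ, ∀ p r θ, G p r θ
      = bandTerm b (torusChar θ p) (torusChar θ r) x y *
        (torusTest i j θ * (torusDenom b θ * starRingEnd ℂ (torusDenom b θ))⁻¹) :=
    ⟨_, fun _ _ _ => rfl⟩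
  have hi : ∀ p r : Fin 3, IntegrableOn (G p r) torusSquare := fun p r => by
    rw [funext (hG p r)]
    exact integrableOn_torusSquare <| (continuous_bandTerm b p r x y).mul <|
      (continuous_torusTest i j).mul <| ((continuous_torusDenom b).mul
        (Complex.continuous_conj.comp (continuous_torusDenom b))).inv₀ fun θ =>
          mul_ne_zero (torusDenom_ne_zero hb θ)
            ((map_ne_zero (starRingEnd ℂ)).2 (torusDenom_ne_zero hb θ))
  have h0 : ∀ {p r : Fin 3} (q : Fin 3), p ≠ q → p ≠ r → q ≠ r →
      ∫ θ in torusSquare, G p r θ = 0 := fun {p r} q h1 h2 h3 => by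
    rw [funext (hG p r)]
    exact integral_bandTerm hb h1 h2 h3 x y i j hx
  have e : (fun θ => bandAlternant b (starRingEnd ℂ b) (torusChar θ 0) (torusChar θ 1)
      (torusChar θ 2) x y *
      (torusTest i j θ * (torusDenom b θ * starRingEnd ℂ (torusDenom b θ))⁻¹))
      = G 0 2 - G 1 2 - G 0 1 + G 1 0 + G 2 1 - G 2 0 := by
    ext θ
    simp only [Pi.add_apply, Pi.sub_apply, hG, bandAlternant_eq_bandTerm]
    ring
  have i1 := (hi 0 2).sub (hi 1 2)
  have i2 := i1.sub (hi 0 1)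
  have i3 := i2.add (hi 1 0)
  have i4 := i3.add (hi 2 1)
  rw [e, integral_sub' i4 (hi 2 0), integral_add' i3 (hi 2 1), integral_add' i2 (hi 1 0),
    integral_sub' i1 (hi 0 1), integral_sub' (hi 0 2) (hi 1 2),
    h0 (p := 0) (r := 2) 1 (by decide) (by decide) (by decide),
    h0 (p := 1) (r := 2) 0 (by decide) (by decide) (by decide),
    h0 (p := 0) (r := 1) 2 (by decide) (by decide) (by decide),
    h0 (p := 1) (r := 0) 2 (by decide) (by decide) (by decide),
    h0 (p := 2) (r := 1) 0 (by decide) (by decide) (by decide),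
    h0 (p := 2) (r := 0) 1 (by decide) (by decide) (by decide)]
  norm_num

/-! ### The polynomials `Q` -/

/-- Telescoping: each term contains one constant difference in place of a linear factor, so one
degree is lost. -/
lemma totalDegree_prod_sub_prod_le {ι : Type*} (s : Finset ι) (a b : ι → MvPolynomial (Fin 2) ℂ)
    (ha : ∀ i ∈ s, (a i).totalDegree ≤ 1) (hb : ∀ i ∈ s, (b i).totalDegree ≤ 1)
    (hab : ∀ i ∈ s, (a i - b i).totalDegree = 0) :
    (∏ i ∈ s, a i - ∏ i ∈ s, b i).totalDegree ≤ s.card - 1 := by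
  classical
  induction s using Finset.induction_on with
  | empty => simp
  | insert i s hi ih =>
    have ih := ih (fun j hj => ha j (Finset.mem_insert_of_mem hj))
      (fun j hj => hb j (Finset.mem_insert_of_mem hj))
      (fun j hj => hab j (Finset.mem_insert_of_mem hj))
    rw [Finset.prod_insert hi, Finset.prod_insert hi, Finset.card_insert_of_notMem hi,
      Nat.add_sub_cancel]
    have e : a i * ∏ j ∈ s, a j - b i * ∏ j ∈ s, b j
        = a i * (∏ j ∈ s, a j - ∏ j ∈ s, b j) + (a i - b i) * ∏ j ∈ s, b j := by ring
    rw [e]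
    refine (totalDegree_add _ _).trans (max_le ?_ ?_)
    · rcases s.eq_empty_or_nonempty with rfl | hs
      · simp
      · refine (totalDegree_mul _ _).trans ?_
        have := ha i (Finset.mem_insert_self _ _)
        have := hs.card_pos
        omega
    · refine (totalDegree_mul _ _).trans ?_
      rw [hab i (Finset.mem_insert_self _ _), zero_add]
      refine (totalDegree_finsetProd _ _).trans ?_
      refine (Finset.sum_le_card_nsmul s _ 1 fun j hj =>
        hb j (Finset.mem_insert_of_mem hj)).trans ?_
      simp

lemma totalDegree_det_sub_det_lt {m : ℕ} (hm : 1 ≤ m)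
    (A B : Matrix (Fin m) (Fin m) (MvPolynomial (Fin 2) ℂ))
    (hA : ∀ i j, (A i j).totalDegree ≤ 1) (hB : ∀ i j, (B i j).totalDegree ≤ 1)
    (hAB : ∀ i j, (A i j - B i j).totalDegree = 0) : (A.det - B.det).totalDegree < m := by
  rw [Matrix.det_apply, Matrix.det_apply, ← Finset.sum_sub_distrib]
  refine lt_of_le_of_lt (totalDegree_finsetSum_le (d := m - 1) fun σ _ => ?_) (by omega)
  rw [← smul_sub]
  have h := totalDegree_prod_sub_prod_le Finset.univ (fun i => A (σ i) i) (fun i => B (σ i) i)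
    (fun i _ => hA _ _) (fun i _ => hB _ _) (fun i _ => hAB _ _)
  rw [Finset.card_univ, Fintype.card_fin] at h
  rcases Int.units_eq_one_or (Equiv.Perm.sign σ) with hs | hs
  · rwa [hs, one_smul]
  · rwa [hs, Units.neg_smul, one_smul, totalDegree_neg]

/-- The part of degree one of the banded matrix. -/
def linearMatrix (m : ℕ) : Matrix (Fin m) (Fin (m + 1)) (MvPolynomial (Fin 2) ℂ) :=
  Matrix.of fun i j => if (j : ℕ) = i then X 0 else if (j : ℕ) = i + 1 then X 1 else 0

/-- Deleting column k splits the bidiagonal matrix into an upper triangular block with z on the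
diagonal and a lower triangular block with conj z on the diagonal. -/
lemma det_linearMatrix (m : ℕ) (k : Fin (m + 1)) :
    ((linearMatrix m).submatrix id k.succAbove).det = X 0 ^ (k : ℕ) * X 1 ^ (m - k : ℕ) := by
  have hk : (k : ℕ) ≤ m := Nat.lt_succ_iff.1 k.2
  rw [Matrix.twoBlockTriangular_det _ (fun i : Fin m => (i : ℕ) < k)]
  · rw [Matrix.det_of_isUpperTriangular, Matrix.det_of_isLowerTriangular]
    · congr 1
      · rw [Finset.prod_congr rfl (g := fun _ => X 0), Finset.prod_const, Finset.card_univ,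
          Fintype.card_fin_lt_of_le hk]
        rintro ⟨i, hi⟩ _
        have : i.castSucc < k := hi
        simp [Matrix.toSquareBlockProp, linearMatrix, Fin.succAbove, this]
      · rw [Finset.prod_congr rfl (g := fun _ => X 1), Finset.prod_const, Finset.card_univ,
          Fintype.card_subtype_compl, Fintype.card_fin_lt_of_le hk, Fintype.card_fin]
        rintro ⟨i, hi⟩ _
        have : ¬ i.castSucc < k := hi
        simp [Matrix.toSquareBlockProp, linearMatrix, Fin.succAbove, this]
    · rintro ⟨i, hi⟩ ⟨j, hj⟩ hij
      have h1 : ¬ i.castSucc < k := hi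
      have h2 : ¬ j.castSucc < k := hj
      have h3 : (i : ℕ) < j := by simpa using hij
      have h4 : (k.succAbove j : ℕ) = j + 1 := by simp [Fin.succAbove, h2]
      change (if ((k.succAbove j : Fin (m + 1)) : ℕ) = i then (X 0 : MvPolynomial (Fin 2) ℂ)
        else if ((k.succAbove j : Fin (m + 1)) : ℕ) = i + 1 then X 1 else 0) = 0
      rw [h4, if_neg (by omega), if_neg (by omega)]
    · rintro ⟨i, hi⟩ ⟨j, hj⟩ hij
      have h2 : j.castSucc < k := hj
      have h3 : (j : ℕ) < i := by simpa using hij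
      have h4 : (k.succAbove j : ℕ) = j := by simp [Fin.succAbove, h2]
      change (if ((k.succAbove j : Fin (m + 1)) : ℕ) = i then (X 0 : MvPolynomial (Fin 2) ℂ)
        else if ((k.succAbove j : Fin (m + 1)) : ℕ) = i + 1 then X 1 else 0) = 0
      rw [h4, if_neg (by omega), if_neg (by omega)]
  · intro i hi j hj
    have h2 : j.castSucc < k := hj
    have h4 : (k.succAbove j : ℕ) = j := by simp [Fin.succAbove, h2]
    simp only [Matrix.of_apply, Matrix.submatrix_apply, linearMatrix, id, h4]
    rw [if_neg (by omega), if_neg (by omega)]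

/-- The leading monomial of `Q`. -/
lemma totalDegree_monomial_sub_Q_lt (a c : ℂ) {m : ℕ} (hm : 1 ≤ m) (k : Fin (m + 1)) :
    (X 0 ^ (m - k : ℕ) * X 1 ^ (k : ℕ) - Q a c m k).totalDegree < m := by
  have hk : (k : ℕ) ≤ m := Nat.lt_succ_iff.1 k.2
  have h := det_linearMatrix m k.rev
  rw [Fin.val_rev, show m + 1 - (k + 1) = m - (k : ℕ) by omega,
    show m - (m - (k : ℕ)) = k by omega] at h
  rw [← h, Q]
  have hX : ∀ i : Fin 2, (X i : MvPolynomial (Fin 2) ℂ).totalDegree ≤ 1 := fun i => by simp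
  refine totalDegree_det_sub_det_lt hm _ _ (fun i j => ?_) (fun i j => ?_) (fun i j => ?_)
  · simp only [Matrix.submatrix_apply, linearMatrix, Matrix.of_apply]
    split_ifs <;> simp
  · simp only [Matrix.submatrix_apply, charMatrix, Matrix.of_apply]
    split_ifs <;> simp
  · simp only [Matrix.submatrix_apply, charMatrix, linearMatrix, Matrix.of_apply]
    split_ifs <;> simp

/-- The kernel relation between the `Q`. -/
lemma X_mul_Q_sub (a c : ℂ) (m : ℕ) (j : Fin m) :
    X 0 * Q a c m j.succ - X 1 * Q a c m j.castSucc
      ∈ Submodule.span ℂ (Set.range (Q a c m)) := by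
  have h := sum_neg_one_pow_mul_minor_eq_zero (charMatrix a c m) j.rev
  rw [← Equiv.sum_comp Fin.revPerm] at h
  simp only [Fin.revPerm_apply] at h
  have hQ : ∀ l : Fin (m + 1), ((charMatrix a c m).submatrix id (Fin.succAbove l.rev)).det
      = Q a c m l := fun l => rfl
  simp only [hQ] at h
  have h1 : charMatrix a c m j.rev j.succ.rev = X 0 := by
    simp [charMatrix, Fin.val_rev]
  have h2 : charMatrix a c m j.rev j.castSucc.rev = X 1 := by
    have : m - (j : ℕ) = m - (j + 1) + 1 := by omega
    simp [charMatrix, Fin.val_rev, this]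
  have hne : j.succ ≠ j.castSucc := (Fin.castSucc_lt_succ).ne'
  rw [← Finset.add_sum_erase _ _ (Finset.mem_univ j.succ), ← Finset.add_sum_erase _ _
    (Finset.mem_erase.2 ⟨hne.symm, Finset.mem_univ j.castSucc⟩), h1, h2] at h
  have e1 : ((j.succ.rev : Fin (m + 1)) : ℕ) + 1 = (j.castSucc.rev : Fin (m + 1)) := by
    simp [Fin.val_rev]; omega
  rw [← e1, pow_succ] at h
  set ε : MvPolynomial (Fin 2) ℂ := (-1) ^ ((j.succ.rev : Fin (m + 1)) : ℕ) with hε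
  have hε2 : ε * ε = 1 := by rw [hε, ← mul_pow]; simp
  -- The other entries of the row are constants, so the rest of the kernel relation is a scalar
  -- combination of the Q's.
  set R := ∑ x ∈ (Finset.univ.erase j.succ).erase j.castSucc,
    (-1) ^ ((x.rev : Fin (m + 1)) : ℕ) * charMatrix a c m j.rev x.rev * Q a c m x with hR
  have hRmem : ε * R ∈ Submodule.span ℂ (Set.range (Q a c m)) := by
    rw [hR, Finset.mul_sum]
    refine Submodule.sum_mem _ fun x hx => ?_
    obtain ⟨d, hd⟩ : ∃ d : ℂ, charMatrix a c m j.rev x.rev = C d := by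
      simp only [Finset.mem_erase, Finset.mem_univ, and_true] at hx
      have hx1 : (x : ℕ) ≠ j := fun h => hx.1 (Fin.ext h)
      have hx2 : (x : ℕ) ≠ j + 1 := fun h => hx.2 (Fin.ext h)
      have hx3 := x.2
      simp only [charMatrix, Matrix.of_apply, Fin.val_rev]
      rw [if_neg (by omega), if_neg (by omega)]
      split_ifs
      · exact ⟨_, rfl⟩
      · exact ⟨_, rfl⟩
      · exact ⟨_, rfl⟩
      · exact ⟨_, rfl⟩
      · exact ⟨0, by simp⟩
    have : ε * ((-1) ^ ((x.rev : Fin (m + 1)) : ℕ) * charMatrix a c m j.rev x.rev * Q a c m x)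
        = ((-1) ^ ((j.succ.rev : Fin (m + 1)) : ℕ) * (-1) ^ ((x.rev : Fin (m + 1)) : ℕ) * d)
          • Q a c m x := by
      rw [hd, hε, smul_eq_C_mul]
      simp
      ring
    rw [this]
    exact Submodule.smul_mem _ _ (Submodule.subset_span ⟨x, rfl⟩)
  have : X 0 * Q a c m j.succ - X 1 * Q a c m j.castSucc = -(ε * R) := by
    linear_combination ε * h - (X 0 * Q a c m j.succ - X 1 * Q a c m j.castSucc) * hε2
  rw [this]
  exact Submodule.neg_mem _ hRmem

/-! ### Dimension of the polynomials of bounded degree -/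

lemma finrank_restrictTotalDegree (n : ℕ) :
    Module.finrank ℂ (restrictTotalDegree (Fin 2) ℂ n) = (n + 2).choose 2 := by
  have h : Module.finrank ℂ (restrictTotalDegree (Fin 2) ℂ n)
      = Nat.card {s : Fin 2 →₀ ℕ | (s.sum fun _ e => e) ≤ n} :=
    Module.finrank_eq_nat_card_basis (basisRestrictSupport ℂ _)
  rw [h]
  let e : {s : Fin 2 →₀ ℕ | (s.sum fun _ e => e) ≤ n} ≃
      ((Finset.range (n + 1)).sigma fun k => Finset.HasAntidiagonal.antidiagonal k) :=
    { toFun := fun s => ⟨⟨s.1 0 + s.1 1, (s.1 0, s.1 1)⟩, by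
        have := s.2
        simp [Finsupp.sum_fintype] at this
        simp; omega⟩
      invFun := fun x => ⟨Finsupp.equivFunOnFinite.symm ![x.1.2.1, x.1.2.2], by
        obtain ⟨⟨k, p⟩, hx⟩ := x
        rw [Finset.mem_sigma, Finset.mem_range, Finset.HasAntidiagonal.mem_antidiagonal] at hx
        obtain ⟨h1, h2⟩ := hx
        simp only at h1 h2
        simp [Finsupp.sum_fintype]; omega⟩
      left_inv := fun s => by
        ext i; fin_cases i <;> simp
      right_inv := fun x => by
        obtain ⟨⟨k, p⟩, hx⟩ := x
        simp at hx
        obtain ⟨h1, rfl⟩ := hx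
        simp }
  rw [Nat.card_congr e, Nat.card_eq_fintype_card, Fintype.card_coe, Finset.card_sigma]
  simp only [Finset.Nat.card_antidiagonal]
  clear e h
  induction n with
  | zero => simp
  | succ n ih =>
    rw [Finset.sum_range_succ, ih, Nat.choose_succ_succ' (n + 2) 1, Nat.choose_one_right]
    simp only [Nat.reduceAdd]
    omega

/-! ### Cubature from commuting truncated multiplication operators -/

section Operators

open scoped InnerProductSpace

/-- Joint diagonalisation of a commuting pair of adjoint operators, applied to a vector. -/
lemma exists_eigenvector_decomposition {H : Type*} [NormedAddCommGroup H] [InnerProductSpace ℂ H]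
    [FiniteDimensional ℂ H] (Z W : Module.End ℂ H) (hZW : Commute Z W)
    (hadj : ∀ u v, ⟪Z u, v⟫_ℂ = ⟪u, W v⟫_ℂ) (e : H) :
    ∃ (S : Finset (Fin 2 → ℝ)) (v : (Fin 2 → ℝ) → H),
      (∀ s ∈ S, v s ≠ 0 ∧ Z (v s) = toComplex s • v s ∧
        W (v s) = starRingEnd ℂ (toComplex s) • v s) ∧
      (∀ s ∈ S, ∀ t ∈ S, s ≠ t → ⟪v s, v t⟫_ℂ = 0) ∧ ∑ s ∈ S, v s = e := by
  classical
  have hadj' : ∀ u v, ⟪W u, v⟫_ℂ = ⟪u, Z v⟫_ℂ := fun u v => by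
    rw [← inner_conj_symm, ← hadj, inner_conj_symm]
  -- The real and imaginary parts are commuting symmetric operators; their real eigenvalues will be
  -- the coordinates of the nodes.
  set A : Module.End ℂ H := (1 / 2 : ℂ) • (Z + W) with hA
  set B : Module.End ℂ H := (-Complex.I / 2) • (Z - W) with hB
  have hAs : A.IsSymmetric := fun u v => by
    simp only [hA, LinearMap.smul_apply, LinearMap.add_apply, inner_smul_left, inner_smul_right,
      inner_add_left, inner_add_right, hadj, hadj', map_div₀, map_one, Complex.conj_ofNat]
    ring
  have hBs : B.IsSymmetric := fun u v => by
    simp only [hB, LinearMap.smul_apply, LinearMap.sub_apply, inner_smul_left, inner_smul_right,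
      inner_sub_left, inner_sub_right, hadj, hadj', map_div₀, map_neg, Complex.conj_I,
      Complex.conj_ofNat]
    ring
  have hAB : Commute A B := by
    refine Commute.smul_left (Commute.smul_right ?_ _) _
    exact ((Commute.refl Z).sub_right hZW).add_left (hZW.symm.sub_right (Commute.refl W))
  have hZ : Z = A + Complex.I • B := by
    rw [hA, hB, smul_smul, show Complex.I * (-Complex.I / 2) = 1 / 2 by
      linear_combination (-1 / 2 : ℂ) * Complex.I_mul_I]
    module
  have hW : W = A - Complex.I • B := by
    rw [hA, hB, smul_smul, show Complex.I * (-Complex.I / 2) = 1 / 2 by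
      linear_combination (-1 / 2 : ℂ) * Complex.I_mul_I]
    module
  clear_value A B
  have htop : e ∈ ⨆ i : ℂ × ℂ, Module.End.eigenspace A i.2 ⊓ Module.End.eigenspace B i.1 := by
    have := (LinearMap.IsSymmetric.directSum_isInternal_of_commute hAs hBs hAB
      ).submodule_iSup_eq_top
    rw [this]; trivial
  have horth := LinearMap.IsSymmetric.orthogonalFamily_eigenspace_inf_eigenspace hAs hBs
  rw [Submodule.mem_iSup_iff_exists_finsupp] at htop
  obtain ⟨f, hf, hfe⟩ := htop
  have hreal : ∀ i ∈ f.support, i = (((i.1.re : ℝ) : ℂ), ((i.2.re : ℝ) : ℂ)) := fun i hi => by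
    have hne : f i ≠ 0 := Finsupp.mem_support_iff.1 hi
    have h2 := hAs.conj_eigenvalue_eq_self (μ := i.2)
      (Module.End.hasEigenvalue_of_hasEigenvector ⟨(hf i).1, hne⟩)
    have h1 := hBs.conj_eigenvalue_eq_self (μ := i.1)
      (Module.End.hasEigenvalue_of_hasEigenvector ⟨(hf i).2, hne⟩)
    rw [Complex.conj_eq_iff_re] at h1 h2
    rw [h1, h2]
  -- The second component of the index belongs to the real part A and the first to B, hence the
  -- swap.
  let g : ℂ × ℂ → Fin 2 → ℝ := fun i => ![i.2.re, i.1.re]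
  let h : (Fin 2 → ℝ) → ℂ × ℂ := fun s => ((s 1 : ℂ), (s 0 : ℂ))
  have hhg : ∀ i ∈ f.support, h (g i) = i := fun i hi => by
    rw [hreal i hi]; simp [h, g]
  have hginj : Set.InjOn g f.support := fun i hi j hj hij => by
    rw [← hhg i hi, ← hhg j hj, hij]
  refine ⟨f.support.image g, fun s => f (h s), ?_, ?_, ?_⟩
  · intro s hs
    obtain ⟨i, hi, rfl⟩ := Finset.mem_image.1 hs
    simp only [hhg i hi]
    have e1 := Module.End.mem_eigenspace_iff.1 (hf i).1
    have e2 := Module.End.mem_eigenspace_iff.1 (hf i).2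
    have e3 : toComplex (g i) = i.2 + Complex.I * i.1 := by
      conv_rhs => rw [hreal i hi]
      simp [toComplex, g]
    have e4 : starRingEnd ℂ (toComplex (g i)) = i.2 - Complex.I * i.1 := by
      rw [e3]
      conv_lhs => rw [hreal i hi]
      conv_rhs => rw [hreal i hi]
      simp
      ring
    refine ⟨Finsupp.mem_support_iff.1 hi, ?_, ?_⟩
    · rw [hZ, LinearMap.add_apply, LinearMap.smul_apply, e1, e2, e3, smul_smul, add_smul]
    · rw [hW, LinearMap.sub_apply, LinearMap.smul_apply, e1, e2, e4, smul_smul, sub_smul]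
  · intro s hs t ht hst
    obtain ⟨i, hi, rfl⟩ := Finset.mem_image.1 hs
    obtain ⟨j, hj, rfl⟩ := Finset.mem_image.1 ht
    simp only [hhg i hi, hhg j hj]
    have hij : i ≠ j := fun h => hst (by rw [h])
    exact horth hij ⟨f i, hf i⟩ ⟨f j, hf j⟩
  · rw [Finset.sum_image hginj, ← hfe, Finsupp.sum]
    exact Finset.sum_congr rfl fun i hi => by rw [hhg i hi]

variable {V : Type*} [NormedAddCommGroup V] [InnerProductSpace ℂ V]

/-- The vectors `Z ^ i * W ^ j` applied to `e`. -/
def moment (Z W : Module.End ℂ V) (e : V) (i j : ℕ) : V := (Z ^ i) ((W ^ j) e)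

/-- The span of the moments of degree at most `n`. -/
def momentSpan (Z W : Module.End ℂ V) (e : V) (n : ℕ) : Submodule ℂ V :=
  Submodule.span ℂ {u | ∃ i j : ℕ, i + j ≤ n ∧ u = moment Z W e i j}

lemma moment_mem {Z W : Module.End ℂ V} {e : V} {n i j : ℕ} (h : i + j ≤ n) :
    moment Z W e i j ∈ momentSpan Z W e n := Submodule.subset_span ⟨i, j, h, rfl⟩

instance finiteDimensional_momentSpan (Z W : Module.End ℂ V) (e : V) (n : ℕ) :
    FiniteDimensional ℂ (momentSpan Z W e n) := by
  refine FiniteDimensional.span_of_finite ℂ (Set.Finite.subset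
    (((Finset.range (n + 1)).product (Finset.range (n + 1))).finite_toSet.image
      fun p => moment Z W e p.1 p.2) ?_)
  rintro u ⟨i, j, h, rfl⟩
  refine ⟨(i, j), ?_, rfl⟩
  simp
  omega

lemma moment_succ_left (Z W : Module.End ℂ V) (e : V) (i j : ℕ) :
    moment Z W e (i + 1) j = Z (moment Z W e i j) := by
  rw [moment, pow_succ', Module.End.mul_apply, moment]

lemma moment_succ_right {Z W : Module.End ℂ V} (hZW : Commute Z W) (e : V) (i j : ℕ) :
    moment Z W e i (j + 1) = W (moment Z W e i j) := by
  rw [moment, pow_succ', Module.End.mul_apply, moment, ← Module.End.mul_apply (Z ^ i),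
    (hZW.pow_left i).eq, Module.End.mul_apply]

/-- Moving Z and W to the left slot replaces each by the other, so the exponents i and j appear
there interchanged. -/
lemma inner_moment_add {Z W : Module.End ℂ V} (hZW : Commute Z W)
    (hadj : ∀ u v, ⟪Z u, v⟫_ℂ = ⟪u, W v⟫_ℂ) (e : V) (i j k l : ℕ) :
    ⟪e, moment Z W e (i + k) (j + l)⟫_ℂ = ⟪moment Z W e j i, moment Z W e k l⟫_ℂ := by
  have hadj' : ∀ u v, ⟪W u, v⟫_ℂ = ⟪u, Z v⟫_ℂ := fun u v => by
    rw [← inner_conj_symm, ← hadj, inner_conj_symm]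
  have hZp : ∀ (n : ℕ) u v, ⟪u, (Z ^ n) v⟫_ℂ = ⟪(W ^ n) u, v⟫_ℂ := by
    intro n
    induction n with
    | zero => simp
    | succ n ih =>
      intro u v
      rw [pow_succ, Module.End.mul_apply, ih, ← hadj', pow_succ', Module.End.mul_apply]
  have hWp : ∀ (n : ℕ) u v, ⟪u, (W ^ n) v⟫_ℂ = ⟪(Z ^ n) u, v⟫_ℂ := by
    intro n
    induction n with
    | zero => simp
    | succ n ih =>
      intro u v
      rw [pow_succ, Module.End.mul_apply, ih, ← hadj, pow_succ', Module.End.mul_apply]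
  have h1 : moment Z W e (i + k) (j + l) = (Z ^ i) ((W ^ j) (moment Z W e k l)) := by
    simp only [moment, ← Module.End.mul_apply]
    congr 1
    rw [pow_add, pow_add]
    simp only [mul_assoc]
    rw [← mul_assoc (W ^ j), ((hZW.pow_pow k j).eq).symm, mul_assoc]
  rw [h1, hZp, hWp]
  rfl

/-- Gaussian cubature in operator form. -/
theorem exists_cubature_of_orthogonal {Z W : Module.End ℂ V} (hZW : Commute Z W)
    (hadj : ∀ u v, ⟪Z u, v⟫_ℂ = ⟪u, W v⟫_ℂ) (e : V) (n : ℕ) (q : ℕ → V)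
    (hq : ∀ k ≤ n + 1, q k ∈ (momentSpan Z W e n)ᗮ)
    (hlead : ∀ k ≤ n + 1, moment Z W e (n + 1 - k) k - q k ∈ momentSpan Z W e n)
    (hker : ∀ k ≤ n, Z (q (k + 1)) - W (q k) ∈ (momentSpan Z W e n)ᗮ) :
    ∃ (S : Finset (Fin 2 → ℝ)) (w : (Fin 2 → ℝ) → ℝ),
      S.card = Module.finrank ℂ (momentSpan Z W e n) ∧ (∀ s ∈ S, w s ≠ 0) ∧
      ∀ i j : ℕ, i + j ≤ 2 * n + 1 → ⟪e, moment Z W e i j⟫_ℂ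
        = ∑ s ∈ S, (w s : ℂ) * (toComplex s ^ i * starRingEnd ℂ (toComplex s) ^ j) := by
  classical
  set E := momentSpan Z W e n with hE
  set P : V →L[ℂ] V := E.starProjection with hP
  have hPmem : ∀ u, P u ∈ E := E.starProjection_apply_mem
  have hPself : ∀ u ∈ E, P u = u := fun u hu => Submodule.starProjection_eq_self_iff.2 hu
  have hPorth : ∀ u ∈ Eᗮ, P u = 0 := fun u hu => by
    rwa [hP, Submodule.starProjection_apply_eq_zero_iff]
  have hPsym : ∀ u v, ⟪P u, v⟫_ℂ = ⟪u, P v⟫_ℂ := E.inner_starProjection_left_eq_right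
  have hPlead : ∀ i j, i + j = n + 1 → P (moment Z W e i j) = moment Z W e i j - q j := by
    intro i j hij
    have h := hPself _ (hlead j (by omega))
    rw [map_sub, hPorth _ (hq j (by omega)), sub_zero, show n + 1 - j = i by omega] at h
    exact h
  let Zc : Module.End ℂ E := LinearMap.codRestrict E (P.toLinearMap ∘ₗ Z ∘ₗ E.subtype)
    (fun u => hPmem _)
  let Wc : Module.End ℂ E := LinearMap.codRestrict E (P.toLinearMap ∘ₗ W ∘ₗ E.subtype)
    (fun u => hPmem _)
  have hZc : ∀ u : E, ((Zc u : E) : V) = P (Z u) := fun u => rfl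
  have hWc : ∀ u : E, ((Wc u : E) : V) = P (W u) := fun u => rfl
  -- Below the top degree no projection acts and Z, W commute; only moments of degree exactly n need
  -- the hypotheses on q.
  have hcomm : ∀ u ∈ E, P (Z (P (W u))) = P (W (P (Z u))) := by
    intro u hu
    induction hu using Submodule.span_induction with
    | zero => simp
    | add u v _ _ hu hv => simp only [map_add, hu, hv]
    | smul c u _ hu => simp only [map_smul, hu]
    | mem u hu =>
      obtain ⟨i, j, hij, rfl⟩ := hu
      have hzw : Z (W (moment Z W e i j)) = W (Z (moment Z W e i j)) := by
        rw [← Module.End.mul_apply, hZW.eq, Module.End.mul_apply]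
      rcases hij.lt_or_eq with h | h
      · have hw : W (moment Z W e i j) ∈ E := by
          rw [← moment_succ_right hZW]; exact moment_mem (by omega)
        have hz : Z (moment Z W e i j) ∈ E := by
          rw [← moment_succ_left]; exact moment_mem (by omega)
        rw [hPself _ hw, hPself _ hz, hzw]
      -- Projecting a moment of degree n + 1 subtracts the corresponding q. The commutator is
      -- therefore the projection of W(q j) - Z(q (j + 1)), which is zero by `hker`.
      · rw [← moment_succ_left, ← moment_succ_right hZW, hPlead _ _ (by omega),
          hPlead _ _ (by omega), moment_succ_left, moment_succ_right hZW, map_sub, map_sub, hzw,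
          map_sub, map_sub]
        have h0 := hPorth _ (hker j (by omega))
        rw [map_sub, sub_eq_zero] at h0
        rw [h0]
  have hcommc : Commute Zc Wc := by
    refine LinearMap.ext fun u => Subtype.ext ?_
    rw [Module.End.mul_apply, Module.End.mul_apply, hZc, hWc, hWc, hZc]
    exact hcomm u u.2
  have hadjc : ∀ u v, ⟪Zc u, v⟫_ℂ = ⟪u, Wc v⟫_ℂ := by
    intro u v
    rw [Submodule.coe_inner, Submodule.coe_inner, hZc, hWc, hPsym, hPself v v.2, hadj, ← hPsym,
      hPself u u.2]
  have heE : e ∈ E := by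
    have := moment_mem (Z := Z) (W := W) (e := e) (n := n) (i := 0) (j := 0) (by omega)
    simpa [moment] using this
  obtain ⟨S, v, hv, hvo, hve⟩ := exists_eigenvector_decomposition Zc Wc hcommc hadjc ⟨e, heE⟩
  have hve' : ∑ s ∈ S, (v s : V) = e := by
    rw [← Submodule.coe_sum, hve]
  have hvZ : ∀ s ∈ S, P (Z (v s)) = toComplex s • (v s : V) := fun s hs => by
    rw [← hZc, (hv s hs).2.1]; rfl
  have hvW : ∀ s ∈ S, P (W (v s)) = starRingEnd ℂ (toComplex s) • (v s : V) := fun s hs => by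
    rw [← hWc, (hv s hs).2.2]; rfl
  have hmom : ∀ i j, i + j ≤ n + 1 → P (moment Z W e i j)
      = ∑ s ∈ S, (toComplex s ^ i * starRingEnd ℂ (toComplex s) ^ j) • (v s : V) := by
    intro i j hij
    induction i with
    | zero =>
      induction j with
      | zero =>
        simp only [moment, pow_zero, Module.End.one_apply, mul_one, one_smul, hve']
        exact hPself e heE
      | succ j ih =>
        have h := hPself _ (moment_mem (Z := Z) (W := W) (e := e) (n := n) (i := 0) (j := j)
          (by omega))
        rw [moment_succ_right hZW, ← h, ih (by omega), map_sum, map_sum]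
        refine Finset.sum_congr rfl fun s hs => ?_
        rw [map_smul, map_smul, hvW s hs, smul_smul]
        ring_nf
    | succ i ih =>
      have h := hPself _ (moment_mem (Z := Z) (W := W) (e := e) (n := n) (i := i) (j := j)
        (by omega))
      rw [moment_succ_left, ← h, ih (by omega), map_sum, map_sum]
      refine Finset.sum_congr rfl fun s hs => ?_
      rw [map_smul, map_smul, hvZ s hs, smul_smul]
      ring_nf
  refine ⟨S, fun s => ‖v s‖ ^ 2, ?_, fun s hs => ?_, fun i j hij => ?_⟩
  -- The components of e are orthogonal and nonzero, and all moments of degree at most n are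
  -- combinations of them; so they form a basis of E.
  · have hli : LinearIndependent ℂ (fun s : S => v s) :=
      linearIndependent_of_ne_zero_of_inner_eq_zero (fun s => (hv s s.2).1)
        (fun s t hst => hvo s s.2 t t.2 fun h => hst (Subtype.ext h))
    have hli' : LinearIndependent ℂ (fun s : S => (v s : V)) :=
      hli.map' E.subtype (Submodule.ker_subtype E)
    have hspan : Submodule.span ℂ (Set.range fun s : S => (v s : V)) = E := by
      refine le_antisymm (Submodule.span_le.2 ?_) (Submodule.span_le.2 ?_)
      · rintro _ ⟨s, rfl⟩
        exact (v s).2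
      · rintro u ⟨i, j, h, rfl⟩
        rw [← hPself _ (moment_mem h), hmom i j (by omega)]
        exact Submodule.sum_mem _ fun s hs =>
          Submodule.smul_mem _ _ (Submodule.subset_span ⟨⟨s, hs⟩, rfl⟩)
    rw [← hspan, finrank_span_eq_card hli', Fintype.card_coe]
  · have := (hv s hs).1
    simpa using this
  -- Split the degree 2n + 1 as n + (n + 1). The part of degree at most n lies in E, so the
  -- projection may be moved onto the other part, where the nodal expansion still holds in degree n
  -- + 1.
  · obtain ⟨i₁, i₂, j₁, j₂, rfl, rfl, h1, h2⟩ : ∃ i₁ i₂ j₁ j₂, i = i₁ + i₂ ∧ j = j₁ + j₂ ∧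
        i₁ + j₁ ≤ n ∧ i₂ + j₂ ≤ n + 1 :=
      ⟨min i n, i - min i n, min j (n - min i n), j - min j (n - min i n), by omega, by omega,
        by omega, by omega⟩
    have hm1 : moment Z W e j₁ i₁ ∈ E := moment_mem (by omega)
    rw [inner_moment_add hZW hadj, ← hPself _ hm1, hPsym,
      hmom i₂ j₂ h2, ← hPself _ hm1, hmom j₁ i₁ (by omega), sum_inner]
    refine Finset.sum_congr rfl fun s hs => ?_
    rw [inner_sum, Finset.sum_eq_single s]
    · rw [inner_smul_left, inner_smul_right, inner_self_eq_norm_sq_to_K]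
      simp
      ring
    · intro t ht hts
      have : ⟪(v s : V), (v t : V)⟫_ℂ = 0 := hvo s hs t ht hts.symm
      rw [inner_smul_left, inner_smul_right, this]
      simp
    · exact fun h => absurd hs h

end Operators

/-! ### Polynomial functions in conjugate variables -/

lemma evalConj_eq (p : MvPolynomial (Fin 2) ℂ) (v : Fin 2 → ℝ) :
    evalConj p v = eval ![toComplex v, starRingEnd ℂ (toComplex v)] p := by
  rw [conj_toComplex]
  rfl

@[simp] lemma evalConj_one (v : Fin 2 → ℝ) : evalConj 1 v = 1 := map_one _
@[simp] lemma evalConj_C (c : ℂ) (v : Fin 2 → ℝ) : evalConj (C c) v = c := eval_C _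
lemma evalConj_add (p q : MvPolynomial (Fin 2) ℂ) (v : Fin 2 → ℝ) :
    evalConj (p + q) v = evalConj p v + evalConj q v := map_add _ _ _
lemma evalConj_mul (p q : MvPolynomial (Fin 2) ℂ) (v : Fin 2 → ℝ) :
    evalConj (p * q) v = evalConj p v * evalConj q v := map_mul _ _ _
lemma evalConj_smul (c : ℂ) (p : MvPolynomial (Fin 2) ℂ) (v : Fin 2 → ℝ) :
    evalConj (c • p) v = c * evalConj p v := smul_eval _ _ _
lemma evalConj_pow (p : MvPolynomial (Fin 2) ℂ) (n : ℕ) (v : Fin 2 → ℝ) :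
    evalConj (p ^ n) v = evalConj p v ^ n := map_pow _ _ _
@[simp] lemma evalConj_X_zero (v : Fin 2 → ℝ) : evalConj (X 0) v = toComplex v := by
  simp [evalConj_eq]
@[simp] lemma evalConj_X_one (v : Fin 2 → ℝ) :
    evalConj (X 1) v = starRingEnd ℂ (toComplex v) := by
  simp [evalConj_eq]

lemma continuous_evalConj (p : MvPolynomial (Fin 2) ℂ) : Continuous (evalConj p) := by
  refine (MvPolynomial.continuous_eval p).comp (continuous_pi fun i => ?_)
  fin_cases i
  · simp only [Fin.zero_eta, Matrix.cons_val_zero]; fun_prop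
  · simp only [Fin.mk_one, Matrix.cons_val_one]; fun_prop

lemma monomial_fin_two {R : Type*} [CommSemiring R] (d : Fin 2 →₀ ℕ) (r : R) :
    monomial d r = C r * (X 0 ^ d 0 * X 1 ^ d 1) := by
  rw [monomial_eq, Finsupp.prod_fintype _ _ (fun i => pow_zero _), Fin.prod_univ_two]

lemma eq_sum_monomials {R : Type*} [CommSemiring R] (p : MvPolynomial (Fin 2) R) :
    p = ∑ d ∈ p.support, C (p.coeff d) * (X 0 ^ d 0 * X 1 ^ d 1) := by
  conv_lhs => rw [p.as_sum]
  exact Finset.sum_congr rfl fun d _ => monomial_fin_two _ _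

lemma degree_le_totalDegree {R : Type*} [CommSemiring R] (p : MvPolynomial (Fin 2) R)
    {d : Fin 2 →₀ ℕ} (hd : d ∈ p.support) : d 0 + d 1 ≤ p.totalDegree := by
  have := le_totalDegree hd
  rwa [Finsupp.sum_fintype _ _ (fun i => rfl), Fin.sum_univ_two] at this

lemma totalDegree_X_pow_mul_X_pow_le (i j : ℕ) :
    (X 0 ^ i * X 1 ^ j : MvPolynomial (Fin 2) ℂ).totalDegree ≤ i + j := by
  refine (totalDegree_mul _ _).trans (add_le_add ?_ ?_) <;>
  simp [totalDegree_X_pow]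

/-- A real polynomial in `x, y` written in the variables `z, z̄`. -/
def toConjVars (f : MvPolynomial (Fin 2) ℝ) : MvPolynomial (Fin 2) ℂ :=
  ∑ d ∈ f.support, C ((f.coeff d : ℝ) : ℂ) *
    ((C (1 / 2) * (X 0 + X 1)) ^ d 0 * (C (-Complex.I / 2) * (X 0 - X 1)) ^ d 1)

lemma evalConj_toConjVars (f : MvPolynomial (Fin 2) ℝ) (v : Fin 2 → ℝ) :
    evalConj (toConjVars f) v = (eval v f : ℝ) := by
  conv_rhs => rw [eq_sum_monomials f]
  have h0 : evalConj (C (1 / 2) * (X 0 + X 1)) v = v 0 := by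
    rw [evalConj_mul, evalConj_add, evalConj_C, evalConj_X_zero, evalConj_X_one, conj_toComplex,
      toComplex]
    ring
  have h1 : evalConj (C (-Complex.I / 2) * (X 0 - X 1)) v = v 1 := by
    rw [evalConj_mul, sub_eq_add_neg, ← neg_one_smul ℂ (X 1), evalConj_add, evalConj_smul, evalConj_C,
      evalConj_X_zero, evalConj_X_one, conj_toComplex, toComplex]
    linear_combination (-(v 1 : ℂ)) * Complex.I_mul_I
  rw [toConjVars, evalConj, map_sum, map_sum, Complex.ofReal_sum]
  refine Finset.sum_congr rfl fun d _ => ?_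
  change evalConj _ v = _
  rw [evalConj_mul, evalConj_mul, evalConj_pow, evalConj_pow, h0, h1, evalConj_C]
  simp

lemma totalDegree_toConjVars_le (f : MvPolynomial (Fin 2) ℝ) :
    (toConjVars f).totalDegree ≤ f.totalDegree := by
  refine totalDegree_finsetSum_le fun d hd => ?_
  refine le_trans ?_ (degree_le_totalDegree f hd)
  have h0 : (C (1 / 2) * (X 0 + X 1) : MvPolynomial (Fin 2) ℂ).totalDegree ≤ 1 := by
    refine (totalDegree_mul _ _).trans ?_
    rw [totalDegree_C, zero_add]
    exact (totalDegree_add _ _).trans (by simp)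
  have h1 : (C (-Complex.I / 2) * (X 0 - X 1) : MvPolynomial (Fin 2) ℂ).totalDegree ≤ 1 := by
    refine (totalDegree_mul _ _).trans ?_
    rw [totalDegree_C, zero_add]
    exact (totalDegree_sub _ _).trans (by simp)
  refine (totalDegree_mul _ _).trans ?_
  rw [totalDegree_C, zero_add]
  refine (totalDegree_mul _ _).trans (add_le_add ?_ ?_)
  · exact (totalDegree_pow _ _).trans (by nlinarith)
  · exact (totalDegree_pow _ _).trans (by nlinarith)

/-! ### Gaussian cubature from orthogonality -/

/-- The inner product of a measure on polynomials in `z, z̄`. -/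
@[reducible] def polynomialCore (μ : Measure (Fin 2 → ℝ))
    (hint : ∀ f g, Integrable (fun v => starRingEnd ℂ (evalConj f v) * evalConj g v) μ)
    (hdef : ∀ f, (∀ᵐ v ∂μ, evalConj f v = 0) → f = 0) :
    InnerProductSpace.Core ℂ (MvPolynomial (Fin 2) ℂ) where
  inner f g := ∫ v, starRingEnd ℂ (evalConj f v) * evalConj g v ∂μ
  conj_inner_symm f g := by
    rw [← integral_conj]
    refine integral_congr_ae (Filter.Eventually.of_forall fun v => ?_)
    simp [mul_comm]
  re_inner_nonneg f := by
    have h : ∀ v, starRingEnd ℂ (evalConj f v) * evalConj f v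
        = ((Complex.normSq (evalConj f v) : ℝ) : ℂ) := fun v => Complex.normSq_eq_conj_mul_self.symm
    simp only [h, integral_complex_ofReal]
    exact integral_nonneg fun v => Complex.normSq_nonneg _
  add_left f g h := by
    rw [← integral_add (hint f h) (hint g h)]
    refine integral_congr_ae (Filter.Eventually.of_forall fun v => ?_)
    simp [evalConj_add, add_mul]
  smul_left f g r := by
    rw [← integral_const_mul]
    refine integral_congr_ae (Filter.Eventually.of_forall fun v => ?_)
    simp [evalConj_smul, mul_assoc]
  definite f hf := by
    have h : ∀ v, starRingEnd ℂ (evalConj f v) * evalConj f v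
        = ((Complex.normSq (evalConj f v) : ℝ) : ℂ) := fun v => Complex.normSq_eq_conj_mul_self.symm
    have hi := hint f f
    simp only [h] at hf hi
    rw [integral_complex_ofReal, Complex.ofReal_eq_zero, integral_eq_zero_iff_of_nonneg
      (fun v => Complex.normSq_nonneg _) (by simpa using hi.re)] at hf
    exact hdef f (hf.mono fun v hv => Complex.normSq_eq_zero.1 hv)

/-- The operator theorem applies to multiplication by z and conj z on polynomials, with e = 1.
Definiteness of the form makes the moment span have the dimension of the full polynomial space. -/
theorem hasGaussianCubature_of_orthogonal {μ : Measure (Fin 2 → ℝ)} {a c : ℂ}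
    (hint : ∀ f g, Integrable (fun v => starRingEnd ℂ (evalConj f v) * evalConj g v) μ)
    (hdef : ∀ f, (∀ᵐ v ∂μ, evalConj f v = 0) → f = 0) {m : ℕ} (hm : 1 ≤ m)
    (horth : ∀ k : Fin (m + 1), IsOrthogonalToLower μ m (Q a c m k)) :
    HasGaussianCubature μ m := by
  obtain ⟨n, rfl⟩ : ∃ n, m = n + 1 := ⟨m - 1, by omega⟩
  let core := polynomialCore μ hint hdef
  let : NormedAddCommGroup (MvPolynomial (Fin 2) ℂ) := core.toNormedAddCommGroup
  let : InnerProductSpace ℂ (MvPolynomial (Fin 2) ℂ) := InnerProductSpace.ofCore core.toCore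
  have hinner : ∀ f g : MvPolynomial (Fin 2) ℂ,
      inner ℂ f g = ∫ v, starRingEnd ℂ (evalConj f v) * evalConj g v ∂μ := fun f g => rfl
  let Z : Module.End ℂ (MvPolynomial (Fin 2) ℂ) := LinearMap.mulLeft ℂ (X 0)
  let W : Module.End ℂ (MvPolynomial (Fin 2) ℂ) := LinearMap.mulLeft ℂ (X 1)
  have hZW : Commute Z W := LinearMap.ext fun p => mul_left_comm _ _ _
  have hadj : ∀ u v, inner ℂ (Z u) v = inner ℂ u (W v) := fun u v => by
    rw [hinner, hinner]
    refine integral_congr_ae (Filter.Eventually.of_forall fun x => ?_)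
    simp only [Z, W, LinearMap.mulLeft_apply, evalConj_mul, evalConj_X_zero, evalConj_X_one,
      map_mul]
    ring
  have hmom : ∀ i j, moment Z W (1 : MvPolynomial (Fin 2) ℂ) i j = X 0 ^ i * X 1 ^ j := fun i j => by
    simp [moment, Z, W, LinearMap.pow_mulLeft]
  have hspan : ∀ p, p ∈ momentSpan Z W (1 : MvPolynomial (Fin 2) ℂ) n ↔ p.totalDegree ≤ n := by
    intro p
    constructor
    · intro hp
      rw [← mem_restrictTotalDegree]
      revert hp
      refine fun hp => (Submodule.span_le.2 ?_ : momentSpan Z W 1 n ≤ _) hp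
      rintro u ⟨i, j, hij, rfl⟩
      rw [hmom]
      exact (mem_restrictTotalDegree _ _ _).2 ((totalDegree_X_pow_mul_X_pow_le i j).trans hij)
    · intro hp
      rw [eq_sum_monomials p]
      refine Submodule.sum_mem _ fun d hd => ?_
      rw [← smul_eq_C_mul, ← hmom]
      exact Submodule.smul_mem _ _ (moment_mem ((degree_le_totalDegree p hd).trans hp))
  have hQ : ∀ k, Q a c (n + 1) k ∈ (momentSpan Z W (1 : MvPolynomial (Fin 2) ℂ) n)ᗮ := by
    intro k
    rw [Submodule.mem_orthogonal]
    intro g hg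
    rw [hinner, ← horth k g (Nat.lt_succ_of_le ((hspan g).1 hg))]
    exact integral_congr_ae (Filter.Eventually.of_forall fun v => mul_comm _ _)
  -- The value 0 is only a filler; just the indices k ≤ n + 1 are used.
  let q : ℕ → MvPolynomial (Fin 2) ℂ := fun k => if h : k < n + 2 then Q a c (n + 1) ⟨k, h⟩ else 0
  have hqQ : ∀ k (h : k < n + 2), q k = Q a c (n + 1) ⟨k, h⟩ := fun k h => dif_pos h
  have hq : ∀ k ≤ n + 1, q k ∈ (momentSpan Z W (1 : MvPolynomial (Fin 2) ℂ) n)ᗮ := by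
    intro k hk
    rw [hqQ k (by omega)]
    exact hQ _
  have hlead : ∀ k ≤ n + 1, moment Z W (1 : MvPolynomial (Fin 2) ℂ) (n + 1 - k) k - q k
      ∈ momentSpan Z W (1 : MvPolynomial (Fin 2) ℂ) n := by
    intro k hk
    rw [hqQ k (by omega), hspan, hmom]
    exact Nat.le_of_lt_succ (totalDegree_monomial_sub_Q_lt a c (by omega) ⟨k, by omega⟩)
  have hker : ∀ k ≤ n, Z (q (k + 1)) - W (q k)
      ∈ (momentSpan Z W (1 : MvPolynomial (Fin 2) ℂ) n)ᗮ := by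
    intro k hk
    rw [hqQ (k + 1) (by omega), hqQ k (by omega)]
    refine (Submodule.span_le.2 ?_ : Submodule.span ℂ (Set.range (Q a c (n + 1))) ≤ _)
      (X_mul_Q_sub a c (n + 1) ⟨k, by omega⟩)
    rintro _ ⟨l, rfl⟩
    exact hQ l
  obtain ⟨S, w, hcard, hw, hS⟩ := exists_cubature_of_orthogonal hZW hadj 1 n q hq hlead hker
  refine ⟨S, w, ?_, hw, fun f hf => ?_⟩
  · have he : momentSpan Z W (1 : MvPolynomial (Fin 2) ℂ) n = restrictTotalDegree (Fin 2) ℂ n :=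
      Submodule.ext fun p => by rw [hspan, mem_restrictTotalDegree]
    rw [hcard, he]
    exact finrank_restrictTotalDegree n
  · have h1 : ∀ p : MvPolynomial (Fin 2) ℂ, p.totalDegree ≤ 2 * n + 1 →
        inner ℂ (1 : MvPolynomial (Fin 2) ℂ) p = ∑ s ∈ S, (w s : ℂ) * evalConj p s := by
      intro p hp
      conv_lhs => rw [eq_sum_monomials p]
      conv_rhs => rw [eq_sum_monomials p]
      simp only [evalConj, map_sum, Finset.mul_sum]
      rw [inner_sum, Finset.sum_comm]
      refine Finset.sum_congr rfl fun d hd => ?_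
      rw [← smul_eq_C_mul, inner_smul_right, ← hmom,
        hS _ _ ((degree_le_totalDegree p hd).trans hp), Finset.mul_sum]
      refine Finset.sum_congr rfl fun s _ => ?_
      rw [hmom]
      change _ = _ * evalConj _ s
      rw [evalConj_smul, evalConj_mul, evalConj_pow, evalConj_pow, evalConj_X_zero,
        evalConj_X_one]
      ring
    have h2 := h1 (toConjVars f) ((totalDegree_toConjVars_le f).trans (by omega))
    rw [hinner] at h2
    simp only [evalConj_one, map_one, one_mul, evalConj_toConjVars] at h2
    rw [integral_complex_ofReal] at h2
    exact_mod_cast h2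

/-! ### Values of the polynomials `Q` -/

/-- Up to a constant factor, the values of `Q` are minors of the normalised banded matrix. -/
lemma exists_eval_Q_eq {τ : ℂ} (hτ : τ ≠ 0) (b : ℂ) (m : ℕ) (k : Fin (m + 1)) :
    ∃ κ : ℂ, ∀ z w : ℂ, eval ![τ * z, starRingEnd ℂ τ * w]
        (Q (τ ^ 2 / starRingEnd ℂ τ * (1 + b)) (τ ^ 2 / starRingEnd ℂ τ) m k)
      = κ * bandMinor (1 + b) (1 + starRingEnd ℂ b) z w m (m - k) := by
  set σ := starRingEnd ℂ τ with hσ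
  have hσ0 : σ ≠ 0 := (map_ne_zero _).2 hτ
  have hστ : starRingEnd ℂ σ = τ := Complex.conj_conj τ
  -- The row and column factors are chosen so that uᵢ vⱼ = τ (σ/τ)^(j - i): this is τ, σ, σ²/τ and
  -- τ²/σ on the four bands, so the unit outer bands become conj c and c.
  let u : Fin m → ℂ := fun i => τ * (τ / σ) ^ (i : ℕ)
  let v : Fin (m + 1) → ℂ := fun j => (σ / τ) ^ (j : ℕ)
  have huv : ∀ (i : Fin m) (j : Fin (m + 1)) (n : ℕ), (j : ℕ) = i + n →
      u i * v j = τ * (σ / τ) ^ n := by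
    intro i j n h
    have : (τ / σ) ^ (i : ℕ) * (σ / τ) ^ (i : ℕ) = 1 := by
      rw [← mul_pow, div_mul_div_comm, mul_comm, div_self (mul_ne_zero hσ0 hτ), one_pow]
    simp only [u, v, h, pow_add]
    linear_combination τ * (σ / τ) ^ n * this
  have huv' : ∀ (i : Fin m) (j : Fin (m + 1)), (j : ℕ) + 1 = i → u i * v j = τ ^ 2 / σ := by
    intro i j h
    have : (τ / σ) ^ (j : ℕ) * (σ / τ) ^ (j : ℕ) = 1 := by
      rw [← mul_pow, div_mul_div_comm, mul_comm, div_self (mul_ne_zero hσ0 hτ), one_pow]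
    simp only [u, v, ← h, pow_succ]
    linear_combination τ * (τ / σ) * this
  refine ⟨(∏ i, u i) * ∏ j, v (k.rev.succAbove j), fun z w => ?_⟩
  have hk : (k.rev : ℕ) = m - k := by rw [Fin.val_rev]; omega
  rw [← hk, bandMinor_eq_det, Q, RingHom.map_det, mul_assoc, ← Matrix.det_mul_row,
    ← Matrix.det_mul_column]
  congr 1
  ext i j
  simp only [RingHom.mapMatrix_apply, Matrix.map_apply, Matrix.submatrix_apply, id, Matrix.of_apply]
  generalize k.rev.succAbove j = l
  rw [← mul_assoc, charMatrix, bandEntry, Matrix.of_apply]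
  by_cases h0 : (l : ℕ) = i
  · rw [if_pos h0, if_pos h0, huv i l 0 (by omega)]
    simp
  rw [if_neg h0, if_neg h0]
  by_cases h1 : (l : ℕ) = i + 1
  · rw [if_pos h1, if_pos h1, huv i l 1 h1]
    simp
    left
    field_simp
  rw [if_neg h1, if_neg h1]
  by_cases h2 : (l : ℕ) = i + 2
  · rw [if_pos h2, if_pos h2, huv i l 2 h2, eval_C]
    split_ifs
    · simp only [map_mul, map_div₀, map_pow, map_add, map_one, hστ, ← hσ]
      field_simp
    · simp only [map_div₀, map_pow, hστ, ← hσ]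
      field_simp
  rw [if_neg h2, if_neg h2]
  by_cases h3 : (l : ℕ) + 1 = i
  · rw [if_pos h3, if_pos h3, huv' i l h3, eval_C]
    split_ifs <;> ring
  rw [if_neg h3, if_neg h3]
  simp

/-! ### The perturbed deltoid measures -/

/-- The Chebyshev measure of the second kind on the dilated deltoid. -/
def dilatedMeasure : Measure (Fin 2 → ℝ) := deltoidMeasure.map (fun v => (3 : ℝ) • v)

/-- The function on the dilated deltoid that corresponds to `torusDenom`. -/
def denom (b : ℂ) (v : Fin 2 → ℝ) : ℂ :=
  1 + b * (toComplex v ^ 3 - 3 * toComplex v * starRingEnd ℂ (toComplex v) + 3)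
    + b ^ 2 * (starRingEnd ℂ (toComplex v) ^ 3 - 3 * toComplex v * starRingEnd ℂ (toComplex v) + 3)
    + b ^ 3

lemma continuous_toComplex : Continuous toComplex := by
  unfold toComplex
  fun_prop

lemma continuous_denom (b : ℂ) : Continuous (denom b) := by
  have := continuous_toComplex
  have := Complex.continuous_conj.comp continuous_toComplex
  unfold denom
  fun_prop

/-- The coefficients are the elementary symmetric functions of the cubes tᵢ³, written through z,
conj z and the product one. -/
lemma denom_torusMap (b : ℂ) (θ : Fin 2 → ℝ) : denom b (torusMap θ) = torusDenom b θ := by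
  rw [denom, conj_toComplex_torusMap, inv_sum_eq (torusChar_mul θ), toComplex_torusMap, torusDenom,
    Fin.prod_univ_three]
  have h := torusChar_mul θ
  generalize torusChar θ 0 = t₀ at *
  generalize torusChar θ 1 = t₁ at *
  generalize torusChar θ 2 = t₂ at *
  linear_combination (-3 * b + b ^ 2 * (3 * (t₀ + t₁ + t₂) * (t₀ * t₁ + t₀ * t₂ + t₁ * t₂)
    - 3 * (t₀ * t₁ * t₂ + 1)) - b ^ 3 * ((t₀ * t₁ * t₂) ^ 2 + t₀ * t₁ * t₂ + 1)) * h

/-- The density of the perturbed measures. -/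
def density (b : ℂ) (v : Fin 2 → ℝ) : ℝ := (Complex.normSq (denom b v))⁻¹

lemma density_nonneg (b : ℂ) (v : Fin 2 → ℝ) : 0 ≤ density b v :=
  inv_nonneg.2 (Complex.normSq_nonneg _)

lemma measurable_density (b : ℂ) : Measurable (density b) :=
  (Complex.continuous_normSq.comp (continuous_denom b)).measurable.inv

/-- The perturbed deltoid measure. -/
def perturbedMeasure (b : ℂ) : Measure (Fin 2 → ℝ) :=
  dilatedMeasure.withDensity fun v => ENNReal.ofReal (density b v)

lemma perturbedMeasure_zero : perturbedMeasure 0 = dilatedMeasure := by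
  simp [perturbedMeasure, density, denom]

/-! ### Compactness, finiteness and comparison of the measures -/

lemma isCompact_deltoid : IsCompact deltoid := by
  have h : deltoid = {v | 0 ≤ deltoidPoly v} := Set.ext mem_deltoid_iff
  refine Metric.isCompact_of_isClosed_isBounded ?_ ?_
  · rw [h]
    exact isClosed_le continuous_const continuous_deltoidPoly
  · refine (Metric.isBounded_closedBall (x := 0) (r := 1)).subset ?_
    rintro _ ⟨r, ⟨h0, h1⟩, θ, rfl⟩
    rw [mem_closedBall_zero_iff, norm_smul, Real.norm_of_nonneg h0]
    refine mul_le_one₀ h1 (norm_nonneg _) ((pi_norm_le_iff_of_nonneg zero_le_one).2 fun i => ?_)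
    rw [Real.norm_eq_abs, abs_le]
    have := Real.cos_le_one θ
    have := Real.neg_one_le_cos θ
    have := Real.cos_le_one (2 * θ)
    have := Real.neg_one_le_cos (2 * θ)
    have := Real.sin_le_one θ
    have := Real.neg_one_le_sin θ
    have := Real.sin_le_one (2 * θ)
    have := Real.neg_one_le_sin (2 * θ)
    fin_cases i
    · simp [steiner]; constructor <;> linarith
    · simp [steiner]; constructor <;> linarith

instance isFiniteMeasure_deltoidMeasure : IsFiniteMeasure deltoidMeasure := by
  refine isFiniteMeasure_withDensity_ofReal ?_
  exact ((continuous_deltoidPoly.sqrt.continuousOn).integrableOn_compact isCompact_deltoid).2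

instance isFiniteMeasure_dilatedMeasure : IsFiniteMeasure dilatedMeasure := by
  unfold dilatedMeasure; infer_instance

lemma ae_mem_deltoid : ∀ᵐ v ∂deltoidMeasure, v ∈ deltoid :=
  (withDensity_absolutelyContinuous _ _).ae_le
    (ae_restrict_mem isCompact_deltoid.isClosed.measurableSet)

lemma six_smul_dilatedMeasure : (6 : ENNReal) • dilatedMeasure
    = ((volume.restrict torusSquare).withDensity torusDensity).map torusMap :=
  map_torusMap_eq.symm

/-- Six times the measure is an image under `torusMap`, so it is enough to check points of the form
`torusMap θ`. -/
lemma ae_dilatedMeasure {p : (Fin 2 → ℝ) → Prop} (hp : MeasurableSet {v | p v})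
    (h : ∀ θ, p (torusMap θ)) : ∀ᵐ v ∂dilatedMeasure, p v := by
  have h6 : ∀ᵐ v ∂((6 : ENNReal) • dilatedMeasure), p v := by
    rw [six_smul_dilatedMeasure, ae_map_iff continuous_torusMap.aemeasurable hp]
    exact Filter.Eventually.of_forall h
  exact (Measure.absolutelyContinuous_smul (by norm_num : (6 : ENNReal) ≠ 0)).ae_le h6

lemma normSq_torusDenom_ge {b : ℂ} (hb : ‖b‖ ≤ 1 / 2) (θ : Fin 2 → ℝ) :
    1 / 64 ≤ Complex.normSq (torusDenom b θ) := by
  have h : ∀ i, 1 / 2 ≤ ‖1 + b * torusChar θ i ^ 3‖ := fun i => by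
    have := norm_sub_norm_le (1 : ℂ) (-(b * torusChar θ i ^ 3))
    rw [norm_neg, norm_mul, norm_pow, norm_torusChar, sub_neg_eq_add] at this
    simp at this
    linarith
  rw [Complex.normSq_eq_norm_sq, torusDenom, norm_prod, Fin.prod_univ_three]
  have : (1 / 2 : ℝ) * (1 / 2) * (1 / 2) ≤ ‖1 + b * torusChar θ 0 ^ 3‖ *
      ‖1 + b * torusChar θ 1 ^ 3‖ * ‖1 + b * torusChar θ 2 ^ 3‖ := by
    gcongr <;> exact h _
  nlinarith

lemma ae_normSq_denom {b : ℂ} (hb : ‖b‖ ≤ 1 / 2) :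
    ∀ᵐ v ∂dilatedMeasure, 1 / 64 ≤ Complex.normSq (denom b v) := by
  refine ae_dilatedMeasure ?_ fun θ => ?_
  · exact (isClosed_le continuous_const
      (Complex.continuous_normSq.comp (continuous_denom b))).measurableSet
  · rw [denom_torusMap]
    exact normSq_torusDenom_ge hb θ

lemma isFiniteMeasure_perturbedMeasure {b : ℂ} (hb : ‖b‖ ≤ 1 / 2) :
    IsFiniteMeasure (perturbedMeasure b) := by
  refine isFiniteMeasure_withDensity (ne_of_lt (lt_of_le_of_lt (lintegral_mono_ae
    (g := fun _ => ENNReal.ofReal 64) ?_) ?_))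
  · filter_upwards [ae_normSq_denom hb] with v hv
    refine ENNReal.ofReal_le_ofReal ?_
    rw [density]
    exact inv_le_of_inv_le₀ (by norm_num) (by linarith)
  · rw [lintegral_const]
    exact ENNReal.mul_lt_top ENNReal.ofReal_lt_top (measure_lt_top _ _)

/-- The bound 1/64 keeps the denominator nonzero almost everywhere, so the density is positive. This
lets null sets pass back to the unperturbed measure. -/
lemma dilatedMeasure_absolutelyContinuous {b : ℂ} (hb : ‖b‖ ≤ 1 / 2) :
    dilatedMeasure ≪ perturbedMeasure b := by
  refine withDensity_absolutelyContinuous' (measurable_density b).ennreal_ofReal.aemeasurable ?_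
  filter_upwards [ae_normSq_denom hb] with v hv
  rw [Ne, ENNReal.ofReal_eq_zero, not_le, density]
  exact inv_pos.2 (by linarith)

/-- Integration against the perturbed measure on the torus. -/
lemma integral_perturbedMeasure (b : ℂ) {f : (Fin 2 → ℝ) → ℂ} (hf : Continuous f) :
    6 * ∫ v, f v ∂perturbedMeasure b = ((√(4 / 27) / 9 : ℝ) : ℂ) * ∫ θ in torusSquare,
      ((torusJac θ ^ 2 : ℝ) : ℂ) *
        (f (torusMap θ) * (torusDenom b θ * starRingEnd ℂ (torusDenom b θ))⁻¹) := by
  have hd : Measurable fun v => (density b v : ℂ) * f v :=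
    (Complex.measurable_ofReal.comp (measurable_density b)).mul hf.measurable
  have h1 : ∫ v, f v ∂perturbedMeasure b = ∫ v, (density b v : ℂ) * f v ∂dilatedMeasure := by
    rw [perturbedMeasure, integral_withDensity_eq_integral_toReal_smul
      (measurable_density b).ennreal_ofReal (Filter.Eventually.of_forall fun v =>
        ENNReal.ofReal_lt_top)]
    refine integral_congr_ae (Filter.Eventually.of_forall fun v => ?_)
    simp [ENNReal.toReal_ofReal (density_nonneg b v)]
  have h2 : 6 * ∫ v, (density b v : ℂ) * f v ∂dilatedMeasure
      = ∫ v, (density b v : ℂ) * f v ∂((6 : ENNReal) • dilatedMeasure) := by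
    rw [integral_smul_measure]
    simp
  rw [h1, h2, six_smul_dilatedMeasure, integral_map continuous_torusMap.aemeasurable
    hd.aestronglyMeasurable, integral_withDensity_eq_integral_toReal_smul measurable_torusDensity
      (Filter.Eventually.of_forall fun v => ENNReal.ofReal_lt_top), ← integral_const_mul]
  refine integral_congr_ae (Filter.Eventually.of_forall fun θ => ?_)
  have h3 : 0 ≤ √(4 / 27) / 9 * torusJac θ ^ 2 := by positivity
  simp only [torusDensity, ENNReal.toReal_ofReal h3, density, denom_torusMap, Complex.mul_conj,
    Complex.real_smul]
  push_cast
  ring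

/-! ### Rotation and dilation of the perturbed measures -/

/-- In the coordinates x and y the polynomial vanishes on a product of two infinite sets, hence
identically; the substitution is an invertible linear one. -/
lemma polynomial_eq_zero_of_open {f : MvPolynomial (Fin 2) ℂ} {α β : ℂ} (hα : α ≠ 0) (hβ : β ≠ 0)
    {U : Set (Fin 2 → ℝ)} (hU : IsOpen U) (h0 : 0 ∈ U)
    (h : ∀ v ∈ U, eval ![α * toComplex v, β * starRingEnd ℂ (toComplex v)] f = 0) : f = 0 := by
  obtain ⟨ε, hε, hball⟩ := Metric.isOpen_iff.1 hU 0 h0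
  let g : Fin 2 → MvPolynomial (Fin 2) ℂ :=
    ![C α * (X 0 + C Complex.I * X 1), C β * (X 0 - C Complex.I * X 1)]
  have hg : ∀ x : Fin 2 → ℂ, eval x (bind₁ g f)
      = eval ![α * (x 0 + Complex.I * x 1), β * (x 0 - Complex.I * x 1)] f := by
    intro x
    have : eval x (bind₁ g f) = eval (fun i => eval x (g i)) f := by
      simp only [eval, eval₂Hom_bind₁]
    rw [this]
    congr 2
    ext i
    fin_cases i <;> simp [g]
  have hinf : ((fun r : ℝ => (r : ℂ)) '' Set.Ioo (-ε) ε).Infinite :=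
    (Set.Ioo_infinite (by linarith)).image Complex.ofReal_injective.injOn
  have hz : bind₁ g f = 0 := by
    refine funext_set (fun _ => (fun r : ℝ => (r : ℂ)) '' Set.Ioo (-ε) ε) (fun _ => hinf)
      fun x hx => ?_
    choose v hv hvx using fun i => hx i (Set.mem_univ i)
    have hx' : x = fun i => (v i : ℂ) := funext fun i => (hvx i).symm
    rw [hg, map_zero, hx']
    have hvU : v ∈ U := hball <| by
      rw [mem_ball_zero_iff, pi_norm_lt_iff hε]
      exact fun i => by rw [Real.norm_eq_abs, abs_lt]; exact hv i
    rw [← h v hvU, conj_toComplex]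
    rfl
  refine MvPolynomial.funext fun y => ?_
  -- The preimage of y under that linear substitution.
  have hy := hg ![(y 0 / α + y 1 / β) / 2, (y 0 / α - y 1 / β) / (2 * Complex.I)]
  rw [hz, map_zero] at hy
  rw [map_zero, hy]
  congr 2
  ext i
  have hI := Complex.I_ne_zero
  fin_cases i
  · simp
    field_simp
    ring
  · simp
    field_simp
    ring

/-- Multiplication by a complex number on the plane. -/
def complexScale (τ : ℂ) (v : Fin 2 → ℝ) : Fin 2 → ℝ :=
  ![(τ * toComplex v).re, (τ * toComplex v).im]

lemma toComplex_complexScale (τ : ℂ) (v : Fin 2 → ℝ) :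
    toComplex (complexScale τ v) = τ * toComplex v := by
  rw [toComplex, mul_comm Complex.I]
  exact Complex.re_add_im _

lemma complexScale_one : complexScale 1 = id := by
  ext v i
  fin_cases i <;> simp [complexScale, toComplex]

lemma continuous_complexScale (τ : ℂ) : Continuous (complexScale τ) := by
  have := continuous_toComplex
  refine continuous_pi fun i => ?_
  fin_cases i
  · exact Complex.continuous_re.comp (continuous_const.mul this)
  · exact Complex.continuous_im.comp (continuous_const.mul this)

lemma evalConj_complexScale (p : MvPolynomial (Fin 2) ℂ) (τ : ℂ) (v : Fin 2 → ℝ) :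
    evalConj p (complexScale τ v)
      = eval ![τ * toComplex v, starRingEnd ℂ τ * starRingEnd ℂ (toComplex v)] p := by
  rw [evalConj_eq, toComplex_complexScale, map_mul]

/-- The image of the perturbed measure under multiplication by `τ`. -/
def scaledMeasure (τ b : ℂ) : Measure (Fin 2 → ℝ) := (perturbedMeasure b).map (complexScale τ)

/-- The image of the deltoid that carries `scaledMeasure`. -/
def scaledDeltoid (τ : ℂ) : Set (Fin 2 → ℝ) :=
  (fun v => complexScale τ ((3 : ℝ) • v)) '' deltoid

lemma continuous_scale_three (τ : ℂ) :
    Continuous fun v : Fin 2 → ℝ => complexScale τ ((3 : ℝ) • v) :=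
  (continuous_complexScale τ).comp (continuous_const_smul _)

lemma isCompact_scaledDeltoid (τ : ℂ) : IsCompact (scaledDeltoid τ) :=
  isCompact_deltoid.image (continuous_scale_three τ)

lemma ae_mem_scaledDeltoid (τ b : ℂ) : ∀ᵐ v ∂scaledMeasure τ b, v ∈ scaledDeltoid τ := by
  have hm := (isCompact_scaledDeltoid τ).isClosed.measurableSet
  rw [scaledMeasure, ae_map_iff (p := (· ∈ scaledDeltoid τ)) (continuous_complexScale τ).aemeasurable hm]
  have h : ∀ᵐ v ∂dilatedMeasure, complexScale τ v ∈ scaledDeltoid τ := by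
    rw [dilatedMeasure, ae_map_iff (p := fun v => complexScale τ v ∈ scaledDeltoid τ)
      (continuous_const_smul _).aemeasurable ((continuous_complexScale τ).measurable hm)]
    exact ae_mem_deltoid.mono fun v hv => ⟨v, hv, rfl⟩
  exact (withDensity_absolutelyContinuous _ _).ae_le h

lemma isFiniteMeasure_scaledMeasure (τ : ℂ) {b : ℂ} (hb : ‖b‖ ≤ 1 / 2) :
    IsFiniteMeasure (scaledMeasure τ b) := by
  have := isFiniteMeasure_perturbedMeasure hb
  unfold scaledMeasure
  infer_instance

lemma isCompact_support_scaledMeasure (τ b : ℂ) : IsCompact (scaledMeasure τ b).support :=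
  (isCompact_scaledDeltoid τ).of_isClosed_subset Measure.isClosed_support
    (Measure.support_subset_of_isClosed (isCompact_scaledDeltoid τ).isClosed
      (ae_mem_scaledDeltoid τ b))

lemma integrable_scaledMeasure (τ : ℂ) {b : ℂ} (hb : ‖b‖ ≤ 1 / 2) {f : (Fin 2 → ℝ) → ℂ}
    (hf : Continuous f) : Integrable f (scaledMeasure τ b) := by
  have := isFiniteMeasure_scaledMeasure τ hb
  have h := hf.continuousOn.integrableOn_compact (μ := scaledMeasure τ b)
    (isCompact_scaledDeltoid τ)
  rwa [IntegrableOn, Measure.restrict_eq_self_of_ae_mem (ae_mem_scaledDeltoid τ b)] at h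

/-- Pulled back to the deltoid, the function vanishes almost everywhere where the weight is
positive. That set is open and contains 0, so continuity gives vanishing at each of its points. -/
lemma eq_zero_of_ae_evalConj_eq_zero {τ b : ℂ} (hτ : τ ≠ 0) (hb : ‖b‖ ≤ 1 / 2)
    {f : MvPolynomial (Fin 2) ℂ} (hf : ∀ᵐ v ∂scaledMeasure τ b, evalConj f v = 0) : f = 0 := by
  let F : (Fin 2 → ℝ) → ℂ := fun v => evalConj f (complexScale τ ((3 : ℝ) • v))
  have hF : Continuous F := (continuous_evalConj f).comp (continuous_scale_three τ)
  have h1 : ∀ᵐ v ∂deltoidMeasure, F v = 0 := by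
    have h2 := ae_of_ae_map (continuous_complexScale τ).aemeasurable hf
    exact ae_of_ae_map (continuous_const_smul (3 : ℝ)).aemeasurable
      ((dilatedMeasure_absolutelyContinuous hb).ae_le h2)
  rw [deltoidMeasure, ae_withDensity_iff
    continuous_deltoidPoly.sqrt.measurable.ennreal_ofReal] at h1
  let U : Set (Fin 2 → ℝ) := {v | 0 < deltoidPoly v}
  have hU : IsOpen U := isOpen_lt continuous_const continuous_deltoidPoly
  have hsub : U ⊆ deltoid := fun v hv => (mem_deltoid_iff v).2 (le_of_lt hv)
  have h3 : F =ᵐ[volume.restrict U] fun _ => 0 := by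
    filter_upwards [ae_restrict_of_ae_restrict_of_subset hsub h1, ae_restrict_mem hU.measurableSet]
      with v hv hvU
    exact hv (by
      rw [Ne, ENNReal.ofReal_eq_zero, not_le]
      exact Real.sqrt_pos.2 hvU)
  have h4 := Measure.eqOn_open_of_ae_eq h3 hU hF.continuousOn continuousOn_const
  refine polynomial_eq_zero_of_open (α := τ * 3) (β := starRingEnd ℂ τ * 3)
    (mul_ne_zero hτ (by norm_num)) (mul_ne_zero ((map_ne_zero _).2 hτ) (by norm_num)) hU
    (show 0 < deltoidPoly 0 by norm_num [deltoidPoly]) fun v hv => ?_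
  have h5 : F v = 0 := h4 hv
  have h6 : toComplex ((3 : ℝ) • v) = 3 * toComplex v := by
    simp [toComplex]; ring
  simp only [F, evalConj_complexScale, h6, map_mul, Complex.conj_ofNat] at h5
  rw [← h5, mul_assoc, mul_assoc]

lemma scaledMeasure_ne_zero {τ b : ℂ} (hτ : τ ≠ 0) (hb : ‖b‖ ≤ 1 / 2) : scaledMeasure τ b ≠ 0 := by
  intro h
  refine one_ne_zero (eq_zero_of_ae_evalConj_eq_zero (f := 1) hτ hb ?_)
  rw [h]
  simp

/-! ### Orthogonality -/

lemma one_add_conj_ne_zero {b : ℂ} (hb : ‖b‖ ≤ 1 / 2) : 1 + starRingEnd ℂ b ≠ 0 := by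
  intro h
  have : ‖starRingEnd ℂ b‖ = 1 := by
    rw [show starRingEnd ℂ b = -1 by linear_combination h]; simp
  rw [Complex.norm_conj] at this
  linarith

lemma one_sub_mul_conj_ne_zero {b : ℂ} (hb : ‖b‖ ≤ 1 / 2) : 1 - b * starRingEnd ℂ b ≠ 0 := by
  intro h
  have : ‖b * starRingEnd ℂ b‖ = 1 := by
    rw [show b * starRingEnd ℂ b = 1 by linear_combination -h]; simp
  rw [norm_mul, Complex.norm_conj] at this
  nlinarith [norm_nonneg b]

lemma exists_alternant_mul_bandMinor {b : ℂ} (hb : ‖b‖ ≤ 1 / 2) {m k : ℕ} (hm : 1 ≤ m)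
    (hk : k ≤ m) : ∃ κ : ℂ, ∀ θ, alternant (torusChar θ 0) (torusChar θ 1) (torusChar θ 2) 1 1
      * bandMinor (1 + b) (1 + starRingEnd ℂ b) (toComplex (torusMap θ))
        (starRingEnd ℂ (toComplex (torusMap θ))) m k
      = κ * bandAlternant b (starRingEnd ℂ b) (torusChar θ 0) (torusChar θ 1) (torusChar θ 2)
        (k + 1) (m - k + 1) := by
  rcases hm.eq_or_lt with rfl | hm
  · refine ⟨(1 - b * starRingEnd ℂ b)⁻¹, fun θ => ?_⟩
    rw [conj_toComplex_torusMap, toComplex_torusMap, eq_inv_mul_iff_mul_eq₀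
      (one_sub_mul_conj_ne_zero hb)]
    exact_mod_cast bandMinor_one_eq (torusChar_mul θ) b (starRingEnd ℂ b) hk
  · refine ⟨1, fun θ => ?_⟩
    rw [conj_toComplex_torusMap, toComplex_torusMap, one_mul]
    exact bandMinor_eq (torusChar_mul θ) b _ (one_add_conj_ne_zero hb) hm hk

/-- The squared Jacobian is -1/4 of a squared Vandermonde: one factor turns the minor into
alternants with x + y = m + 2, the other belongs to the test function. -/
lemma integral_bandMinor_mul_monomial {b : ℂ} (hb : ‖b‖ ≤ 1 / 2) {m k : ℕ} (hm : 1 ≤ m)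
    (hk : k ≤ m) {i j : ℕ} (hij : i + j < m) :
    ∫ θ in torusSquare, ((torusJac θ ^ 2 : ℝ) : ℂ) *
      (bandMinor (1 + b) (1 + starRingEnd ℂ b) (toComplex (torusMap θ))
        (starRingEnd ℂ (toComplex (torusMap θ))) m k * (toComplex (torusMap θ) ^ i
        * starRingEnd ℂ (toComplex (torusMap θ)) ^ j)
      * (torusDenom b θ * starRingEnd ℂ (torusDenom b θ))⁻¹) = 0 := by
  obtain ⟨κ, hκ⟩ := exists_alternant_mul_bandMinor hb hm hk
  have h := integral_bandAlternant hb (k + 1) (m - k + 1) i j (by omega)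
  have h' := congrArg (fun x => (-κ / 4) * x) h
  simp only [mul_zero] at h'
  rw [← integral_const_mul] at h'
  rw [← h']
  refine integral_congr_ae (Filter.Eventually.of_forall fun θ => ?_)
  simp only [torusTest]
  have hJ : ((torusJac θ ^ 2 : ℝ) : ℂ)
      = -1 / 4 * alternant (torusChar θ 0) (torusChar θ 1) (torusChar θ 2) 1 1 ^ 2 := by
    rw [alternant_torusChar]
    push_cast
    linear_combination ((torusJac θ : ℂ) ^ 2) * Complex.I_sq
  rw [hJ]
  linear_combination (-1 / 4 * alternant (torusChar θ 0) (torusChar θ 1) (torusChar θ 2) 1 1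
    * (toComplex (torusMap θ) ^ i * starRingEnd ℂ (toComplex (torusMap θ)) ^ j)
    * (torusDenom b θ * starRingEnd ℂ (torusDenom b θ))⁻¹) * hκ θ

theorem isOrthogonalToLower_scaledMeasure {τ b : ℂ} (hτ : τ ≠ 0) (hb : ‖b‖ ≤ 1 / 2) (m : ℕ)
    (k : Fin (m + 1)) : IsOrthogonalToLower (scaledMeasure τ b) m
      (Q (τ ^ 2 / starRingEnd ℂ τ * (1 + b)) (τ ^ 2 / starRingEnd ℂ τ) m k) := by
  intro g hg
  obtain ⟨κ, hκ⟩ := exists_eval_Q_eq hτ b m k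
  set q := Q (τ ^ 2 / starRingEnd ℂ τ * (1 + b)) (τ ^ 2 / starRingEnd ℂ τ) m k with hq
  have hmono : ∀ i j : ℕ, i + j < m → ∫ v, evalConj q v *
      starRingEnd ℂ (evalConj (X 0 ^ i * X 1 ^ j) v) ∂scaledMeasure τ b = 0 := by
    intro i j hij
    have hc : Continuous fun v => evalConj q v *
        starRingEnd ℂ (evalConj (X 0 ^ i * X 1 ^ j) v) :=
      (continuous_evalConj q).mul (Complex.continuous_conj.comp (continuous_evalConj _))
    rw [scaledMeasure, integral_map (continuous_complexScale τ).aemeasurable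
      hc.aestronglyMeasurable]
    have h6 := integral_perturbedMeasure b (hc.comp (continuous_complexScale τ))
    -- Conjugating the test monomial interchanges its two exponents.
    have hz := integral_bandMinor_mul_monomial hb (k := m - k) (by omega) (Nat.sub_le _ _)
      (show j + i < m by omega)
    have hz' := congrArg
      (fun x => (κ * (starRingEnd ℂ τ ^ i * τ ^ j)) * x) hz
    simp only [mul_zero] at hz'
    rw [← integral_const_mul] at hz'
    have h7 : ∫ θ in torusSquare, ((torusJac θ ^ 2 : ℝ) : ℂ) *
        (((fun v => evalConj q v * starRingEnd ℂ (evalConj (X 0 ^ i * X 1 ^ j) v)) ∘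
          complexScale τ) (torusMap θ) *
          (torusDenom b θ * starRingEnd ℂ (torusDenom b θ))⁻¹) = 0 := by
      rw [← hz']
      refine integral_congr_ae (Filter.Eventually.of_forall fun θ => ?_)
      simp only [Function.comp_apply, evalConj_mul, evalConj_pow, evalConj_X_zero, evalConj_X_one,
        map_mul, map_pow, Complex.conj_conj, toComplex_complexScale]
      rw [evalConj_complexScale, hκ]
      ring
    rw [h7, mul_zero] at h6
    exact (mul_eq_zero.1 h6).resolve_left (by norm_num)
  have hexp : ∀ v, evalConj q v * starRingEnd ℂ (evalConj g v) = ∑ d ∈ g.support,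
      starRingEnd ℂ (g.coeff d) * (evalConj q v *
        starRingEnd ℂ (evalConj (X 0 ^ d 0 * X 1 ^ d 1) v)) := by
    intro v
    conv_lhs => rw [eq_sum_monomials g]
    rw [show evalConj (∑ d ∈ g.support, C (g.coeff d) * (X 0 ^ d 0 * X 1 ^ d 1)) v
      = ∑ d ∈ g.support, evalConj (C (g.coeff d) * (X 0 ^ d 0 * X 1 ^ d 1)) v from map_sum _ _ _,
      map_sum, Finset.mul_sum]
    refine Finset.sum_congr rfl fun d _ => ?_
    rw [evalConj_mul, evalConj_C, map_mul]
    ring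
  simp only [hexp]
  rw [integral_finsetSum]
  · refine Finset.sum_eq_zero fun d hd => ?_
    rw [integral_const_mul, hmono _ _ ((degree_le_totalDegree g hd).trans_lt hg), mul_zero]
  · intro d _
    exact integrable_scaledMeasure τ hb (continuous_const.mul ((continuous_evalConj q).mul
      (Complex.continuous_conj.comp (continuous_evalConj _))))

theorem hasGaussianCubature_scaledMeasure {τ b : ℂ} (hτ : τ ≠ 0) (hb : ‖b‖ ≤ 1 / 2) {m : ℕ}
    (hm : 1 ≤ m) : HasGaussianCubature (scaledMeasure τ b) m :=
  hasGaussianCubature_of_orthogonal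
    (fun f g => integrable_scaledMeasure τ hb
      ((Complex.continuous_conj.comp (continuous_evalConj f)).mul (continuous_evalConj g)))
    (fun _ => eq_zero_of_ae_evalConj_eq_zero hτ hb) hm
    (isOrthogonalToLower_scaledMeasure hτ hb m)

/-! ### The scaling factor -/

/-- A solution `τ` of `τ ^ 2 / conj τ = c`. -/
def scaleFactor (c : ℂ) : ℂ := ‖c‖ * Complex.exp ((c.arg / 3 : ℝ) * Complex.I)

lemma scaleFactor_ne_zero {c : ℂ} (hc : c ≠ 0) : scaleFactor c ≠ 0 :=
  mul_ne_zero (by simpa using hc) (Complex.exp_ne_zero _)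

/-- The quotient τ²/conj τ keeps the modulus of τ and triples its argument. -/
lemma scaleFactor_sq_div_conj {c : ℂ} (hc : c ≠ 0) :
    scaleFactor c ^ 2 / starRingEnd ℂ (scaleFactor c) = c := by
  have h1 : starRingEnd ℂ (scaleFactor c) = ‖c‖ * (Complex.exp ((c.arg / 3 : ℝ) * Complex.I))⁻¹ := by
    rw [scaleFactor, map_mul, Complex.conj_ofReal, ← Complex.exp_conj, ← Complex.exp_neg, map_mul,
      Complex.conj_ofReal, Complex.conj_I, mul_neg]
  have h2 : Complex.exp ((c.arg / 3 : ℝ) * Complex.I) ^ 3 = Complex.exp (c.arg * Complex.I) := by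
    rw [← Complex.exp_nat_mul]
    congr 1
    push_cast
    ring
  have h3 : (‖c‖ : ℂ) ≠ 0 := by simpa using hc
  have h4 := Complex.exp_ne_zero ((c.arg / 3 : ℝ) * Complex.I)
  rw [h1, scaleFactor]
  conv_rhs => rw [← Complex.norm_mul_exp_arg_mul_I c, ← h2]
  field_simp

lemma scaleFactor_one : scaleFactor 1 = 1 := by simp [scaleFactor]

end GaussCubature

end

theorem corollary4p4 :
    ∃ μ : ℂ → ℂ → Measure (Fin 2 → ℝ),
      (∀ a c : ℂ, a ≠ 0 → c ≠ 0 → (c * (c - a)).im = 0 → 2 * ‖c - a‖ ≤ ‖c‖ →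
        IsFiniteMeasure (μ a c) ∧ μ a c ≠ 0 ∧ IsCompact (μ a c).support ∧
        (∀ (m : ℕ) (k : Fin (m + 1)),
          GaussCubature.IsOrthogonalToLower (μ a c) m (GaussCubature.Q a c m k)) ∧
        ∀ m : ℕ, 1 ≤ m → GaussCubature.HasGaussianCubature (μ a c) m) ∧
      μ 1 1 = GaussCubature.deltoidMeasure.map (fun v => (3 : ℝ) • v) := by
  -- With b = a/c - 1 the bound 2|c - a| ≤ |c| is exactly |b| ≤ 1/2, and c(1 + b) = a recovers the
  -- given polynomials.
  refine ⟨fun a c => GaussCubature.scaledMeasure (GaussCubature.scaleFactor c) (a / c - 1),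
    fun a c _ hc _ hac => ?_, ?_⟩
  · have hb : ‖a / c - 1‖ ≤ 1 / 2 := by
      rw [div_sub_one hc, norm_div, div_le_iff₀ (norm_pos_iff.2 hc), norm_sub_rev]
      linarith
    have hτ := GaussCubature.scaleFactor_ne_zero hc
    refine ⟨GaussCubature.isFiniteMeasure_scaledMeasure _ hb,
      GaussCubature.scaledMeasure_ne_zero hτ hb, GaussCubature.isCompact_support_scaledMeasure _ _,
      fun m k => ?_, fun m hm => GaussCubature.hasGaussianCubature_scaledMeasure hτ hb hm⟩
    have h := GaussCubature.isOrthogonalToLower_scaledMeasure hτ hb m k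
    rwa [GaussCubature.scaleFactor_sq_div_conj hc, add_sub_cancel, mul_div_cancel₀ _ hc] at h
  -- At a = c = 1 there is no rotation and b = 0, so the density is 1.
  · simp only [GaussCubature.scaleFactor_one, div_one, sub_self, GaussCubature.scaledMeasure,
      GaussCubature.complexScale_one, Measure.map_id, GaussCubature.perturbedMeasure_zero]
    rfl
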